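/- Manifolds are smooth, Hausdorff, finite-dimensional and without boundary. For a manifold $M$ let $C^k(M;R)$ be the group of $R$-valued cochains on smooth singular $k$-simplices ($C^{-1}=0$) and $\Omega^k(M)$ the smooth $k$-forms, which are regarded as elements of $C^k(M;\mathbb R)$ by integration over simplices. For an integer $s$ with $s>0$, the complex of differential cochains of height $s$ is $$DC^k_s(M)=\{(c,h,\omega)\in C^k(M;\mathbb Z)\times C^{k-1}(M;\mathbb R)\times\Omega^k(M)\mid \omega=0\text{ if }k<s\},\qquad d(c,h,\omega)=(dc,\ \omega-c-dh,\ d\omega).$$ It is a presheaf of cochain complexes on the category of manifolds. For a cochain complex $A^*$ in non-negative degrees, the cocycle 2-category $\mathcal H^3(A^*)$ has as objects the $c\in A^3$ with $dc=0$, as 1-arrows $c_1\to c_2$ the $b\in A^2$ with $c_1-c_2=db$, and as 2-arrows $b_1\Rightarrow b_2$ the classes $[a]\in A^1/dA^0$ with $b_2-b_1=da$; all compositions are given by addition, and all identities are $0$. Put $\mathcal{DC}^3_s(M)=\mathcal H^3(DC^*_s(M))$. Let $\mathcal U=\{U_\alpha\}_{\alpha\in I}$ be an open cover of $M$, let $U_n=\coprod_{(\alpha_0,\dots,\alpha_n)\in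 I^{n+1}}U_{\alpha_0}\cap\dots\cap U_{\alpha_n}$, let $\partial_i:U_{n+1}\to U_n$ be the map that omits $\alpha_i$, and let $\pi:U_0\to M$ be the projection. The descent bicategory $\mathcal{DC}^3_s(U_\bullet)$ is the following. * Objects are triples $(A,E,\tau)$ of an object $A$ of $\mathcal{DC}^3_s(U_0)$, a 1-arrow $E:\partial_0^*A\to\partial_1^*A$ of $\mathcal{DC}^3_s(U_1)$, and a 2-arrow $\tau:\partial_2^*E\circ\partial_0^*E\Rightarrow\partial_1^*E$ of $\mathcal{DC}^3_s(U_2)$ such that $\partial_2^*\tau\circ(\mathrm{id}\star\partial_0^*\tau)=\partial_1^*\tau\circ(\partial_3^*\tau\star\mathrm{id})$ in $\mathcal{DC}^3_s(U_3)$. * 1-arrows $(A,E,\tau)\to(A',E',\tau')$ are pairs $(F,\alpha)$ of a 1-arrow $F:A\to A'$ and a 2-arrow $\alpha:E'\circ\partial_0^*F\Rightarrow\partial_1^*F\circ E$ such that $(\mathrm{id}\star\tau)\circ(\partial_2^*\alpha\star\mathrm{id})\circ(\mathrm{id}\star\partial_0^*\alpha)=\partial_1^*\alpha\circ(\tau'\star\mathrm{id})$.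 * 2-arrows $(F,\alpha)\Rightarrow(F',\alpha')$ are 2-arrows $\beta:F\Rightarrow F'$ such that $\alpha'\circ(\mathrm{id}\star\partial_0^*\beta)=(\partial_1^*\beta\star\mathrm{id})\circ\alpha$. **Theorem.** For every integer $s>0$ the presheaf of bicategories $\mathcal{DC}^3_s$ is a 2-stack over manifolds: for every second countable manifold $M$ and every open cover of $M$, the restriction 2-functor $$\pi^*:\mathcal{DC}^3_s(M)\to\mathcal{DC}^3_s(U_\bullet),\qquad c\mapsto(\pi^*c,\mathrm{id},\mathrm{id}),\quad b\mapsto(\pi^*b,\mathrm{id}),\quad [a]\mapsto[\pi^*a],$$ is an equivalence of bicategories, i.e. it is an equivalence on all Hom-categories and every object of $\mathcal{DC}^3_s(U_\bullet)$ is equivalent to one in its image. -/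

import Mathlib

open CategoryTheory Set Filter MeasureTheory
open scoped Manifold ContDiff Topology

universe u

namespace DiffCocycle

/-! ### Differential forms on manifolds -/

section Forms

variable {E : Type*} [NormedAddCommGroup E] [NormedSpace ℝ E]
  {M : Type*} [TopologicalSpace M] [ChartedSpace E M]
  {F : Type*} [NormedAddCommGroup F] [NormedSpace ℝ F]
  {N : Type*} [TopologicalSpace N] [ChartedSpace F N]
  {G : Type*} [NormedAddCommGroup G] [NormedSpace ℝ G]
  {P : Type*} [TopologicalSpace P] [ChartedSpace G P]
  {k : ℕ}

variable (E M k) in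
/-- A (not necessarily smooth) section of `Λᵏ T*M`. -/
abbrev FormField : Type _ :=
  ∀ x : M, TangentSpace 𝓘(ℝ, E) x [⋀^Fin k]→L[ℝ] ℝ

/-- Pointwise pullback `(p^*η)_y = η_{p y} ∘ (dp_y × ⋯ × dp_y)`. -/
noncomputable def pullForm (p : N → M) (η : FormField E M k) : FormField F N k :=
  fun y ↦ (η (p y)).compContinuousLinearMap (mfderiv 𝓘(ℝ, F) 𝓘(ℝ, E) p y)

/-- The pullback of `η` to a normed space, with the tangent spaces of the latter identified with the
space itself. -/
noncomputable def plotForm (p : F → M) (η : FormField E M k) : F → F [⋀^Fin k]→L[ℝ] ℝ :=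
  fun y ↦ pullForm (N := F) p η y

/-- A section of `Λᵏ T*M` is smooth if its coefficients in each of the preferred charts are. -/
def IsSmoothForm (η : FormField E M k) : Prop :=
  ∀ x₀ : M, ContDiffOn ℝ ∞ (plotForm (extChartAt 𝓘(ℝ, E) x₀).symm η) (extChartAt 𝓘(ℝ, E) x₀).target

/-- The exterior derivative, computed at `x` in the preferred chart at `x`. -/
noncomputable def extD (η : FormField E M k) : FormField E M (k + 1) :=
  fun x ↦ (extDeriv (plotForm (extChartAt 𝓘(ℝ, E) x).symm η)
    (extChartAt 𝓘(ℝ, E) x x)).compContinuousLinearMap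
      (mfderiv 𝓘(ℝ, E) 𝓘(ℝ, E) (extChartAt 𝓘(ℝ, E) x) x)

/-- Alternatization as a continuous linear map. -/
noncomputable def altCLM (F : Type*) [NormedAddCommGroup F] [NormedSpace ℝ F] (k : ℕ) :
    ContinuousMultilinearMap ℝ (fun _ : Fin k ↦ F) ℝ →L[ℝ] F [⋀^Fin k]→L[ℝ] ℝ :=
  LinearMap.mkContinuous
    { toFun := ContinuousMultilinearMap.alternatization
      map_add' := map_add _
      map_smul' := fun c f ↦ by
        ext v
        simp [ContinuousMultilinearMap.alternatization_apply_apply, Finset.mul_sum,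
          mul_smul_comm] }
    (Fintype.card (Equiv.Perm (Fin k))) (fun f ↦ by
      refine ContinuousAlternatingMap.opNorm_le_bound _ (by positivity) fun v ↦ ?_
      simp only [LinearMap.coe_mk, AddHom.coe_mk,
        ContinuousMultilinearMap.alternatization_apply_apply]
      refine (norm_sum_le _ _).trans ?_
      rw [mul_assoc, ← nsmul_eq_mul]
      refine Finset.sum_le_card_nsmul _ _ _ fun σ _ ↦ ?_
      have h1 : ‖Equiv.Perm.sign σ • f (v ∘ σ)‖ = ‖f (v ∘ σ)‖ := by
        rcases Int.units_eq_one_or (Equiv.Perm.sign σ) with h | h <;> simp [h]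
      refine h1.le.trans ((f.le_opNorm _).trans_eq ?_)
      congr 1
      exact Equiv.prod_comp σ fun i ↦ ‖v i‖)

theorem altCLM_coe (f : F [⋀^Fin k]→L[ℝ] ℝ) :
    ((Fintype.card (Equiv.Perm (Fin k)) : ℝ)⁻¹) • altCLM F k f.toContinuousMultilinearMap = f := by
  ext v
  have h : ∀ σ : Equiv.Perm (Fin k), Equiv.Perm.sign σ • f (v ∘ σ) = f v := fun σ ↦ by
    rw [show f (v ∘ σ) = Equiv.Perm.sign σ • f v from f.toAlternatingMap.map_perm v σ, smul_smul, Int.units_mul_self, one_smul]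
  have h2 : altCLM F k f.toContinuousMultilinearMap v
      = ∑ σ : Equiv.Perm (Fin k), Equiv.Perm.sign σ • f (v ∘ σ) :=
    ContinuousMultilinearMap.alternatization_apply_apply _ _
  rw [ContinuousAlternatingMap.smul_apply, h2, Finset.sum_congr rfl fun σ _ ↦ h σ]
  simp only [Finset.sum_const, Finset.card_univ, nsmul_eq_mul, smul_eq_mul]
  rw [inv_mul_cancel_left₀]
  exact Nat.cast_ne_zero.2 Fintype.card_ne_zero

theorem contDiffAt_compCLM {η : F → E [⋀^Fin k]→L[ℝ] ℝ} {A : F → F →L[ℝ] E} {y : F}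
    (hη : ContDiffAt ℝ ∞ η y) (hA : ContDiffAt ℝ ∞ A y) :
    ContDiffAt ℝ ∞ (fun z ↦ (η z).compContinuousLinearMap (A z)) y := by
  have h1 : ContDiffAt ℝ ∞ (fun z ↦ (ContinuousMultilinearMap.compContinuousLinearMap
      (η z).toContinuousMultilinearMap (fun _ ↦ A z))) y := by
    have := (ContinuousMultilinearMap.analyticAt_uncurry_compContinuousLinearMap (𝕜 := ℝ)
      (Fm := fun _ : Fin k ↦ F) (Em := fun _ : Fin k ↦ E) (G := ℝ)
      (q := (fun _ ↦ A y, (η y).toContinuousMultilinearMap))).contDiffAt (n := ∞)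
    exact this.comp y ((contDiffAt_pi.2 fun _ ↦ hA).prodMk
      ((ContinuousAlternatingMap.toContinuousMultilinearMapCLM ℝ).contDiff.contDiffAt.comp y hη))
  have h2 := ((altCLM F k).contDiff.contDiffAt.comp y h1).const_smul
    ((Fintype.card (Equiv.Perm (Fin k)) : ℝ)⁻¹)
  refine h2.congr_of_eventuallyEq (Eventually.of_forall fun z ↦ ?_)
  exact (altCLM_coe _).symm

theorem minSmoothness_le : minSmoothness ℝ 2 ≤ (∞ : WithTop ℕ∞) := by
  simp only [minSmoothness_of_isRCLikeNormedField]
  exact WithTop.coe_le_coe.2 (le_top : (2 : ℕ∞) ≤ ⊤)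

theorem pullForm_comp {g : P → N} {f : N → M} {z : P} (η : FormField E M k)
    (hf : MDifferentiableAt 𝓘(ℝ, F) 𝓘(ℝ, E) f (g z))
    (hg : MDifferentiableAt 𝓘(ℝ, G) 𝓘(ℝ, F) g z) :
    pullForm (F := G) g (pullForm (F := F) f η) z = pullForm (F := G) (f ∘ g) η z := by
  simp only [pullForm]
  rw [mfderiv_comp z hf hg]
  rfl


variable [IsManifold 𝓘(ℝ, F) ∞ N]

theorem plotForm_pullForm {f : N → M} (η : FormField E M k)
    (hf : ContMDiff 𝓘(ℝ, F) 𝓘(ℝ, E) ∞ f) {p : G → N} {y : G}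
    (hp : ContMDiffAt 𝓘(ℝ, G) 𝓘(ℝ, F) ∞ p y) :
    plotForm p (pullForm (F := F) f η) =ᶠ[𝓝 y] plotForm (f ∘ p) η := by
  have hd : ∀ᶠ z in 𝓝 y, ContMDiffAt 𝓘(ℝ, G) 𝓘(ℝ, F) 1 p z :=
    (contMDiffAt_iff_contMDiffAt_nhds (by simp)).1 (hp.of_le (by simp))
  filter_upwards [hd] with z hz
  exact pullForm_comp η (hf.mdifferentiableAt (by simp)) (hz.mdifferentiableAt (by simp))

variable [IsManifold 𝓘(ℝ, E) ∞ M]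

theorem contDiffAt_chart_comp {p : F → M} {y : F} {x₀ : M}
    (hp : ContMDiffAt 𝓘(ℝ, F) 𝓘(ℝ, E) ∞ p y) (hx : p y ∈ (extChartAt 𝓘(ℝ, E) x₀).source) :
    ContDiffAt ℝ ∞ (extChartAt 𝓘(ℝ, E) x₀ ∘ p) y := by
  rw [← contMDiffAt_iff_contDiffAt]
  exact (contMDiffAt_extChartAt' (by simpa using hx)).comp y hp

theorem plotForm_eventuallyEq {p : F → M} {y : F} {x₀ : M} (η : FormField E M k)
    (hp : ContMDiffAt 𝓘(ℝ, F) 𝓘(ℝ, E) ∞ p y) (hx : p y ∈ (extChartAt 𝓘(ℝ, E) x₀).source) :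
    plotForm p η =ᶠ[𝓝 y] fun z ↦
      (plotForm (extChartAt 𝓘(ℝ, E) x₀).symm η
        ((extChartAt 𝓘(ℝ, E) x₀ ∘ p) z)).compContinuousLinearMap
          (fderiv ℝ (extChartAt 𝓘(ℝ, E) x₀ ∘ p) z) := by
  have hs : ∀ᶠ z in 𝓝 y, p z ∈ (extChartAt 𝓘(ℝ, E) x₀).source :=
    hp.continuousAt.eventually ((isOpen_extChartAt_source x₀).mem_nhds hx)
  have hd : ∀ᶠ z in 𝓝 y, ContMDiffAt 𝓘(ℝ, F) 𝓘(ℝ, E) 1 p z :=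
    (contMDiffAt_iff_contMDiffAt_nhds (by simp)).1 (hp.of_le (by simp))
  filter_upwards [hs, hs.eventually_nhds, hd] with z hz hz' hdz
  have hpz : MDifferentiableAt 𝓘(ℝ, F) 𝓘(ℝ, E) p z := hdz.mdifferentiableAt (by simp)
  have he : MDifferentiableAt 𝓘(ℝ, E) 𝓘(ℝ, E) (extChartAt 𝓘(ℝ, E) x₀) (p z) :=
    mdifferentiableAt_extChartAt (by simpa using hz)
  have hes : MDifferentiableAt 𝓘(ℝ, E) 𝓘(ℝ, E) (extChartAt 𝓘(ℝ, E) x₀).symm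
      ((extChartAt 𝓘(ℝ, E) x₀ ∘ p) z) :=
    ((contMDiffOn_extChartAt_symm (n := ∞) x₀).contMDiffAt ((isOpen_extChartAt_target x₀).mem_nhds
      ((extChartAt 𝓘(ℝ, E) x₀).map_source hz))).mdifferentiableAt (by simp)
  have heq : (extChartAt 𝓘(ℝ, E) x₀).symm ∘ (extChartAt 𝓘(ℝ, E) x₀ ∘ p) =ᶠ[𝓝 z] p := by
    filter_upwards [hz'] with w hw using (extChartAt 𝓘(ℝ, E) x₀).left_inv hw
  have h1 := pullForm_comp (k := k) η hes (he.comp z hpz)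
  have h2 : pullForm (F := F) ((extChartAt 𝓘(ℝ, E) x₀).symm ∘ (extChartAt 𝓘(ℝ, E) x₀ ∘ p)) η z =
      pullForm (F := F) p η z := by
    simp only [pullForm]
    rw [heq.mfderiv_eq]
    have : ((extChartAt 𝓘(ℝ, E) x₀).symm ∘ (extChartAt 𝓘(ℝ, E) x₀ ∘ p)) z = p z :=
      heq.self_of_nhds
    rw [this]
  have h3 : fderiv ℝ (extChartAt 𝓘(ℝ, E) x₀ ∘ p) z =
      mfderiv 𝓘(ℝ, F) 𝓘(ℝ, E) (extChartAt 𝓘(ℝ, E) x₀ ∘ p) z := mfderiv_eq_fderiv.symm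
  rw [h3]
  exact (h1.trans h2).symm

theorem IsSmoothForm.contDiffAt_plotForm {η : FormField E M k} (hη : IsSmoothForm η) {p : F → M}
    {y : F} (hp : ContMDiffAt 𝓘(ℝ, F) 𝓘(ℝ, E) ∞ p y) : ContDiffAt ℝ ∞ (plotForm p η) y := by
  have hx : p y ∈ (extChartAt 𝓘(ℝ, E) (p y)).source := mem_extChartAt_source _
  refine ContDiffAt.congr_of_eventuallyEq ?_ (plotForm_eventuallyEq η hp hx)
  have hq := contDiffAt_chart_comp hp hx
  refine contDiffAt_compCLM (ContDiffAt.comp y ?_ hq) ?_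
  · exact (hη (p y)).contDiffAt ((isOpen_extChartAt_target _).mem_nhds (mem_extChartAt_target _))
  · exact hq.fderiv_right (by simp)

theorem IsSmoothForm.extDeriv_plotForm {η : FormField E M k} (hη : IsSmoothForm η) {p : F → M}
    {y : F} (hp : ContMDiffAt 𝓘(ℝ, F) 𝓘(ℝ, E) ∞ p y) :
    extDeriv (plotForm p η) y = plotForm p (extD η) y := by
  have hx : p y ∈ (extChartAt 𝓘(ℝ, E) (p y)).source := mem_extChartAt_source _
  have hq := contDiffAt_chart_comp hp hx
  rw [(plotForm_eventuallyEq η hp hx).extDeriv_eq,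
    extDeriv_pullback (r := ∞) _ hq minSmoothness_le]
  · have h1 : fderiv ℝ (extChartAt 𝓘(ℝ, E) (p y) ∘ p) y =
        (mfderiv 𝓘(ℝ, E) 𝓘(ℝ, E) (extChartAt 𝓘(ℝ, E) (p y)) (p y)).comp
          (mfderiv 𝓘(ℝ, F) 𝓘(ℝ, E) p y) := by
      rw [← mfderiv_eq_fderiv]
      exact mfderiv_comp y (mdifferentiableAt_extChartAt (by simp)) (hp.mdifferentiableAt (by simp))
    rw [h1]
    rfl
  · exact ((hη (p y)).contDiffAt ((isOpen_extChartAt_target _).mem_nhds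
      (mem_extChartAt_target _))).differentiableAt (by simp)

theorem contMDiffAt_extChartAt_symm' {x₀ : M} {y : E} (hy : y ∈ (extChartAt 𝓘(ℝ, E) x₀).target) :
    ContMDiffAt 𝓘(ℝ, E) 𝓘(ℝ, E) ∞ (extChartAt 𝓘(ℝ, E) x₀).symm y :=
  (contMDiffOn_extChartAt_symm x₀).contMDiffAt ((isOpen_extChartAt_target x₀).mem_nhds hy)

theorem contDiffAt_extDeriv {η : F → F [⋀^Fin k]→L[ℝ] ℝ} {y : F} (h : ContDiffAt ℝ ∞ η y) :
    ContDiffAt ℝ ∞ (extDeriv η) y := by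
  have h1 := (ContinuousAlternatingMap.alternatizeUncurryFinCLM (n := k) ℝ F ℝ).contDiff
    (n := ∞) |>.contDiffAt.comp y (h.fderiv_right (m := ∞) (by simp))
  exact h1

theorem IsSmoothForm.extD {η : FormField E M k} (hη : IsSmoothForm η) : IsSmoothForm (extD η) := by
  intro x₀
  refine ContDiffOn.congr (f := extDeriv (plotForm (extChartAt 𝓘(ℝ, E) x₀).symm η)) ?_ ?_
  · intro y hy
    exact (contDiffAt_extDeriv
      (hη.contDiffAt_plotForm (contMDiffAt_extChartAt_symm' hy))).contDiffWithinAt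
  · intro y hy
    exact (hη.extDeriv_plotForm (contMDiffAt_extChartAt_symm' hy)).symm

theorem IsSmoothForm.pullForm {η : FormField E M k} (hη : IsSmoothForm η) {f : N → M}
    (hf : ContMDiff 𝓘(ℝ, F) 𝓘(ℝ, E) ∞ f) : IsSmoothForm (pullForm (F := F) f η) := by
  intro x₀ y hy
  have hp := contMDiffAt_extChartAt_symm' hy
  exact (ContDiffAt.congr_of_eventuallyEq (hη.contDiffAt_plotForm (hf.contMDiffAt.comp y hp))
    (plotForm_pullForm η hf hp)).contDiffWithinAt

theorem IsSmoothForm.extD_pullForm {η : FormField E M k} (hη : IsSmoothForm η) {f : N → M}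
    (hf : ContMDiff 𝓘(ℝ, F) 𝓘(ℝ, E) ∞ f) :
    DiffCocycle.extD (DiffCocycle.pullForm (F := F) f η) =
      DiffCocycle.pullForm (F := F) f (DiffCocycle.extD η) := by
  funext x
  have hx := mem_extChartAt_target (I := 𝓘(ℝ, F)) x
  have hp := contMDiffAt_extChartAt_symm' hx
  have h1 : extDeriv (plotForm (extChartAt 𝓘(ℝ, F) x).symm (DiffCocycle.pullForm (F := F) f η))
      (extChartAt 𝓘(ℝ, F) x x) =
      plotForm (extChartAt 𝓘(ℝ, F) x).symm (DiffCocycle.pullForm (F := F) f (DiffCocycle.extD η))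
        (extChartAt 𝓘(ℝ, F) x x) := by
    rw [(plotForm_pullForm η hf hp).extDeriv_eq,
      hη.extDeriv_plotForm (hf.contMDiffAt.comp _ hp)]
    exact ((plotForm_pullForm _ hf hp).self_of_nhds).symm
  have h2 := pullForm_comp (z := x) (DiffCocycle.pullForm (F := F) f (DiffCocycle.extD η))
    (hp.mdifferentiableAt (by simp)) (mdifferentiableAt_extChartAt (mem_chart_source F x))
  have heq : (extChartAt 𝓘(ℝ, F) x).symm ∘ (extChartAt 𝓘(ℝ, F) x) =ᶠ[𝓝 x] id := by
    filter_upwards [(isOpen_extChartAt_source (I := 𝓘(ℝ, F)) x).mem_nhds (mem_extChartAt_source x)]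
      with w hw using (extChartAt 𝓘(ℝ, F) x).left_inv hw
  have h3 : ∀ ζ : FormField F N (k + 1),
      DiffCocycle.pullForm (F := F) ((extChartAt 𝓘(ℝ, F) x).symm ∘ (extChartAt 𝓘(ℝ, F) x)) ζ x =
        ζ x := by
    intro ζ
    simp only [DiffCocycle.pullForm]
    rw [heq.mfderiv_eq, mfderiv_id]
    have : ((extChartAt 𝓘(ℝ, F) x).symm ∘ (extChartAt 𝓘(ℝ, F) x)) x = x := heq.self_of_nhds
    rw [this]
    rfl
  rw [← h3 (DiffCocycle.pullForm (F := F) f (DiffCocycle.extD η)), ← h2]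
  simp only [DiffCocycle.extD]
  rw [h1]
  rfl

theorem IsSmoothForm.extD_extD {η : FormField E M k} (hη : IsSmoothForm η) :
    DiffCocycle.extD (DiffCocycle.extD η) = 0 := by
  funext x
  have hx := mem_extChartAt_target (I := 𝓘(ℝ, E)) x
  have h : plotForm (extChartAt 𝓘(ℝ, E) x).symm (DiffCocycle.extD η) =ᶠ[𝓝 (extChartAt 𝓘(ℝ, E) x x)]
      extDeriv (plotForm (extChartAt 𝓘(ℝ, E) x).symm η) := by
    filter_upwards [(isOpen_extChartAt_target (I := 𝓘(ℝ, E)) x).mem_nhds hx] with y hy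
    exact (hη.extDeriv_plotForm (contMDiffAt_extChartAt_symm' hy)).symm
  rw [DiffCocycle.extD, h.extDeriv_eq, extDeriv_extDeriv_apply
    (hη.contDiffAt_plotForm (contMDiffAt_extChartAt_symm' hx)) minSmoothness_le]
  rfl

variable (E M k) in
/-- The space `Ωᵏ(M)` of smooth `k`-forms. -/
noncomputable def Form : AddSubgroup (FormField E M k) where
  carrier := {η | IsSmoothForm η}
  zero_mem' := fun x₀ ↦ by
    have : plotForm (extChartAt 𝓘(ℝ, E) x₀).symm (0 : FormField E M k) = 0 := rfl
    rw [this]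
    exact contDiffOn_const
  add_mem' := fun {a b} ha hb x₀ ↦ (ha x₀).add (hb x₀)
  neg_mem' := fun {a} ha x₀ ↦ (ha x₀).neg

/-- The exterior derivative `d : Ωᵏ(M) → Ωᵏ⁺¹(M)`. -/
noncomputable def Form.d : Form E M k →+ Form E M (k + 1) where
  toFun η := ⟨extD η.1, η.2.extD⟩
  map_zero' := by
    ext x : 2
    have : plotForm (extChartAt 𝓘(ℝ, E) x).symm (0 : FormField E M k) = 0 := rfl
    simp only [extD, ZeroMemClass.coe_zero, this]
    rw [show (0 : E → E [⋀^Fin k]→L[ℝ] ℝ) = (0 : ℝ) • 0 by simp, extDeriv_smul, zero_smul]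
    rfl
  map_add' := fun a b ↦ by
    ext x : 2
    have hx := mem_extChartAt_target (I := 𝓘(ℝ, E)) x
    have h : plotForm (extChartAt 𝓘(ℝ, E) x).symm (a.1 + b.1) =
      plotForm (extChartAt 𝓘(ℝ, E) x).symm a.1 + plotForm (extChartAt 𝓘(ℝ, E) x).symm b.1 := rfl
    have hd : ∀ c : Form E M k, DifferentiableAt ℝ (plotForm (extChartAt 𝓘(ℝ, E) x).symm c.1)
        (extChartAt 𝓘(ℝ, E) x x) := fun c ↦
      (c.2.contDiffAt_plotForm (contMDiffAt_extChartAt_symm' hx)).differentiableAt (by simp)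
    simp only [extD, AddSubgroup.coe_add, h, extDeriv_add (hd a) (hd b)]
    rfl

/-- The pullback `f^* : Ωᵏ(M) → Ωᵏ(N)` along a smooth map `f : N → M`. -/
noncomputable def Form.pull (f : N → M) (hf : ContMDiff 𝓘(ℝ, F) 𝓘(ℝ, E) ∞ f) :
    Form E M k →+ Form F N k where
  toFun η := ⟨pullForm f η.1, η.2.pullForm hf⟩
  map_zero' := rfl
  map_add' _ _ := rfl

end Forms


/-! ### Smooth singular cochains and integration of forms -/

section Simplices

variable {E : Type*} [NormedAddCommGroup E] [NormedSpace ℝ E]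
  {M : Type*} [TopologicalSpace M] [ChartedSpace E M]
  {F : Type*} [NormedAddCommGroup F] [NormedSpace ℝ F]
  {N : Type*} [TopologicalSpace N] [ChartedSpace F N]
  {k : ℕ}

variable (E M k) in
/-- A smooth singular `k`-simplex of `M`: a map from the standard simplex (in barycentric
coordinates) that extends to a smooth map on a neighbourhood of the simplex. -/
@[ext]
structure SmoothSimplex where
  toFun : stdSimplex ℝ (Fin (k + 1)) → M
  exists_ext : ∃ (U : Set (Fin (k + 1) → ℝ)) (f : (Fin (k + 1) → ℝ) → M), IsOpen U ∧
    stdSimplex ℝ (Fin (k + 1)) ⊆ U ∧ ContMDiffOn 𝓘(ℝ, Fin (k + 1) → ℝ) 𝓘(ℝ, E) ∞ f U ∧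
      ∀ x, f x.1 = toFun x

/-- The `i`-th face inclusion, in barycentric coordinates. -/
noncomputable def faceIncl (i : Fin (k + 1)) : (Fin k → ℝ) →L[ℝ] (Fin (k + 1) → ℝ) :=
  LinearMap.toContinuousLinearMap
    { toFun := fun x ↦ i.insertNth (0 : ℝ) x
      map_add' := fun x y ↦ by
        ext j; refine Fin.succAboveCases i ?_ (fun j ↦ ?_) j <;> simp
      map_smul' := fun c x ↦ by
        ext j; refine Fin.succAboveCases i ?_ (fun j ↦ ?_) j <;> simp }

theorem faceIncl_apply (i : Fin (k + 1)) (x : Fin k → ℝ) :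
    faceIncl i x = i.insertNth (α := fun _ ↦ ℝ) (0 : ℝ) x := rfl

theorem faceIncl_mem (i : Fin (k + 1)) {x : Fin k → ℝ} (hx : x ∈ stdSimplex ℝ (Fin k)) :
    faceIncl i x ∈ stdSimplex ℝ (Fin (k + 1)) := by
  rw [faceIncl_apply]
  refine ⟨fun j ↦ ?_, ?_⟩
  · refine Fin.succAboveCases i ?_ (fun j ↦ ?_) j
    · simp
    · simpa using hx.1 j
  · rw [Fin.sum_univ_succAbove _ i]
    simpa using hx.2

/-- The `i`-th face of a smooth singular simplex. -/
noncomputable def SmoothSimplex.face (i : Fin (k + 2)) (σ : SmoothSimplex E M (k + 1)) :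
    SmoothSimplex E M k where
  toFun x := σ.toFun ⟨faceIncl i x.1, faceIncl_mem i x.2⟩
  exists_ext := by
    obtain ⟨U, f, hU, hs, hf, he⟩ := σ.exists_ext
    refine ⟨faceIncl i ⁻¹' U, f ∘ faceIncl i, hU.preimage (faceIncl i).continuous,
      fun x hx ↦ hs (faceIncl_mem i hx), ?_, fun x ↦ he ⟨_, faceIncl_mem i x.2⟩⟩
    exact hf.comp (faceIncl i).contDiff.contMDiff.contMDiffOn fun x hx ↦ hx

/-- The image of a smooth singular simplex under a smooth map. -/
def SmoothSimplex.push (f : N → M) (hf : ContMDiff 𝓘(ℝ, F) 𝓘(ℝ, E) ∞ f)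
    (σ : SmoothSimplex F N k) : SmoothSimplex E M k where
  toFun x := f (σ.toFun x)
  exists_ext := by
    obtain ⟨U, g, hU, hs, hg, he⟩ := σ.exists_ext
    exact ⟨U, f ∘ g, hU, hs, hf.comp_contMDiffOn hg, fun x ↦ congrArg f (he x)⟩

variable (E M k) in
/-- The group `Cᵏ(M; R)` of smooth singular cochains. -/
abbrev SCochain (R : Type*) : Type _ := SmoothSimplex E M k → R

/-- The singular coboundary `(dc)(σ) = ∑ᵢ (-1)ⁱ c(∂ᵢσ)`. -/
noncomputable def SCochain.d {R : Type*} [AddCommGroup R] :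
    SCochain E M k R →+ SCochain E M (k + 1) R where
  toFun c := fun σ ↦ ∑ i : Fin (k + 2), (-1 : ℤ) ^ (i : ℕ) • c (σ.face i)
  map_zero' := by ext; simp
  map_add' a b := by ext; simp [Finset.sum_add_distrib]

/-- The pullback of smooth singular cochains. -/
def SCochain.pull {R : Type*} [AddCommGroup R] (f : N → M)
    (hf : ContMDiff 𝓘(ℝ, F) 𝓘(ℝ, E) ∞ f) : SCochain E M k R →+ SCochain F N k R where
  toFun c := fun σ ↦ c (σ.push f hf)
  map_zero' := rfl
  map_add' _ _ := rfl

theorem SCochain.d_pull {R : Type*} [AddCommGroup R] (f : N → M)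
    (hf : ContMDiff 𝓘(ℝ, F) 𝓘(ℝ, E) ∞ f) (c : SCochain E M k R) :
    SCochain.d (SCochain.pull f hf c) = SCochain.pull f hf (SCochain.d c) := rfl

theorem succAbove_comm {i j : Fin (k + 2)} (h : i ≤ j) (l : Fin (k + 1)) :
    j.succ.succAbove (i.succAbove l) = i.castSucc.succAbove (j.succAbove l) := by
  have h' : (i : ℕ) ≤ j := h
  simp only [Fin.succAbove, Fin.lt_def, Fin.ext_iff]
  split_ifs <;> simp_all <;> omega

theorem succ_succAbove_of_le {i j : Fin (k + 2)} (h : i ≤ j) :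
    j.succ.succAbove i = i.castSucc :=
  Fin.succAbove_of_castSucc_lt _ _ (Fin.castSucc_lt_succ_iff.2 h)

theorem faceIncl_comm {i j : Fin (k + 2)} (h : i ≤ j) (x : Fin (k + 1) → ℝ) :
    faceIncl j.succ (faceIncl i x) = faceIncl i.castSucc (faceIncl j x) := by
  simp only [faceIncl_apply]
  refine Fin.insertNth_eq_iff.2 ⟨?_, Fin.insertNth_eq_iff.2 ⟨?_, ?_⟩⟩
  · rw [← Fin.succAbove_castSucc_of_le i j h]
    simp
  · rw [Fin.removeNth, succ_succAbove_of_le h]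
    simp
  · funext l
    simp only [Fin.removeNth]
    rw [succAbove_comm h]
    simp

/-- The cancellation in a double alternating sum over pairs of faces. -/
theorem alternating_sum_cancel {R : Type*} [AddCommGroup R] {n : ℕ}
    (g : Fin (n + 3) → Fin (n + 2) → R)
    (hg : ∀ i j : Fin (n + 2), i ≤ j → g j.succ i = g i.castSucc j) :
    ∑ i : Fin (n + 3), ∑ j : Fin (n + 2), ((-1 : ℤ) ^ (i : ℕ) * (-1) ^ (j : ℕ)) • g i j = 0 := by
  rw [Finset.sum_comm, ← Finset.sum_product']
  let P := Fin (n + 2) × Fin (n + 3)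
  let S : Finset P := {ij : P | (ij.2 : ℕ) ≤ (ij.1 : ℕ)}
  rw [Finset.univ_product_univ, ← Finset.sum_add_sum_compl S, ← eq_neg_iff_add_eq_zero,
    ← Finset.sum_neg_distrib]
  let φ : ∀ ij : P, ij ∈ S → P := fun ij hij =>
    (Fin.castLT ij.2 (lt_of_le_of_lt (Finset.mem_filter.mp hij).right (Fin.is_lt ij.1)), ij.1.succ)
  apply Finset.sum_bij φ
  · intro ij hij
    simp_rw [S, φ, Finset.compl_filter, Finset.mem_filter_univ, Fin.val_succ,
      Fin.val_castLT] at hij ⊢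
    lia
  · rintro ⟨i, j⟩ hij ⟨i', j'⟩ hij' h
    rw [Prod.mk_inj]
    exact ⟨by simpa [φ] using! congr_arg Prod.snd h,
      by simpa [φ, Fin.castSucc_castLT] using! congr_arg Fin.castSucc (congr_arg Prod.fst h)⟩
  · rintro ⟨i', j'⟩ hij'
    simp_rw [S, Finset.compl_filter, Finset.mem_filter_univ, not_le] at hij'
    refine ⟨(j'.pred <| ?_, Fin.castSucc i'), ?_, ?_⟩
    · rintro rfl
      simp only [Fin.val_zero, not_lt_zero] at hij'
    · simpa [S] using! Nat.le_sub_one_of_lt hij'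
    · simp only [φ, Fin.castLT_castSucc, Fin.succ_pred]
  · rintro ⟨i, j⟩ hij
    have hle : (j : ℕ) ≤ i := by simpa [S] using hij
    have hj : (j : ℕ) < n + 2 := lt_of_le_of_lt hle i.2
    have h1 := hg (Fin.castLT j hj) i hle
    rw [Fin.castSucc_castLT] at h1
    simp only [φ, Fin.val_succ, Fin.val_castLT]
    rw [h1, ← neg_smul]
    congr 1
    rw [pow_succ]
    ring

theorem SmoothSimplex.face_face {i j : Fin (k + 2)} (h : i ≤ j)
    (σ : SmoothSimplex E M (k + 2)) :
    (σ.face j.succ).face i = (σ.face i.castSucc).face j := by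
  ext x
  simp only [SmoothSimplex.face, faceIncl_comm h]

theorem SCochain.d_d {R : Type*} [AddCommGroup R] (c : SCochain E M k R) :
    SCochain.d (SCochain.d c) = 0 := by
  funext σ
  have h := alternating_sum_cancel (fun (i : Fin (k + 3)) (j : Fin (k + 2)) ↦ c ((σ.face i).face j))
    (fun i j hij ↦ by rw [SmoothSimplex.face_face hij])
  simpa [SCochain.d, Finset.smul_sum, smul_smul] using h

/-- The simplex `{x ∈ ℝᵏ | xᵢ ≥ 0, ∑ xᵢ ≤ 1}`. -/
def solidSimplex (k : ℕ) : Set (Fin k → ℝ) := {x | (∀ i, 0 ≤ x i) ∧ ∑ i, x i ≤ 1}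

/-- The affine parametrization `x ↦ (1 - ∑ xᵢ, x₁, …, x_k)` of the standard simplex. -/
def param (x : Fin k → ℝ) : Fin (k + 1) → ℝ := Fin.cons (1 - ∑ i, x i) x

theorem param_mem {x : Fin k → ℝ} (hx : x ∈ solidSimplex k) :
    param x ∈ stdSimplex ℝ (Fin (k + 1)) := by
  refine ⟨fun i ↦ ?_, by simp [param, Fin.sum_univ_succ]⟩
  refine Fin.cases ?_ (fun i ↦ ?_) i
  · simpa [param] using hx.2
  · simpa [param] using hx.1 i

theorem contDiff_param : ContDiff ℝ ∞ (param (k := k)) := by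
  refine contDiff_pi.2 fun i ↦ ?_
  refine Fin.cases ?_ (fun i ↦ ?_) i
  · simp only [param, Fin.cons_zero]; fun_prop
  · simp only [param, Fin.cons_succ]; fun_prop

/-- `∫ g^*η` over the `k`-simplex in `ℝᵏ`. -/
noncomputable def integralAlong (g : (Fin k → ℝ) → M) (η : FormField E M k) : ℝ :=
  ∫ x in solidSimplex k, plotForm g η x fun i ↦ Pi.single i 1

/-- A smooth extension of a singular simplex to the ambient space of the standard simplex. -/
noncomputable def SmoothSimplex.extension (σ : SmoothSimplex E M k) : (Fin (k + 1) → ℝ) → M :=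
  σ.exists_ext.choose_spec.choose

/-- The integral `∫_σ η`; it does not depend on the chosen extension of `σ`. -/
noncomputable def SmoothSimplex.integral (σ : SmoothSimplex E M k) (η : FormField E M k) : ℝ :=
  integralAlong (σ.extension ∘ param) η

theorem isClosed_solidSimplex : IsClosed (solidSimplex k) := by
  have : solidSimplex k = (⋂ i, {x | 0 ≤ x i}) ∩ {x | ∑ i, x i ≤ 1} := by
    ext; simp [solidSimplex]
  rw [this]
  refine (isClosed_iInter fun i ↦ isClosed_le (by fun_prop) (by fun_prop)).inter
    (isClosed_le (by fun_prop) (by fun_prop))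

theorem convex_solidSimplex : Convex ℝ (solidSimplex k) := by
  intro x hx y hy a b ha hb hab
  refine ⟨fun i ↦ ?_, ?_⟩
  · have := hx.1 i; have := hy.1 i
    simp only [Pi.add_apply, Pi.smul_apply, smul_eq_mul]; positivity
  · have h1 := hx.2
    have h2 := hy.2
    simp only [Pi.add_apply, Pi.smul_apply, smul_eq_mul, Finset.sum_add_distrib, ← Finset.mul_sum]
    nlinarith

theorem isCompact_solidSimplex : IsCompact (solidSimplex k) := by
  refine Metric.isCompact_of_isClosed_isBounded isClosed_solidSimplex ?_
  refine (Metric.isBounded_Icc (0 : Fin k → ℝ) 1).subset fun x hx ↦ ⟨fun i ↦ hx.1 i, fun i ↦ ?_⟩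
  exact (Finset.single_le_sum (fun j _ ↦ hx.1 j) (Finset.mem_univ i)).trans hx.2

theorem integralAlong_congr {g g' : (Fin k → ℝ) → M} (h : EqOn g g' (solidSimplex k))
    (η : FormField E M k) : integralAlong g η = integralAlong g' η := by
  refine setIntegral_congr_ae isClosed_solidSimplex.measurableSet ?_
  have h0 : ∀ᵐ x ∂(volume : Measure (Fin k → ℝ)), x ∉ frontier (solidSimplex k) :=
    measure_eq_zero_iff_ae_notMem.1 (convex_solidSimplex.addHaar_frontier volume)
  filter_upwards [h0] with x hx hxs
  have hi : x ∈ interior (solidSimplex k) := by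
    by_contra hc
    exact hx ⟨subset_closure hxs, hc⟩
  have heq : g =ᶠ[𝓝 x] g' := by
    filter_upwards [mem_interior_iff_mem_nhds.1 hi] with y hy using h hy
  simp only [plotForm, pullForm]
  rw [heq.mfderiv_eq, heq.self_of_nhds]

theorem SmoothSimplex.extension_spec (σ : SmoothSimplex E M k) :
    ∃ U : Set (Fin (k + 1) → ℝ), IsOpen U ∧ stdSimplex ℝ (Fin (k + 1)) ⊆ U ∧
      ContMDiffOn 𝓘(ℝ, Fin (k + 1) → ℝ) 𝓘(ℝ, E) ∞ σ.extension U ∧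
      ∀ x, σ.extension x.1 = σ.toFun x :=
  ⟨_, σ.exists_ext.choose_spec.choose_spec⟩

theorem SmoothSimplex.contMDiffAt_extension (σ : SmoothSimplex E M k) {x : Fin k → ℝ}
    (hx : x ∈ solidSimplex k) :
    ContMDiffAt 𝓘(ℝ, Fin k → ℝ) 𝓘(ℝ, E) ∞ (σ.extension ∘ param) x := by
  obtain ⟨U, hU, hs, hf, -⟩ := σ.extension_spec
  exact (hf.contMDiffAt (hU.mem_nhds (hs (param_mem hx)))).comp x
    contDiff_param.contMDiff.contMDiffAt

theorem SmoothSimplex.integral_push [IsManifold 𝓘(ℝ, F) ∞ N] (f : N → M)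
    (hf : ContMDiff 𝓘(ℝ, F) 𝓘(ℝ, E) ∞ f) (σ : SmoothSimplex F N k) (η : FormField E M k) :
    (σ.push f hf).integral η = σ.integral (pullForm (F := F) f η) := by
  have h1 : (σ.push f hf).integral η = integralAlong (f ∘ (σ.extension ∘ param)) η := by
    refine integralAlong_congr (fun x hx ↦ ?_) η
    obtain ⟨_, _, _, _, h⟩ := σ.extension_spec
    obtain ⟨_, _, _, _, h'⟩ := (σ.push f hf).extension_spec
    simp only [Function.comp_apply]
    rw [h ⟨_, param_mem hx⟩, h' ⟨_, param_mem hx⟩]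
    rfl
  rw [h1]
  refine setIntegral_congr_fun isClosed_solidSimplex.measurableSet fun x hx ↦ ?_
  have := (plotForm_pullForm η hf (σ.contMDiffAt_extension hx)).self_of_nhds
  simp only [this]

end Simplices


/-! ### Stokes' theorem for smooth singular simplices

It is what makes the differential cochains a complex. -/

section Stokes

variable {k : ℕ}

/-- The linear part `x ↦ (-∑ xᵢ, x₁, …, x_k)` of `param`. -/
noncomputable def paramLin (k : ℕ) : (Fin k → ℝ) →L[ℝ] (Fin (k + 1) → ℝ) :=
  LinearMap.toContinuousLinearMap
    { toFun := fun x ↦ Fin.cons (-∑ i, x i) x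
      map_add' := fun x y ↦ by
        ext j; refine Fin.cases ?_ (fun j ↦ ?_) j <;> simp [Finset.sum_add_distrib]; ring
      map_smul' := fun c x ↦ by
        ext j; refine Fin.cases ?_ (fun j ↦ ?_) j <;> simp [Finset.mul_sum] }

theorem paramLin_apply (x : Fin k → ℝ) :
    paramLin k x = Fin.cons (α := fun _ ↦ ℝ) (-∑ i, x i) x := rfl

theorem param_eq (x : Fin k → ℝ) : param x = paramLin k x + Pi.single 0 1 := by
  ext j
  refine Fin.cases ?_ (fun j ↦ ?_) j <;> simp [param, paramLin_apply]
  ring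

theorem hasFDerivAt_param (x : Fin k → ℝ) : HasFDerivAt param (paramLin k) x := by
  have h : param = fun x ↦ paramLin k x + Pi.single 0 1 := funext param_eq
  rw [h]
  exact (paramLin k).hasFDerivAt.add_const _

theorem paramLin_single (l : Fin k) :
    paramLin k (Pi.single l 1) = Pi.single l.succ 1 - Pi.single 0 1 := by
  ext j
  refine Fin.cases ?_ (fun j ↦ ?_) j
  · simp [paramLin_apply]
  · simp [paramLin_apply, Pi.single_apply]

theorem faceIncl_single (i : Fin (k + 1)) (l : Fin k) :
    faceIncl i (Pi.single l 1) = Pi.single (i.succAbove l) 1 := by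
  ext j
  rw [faceIncl_apply]
  refine Fin.succAboveCases i ?_ (fun j ↦ ?_) j
  · simp [Fin.ne_succAbove]
  · simp [Pi.single_apply]

/-- The tail of a tuple with prescribed sum recovers the tuple. -/
theorem paramLin_tail {z : Fin (k + 1) → ℝ} (hz : ∑ i, z i = 0) :
    paramLin k (Fin.tail z) = z := by
  rw [Fin.sum_univ_succ] at hz
  ext j
  refine Fin.cases ?_ (fun j ↦ ?_) j
  · simp only [paramLin_apply, Fin.cons_zero, Fin.tail]; linarith
  · simp [paramLin_apply, Fin.tail]

theorem param_tail {z : Fin (k + 1) → ℝ} (hz : ∑ i, z i = 1) : param (Fin.tail z) = z := by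
  rw [Fin.sum_univ_succ] at hz
  ext j
  refine Fin.cases ?_ (fun j ↦ ?_) j
  · simp only [param, Fin.cons_zero, Fin.tail]; linarith
  · simp [param, Fin.tail]

theorem sum_paramLin (x : Fin k → ℝ) : ∑ i, paramLin k x i = 0 := by
  rw [paramLin_apply, Fin.sum_univ_succ]; simp

theorem sum_param (x : Fin k → ℝ) : ∑ i, param x i = 1 := by
  simp [param, Fin.sum_univ_succ]

/-- The linear part of the affine map of the simplex that permutes the vertices. -/
noncomputable def permLin (π : Equiv.Perm (Fin (k + 1))) : (Fin k → ℝ) →ₗ[ℝ] (Fin k → ℝ) :=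
  (LinearMap.funLeft ℝ ℝ Fin.succ).comp ((LinearMap.funLeft ℝ ℝ π).comp (paramLin k).toLinearMap)

theorem permLin_apply (π : Equiv.Perm (Fin (k + 1))) (x : Fin k → ℝ) :
    permLin π x = Fin.tail (paramLin k x ∘ π) := rfl

theorem permLin_mul (π ρ : Equiv.Perm (Fin (k + 1))) :
    permLin (ρ * π) = permLin π ∘ₗ permLin ρ := by
  ext1 x
  ext1
  simp only [LinearMap.comp_apply, LinearMap.coe_single, permLin_apply]
  rw [paramLin_tail]
  · rfl
  · rw [← sum_paramLin (Pi.single x (1 : ℝ))]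
    exact Equiv.sum_comp ρ _

theorem permLin_one : permLin (1 : Equiv.Perm (Fin (k + 1))) = LinearMap.id := by
  ext1 x
  ext1
  simp only [LinearMap.comp_apply, LinearMap.coe_single, permLin_apply]
  rfl

theorem abs_det_permLin (π : Equiv.Perm (Fin (k + 1))) : |LinearMap.det (permLin π)| = 1 := by
  let δ : Equiv.Perm (Fin (k + 1)) →* ℝ :=
    { toFun := fun π ↦ LinearMap.det (permLin π)
      map_one' := by rw [permLin_one, LinearMap.det_id]
      map_mul' := fun π ρ ↦ by rw [permLin_mul, LinearMap.det_comp, mul_comm] }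
  have h : δ π ^ orderOf π = 1 := by rw [← map_pow, pow_orderOf_eq_one, map_one]
  have h2 : |δ π| ^ orderOf π = 1 := by rw [← abs_pow, h, abs_one]
  exact (pow_eq_one_iff_of_nonneg (abs_nonneg _) (orderOf_pos π).ne').1 h2

/-- The affine map of the simplex that permutes the vertices. -/
noncomputable def permMap (π : Equiv.Perm (Fin (k + 1))) (x : Fin k → ℝ) : Fin k → ℝ :=
  Fin.tail (param x ∘ π)

theorem param_permMap (π : Equiv.Perm (Fin (k + 1))) (x : Fin k → ℝ) :
    param (permMap π x) = param x ∘ π := by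
  refine param_tail ?_
  rw [← sum_param x]
  exact Equiv.sum_comp π _

theorem permMap_permMap (π ρ : Equiv.Perm (Fin (k + 1))) (x : Fin k → ℝ) :
    permMap π (permMap ρ x) = permMap (ρ * π) x := by
  rw [permMap, param_permMap]; rfl

theorem permMap_one (x : Fin k → ℝ) : permMap (1 : Equiv.Perm (Fin (k + 1))) x = x := by
  ext; rfl

theorem param_mem_iff {x : Fin k → ℝ} :
    param x ∈ stdSimplex ℝ (Fin (k + 1)) ↔ x ∈ solidSimplex k := by
  refine ⟨fun h ↦ ⟨fun i ↦ ?_, ?_⟩, param_mem⟩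
  · simpa [param] using h.1 i.succ
  · simpa [param] using h.1 0

theorem permMap_mem {π : Equiv.Perm (Fin (k + 1))} {x : Fin k → ℝ} (hx : x ∈ solidSimplex k) :
    permMap π x ∈ solidSimplex k := by
  have := param_mem hx
  rw [← param_mem_iff, param_permMap]
  exact ⟨fun i ↦ this.1 _, by rw [← this.2]; exact Equiv.sum_comp π _⟩

theorem hasFDerivAt_permMap (π : Equiv.Perm (Fin (k + 1))) (x : Fin k → ℝ) :
    HasFDerivAt (permMap π) (LinearMap.toContinuousLinearMap (permLin π)) x := by
  have h : permMap π = fun x ↦ LinearMap.toContinuousLinearMap (permLin π) x +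
      Fin.tail ((Pi.single 0 1 : Fin (k + 1) → ℝ) ∘ π) := by
    funext x
    simp only [permMap, param_eq, LinearMap.coe_toContinuousLinearMap', permLin_apply]
    rfl
  rw [h]
  exact (LinearMap.toContinuousLinearMap (permLin π)).hasFDerivAt.add_const _

theorem integral_permMap (π : Equiv.Perm (Fin (k + 1))) (g : (Fin k → ℝ) → ℝ) :
    ∫ x in solidSimplex k, g (permMap π x) = ∫ x in solidSimplex k, g x := by
  have hinj : InjOn (permMap π) (solidSimplex k) := fun x _ y _ h ↦ by
    have := congrArg (permMap π⁻¹) h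
    simpa [permMap_permMap, permMap_one] using this
  have himg : permMap π '' solidSimplex k = solidSimplex k := by
    refine Subset.antisymm (image_subset_iff.2 fun x hx ↦ permMap_mem hx) fun x hx ↦ ?_
    refine ⟨permMap π⁻¹ x, permMap_mem hx, ?_⟩
    simp [permMap_permMap, permMap_one]
  have h := integral_image_eq_integral_abs_det_fderiv_smul volume
    (isClosed_solidSimplex (k := k)).measurableSet
    (fun x _ ↦ (hasFDerivAt_permMap π x).hasFDerivWithinAt) hinj g
  rw [himg] at h
  rw [h]
  refine setIntegral_congr_fun isClosed_solidSimplex.measurableSet fun x _ ↦ ?_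
  simp [ContinuousLinearMap.det, abs_det_permLin]

theorem integral_insertNth (i : Fin (k + 1)) (h : (Fin (k + 1) → ℝ) → ℝ) :
    ∫ x in solidSimplex k, h (i.insertNth (α := fun _ ↦ ℝ) (1 - ∑ j, x j) x) =
      ∫ x in solidSimplex k, h (param x) := by
  rw [← integral_permMap i.cycleRange fun x ↦ h (param x)]
  refine setIntegral_congr_fun isClosed_solidSimplex.measurableSet fun x _ ↦ ?_
  simp only [param_permMap]
  congr 1
  exact (Fin.cons_comp_cycleRange (1 - ∑ j, x j) x i).symm

theorem insertNth_mem_iff (i : Fin (k + 1)) {t : ℝ} {y : Fin k → ℝ} :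
    i.insertNth (α := fun _ ↦ ℝ) t y ∈ solidSimplex (k + 1) ↔
      y ∈ solidSimplex k ∧ t ∈ Icc 0 (1 - ∑ j, y j) := by
  have h1 : (∀ j, 0 ≤ i.insertNth (α := fun _ ↦ ℝ) t y j) ↔ 0 ≤ t ∧ ∀ j, 0 ≤ y j := by
    rw [Fin.forall_iff_succAbove i]; simp
  have h2 : ∑ j, i.insertNth (α := fun _ ↦ ℝ) t y j = t + ∑ j, y j := by
    rw [Fin.sum_univ_succAbove _ i]; simp
  simp only [solidSimplex, mem_ofPred_eq, h1, h2, mem_Icc]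
  constructor
  · rintro ⟨⟨a, b⟩, c⟩; exact ⟨⟨b, by linarith⟩, a, by linarith⟩
  · rintro ⟨⟨a, b⟩, c, d⟩; exact ⟨⟨c, a⟩, by linarith⟩

theorem insertNth_eq (i : Fin (k + 1)) (t : ℝ) (y : Fin k → ℝ) :
    i.insertNth (α := fun _ ↦ ℝ) t y = faceIncl i y + t • Pi.single i 1 := by
  ext j
  rw [faceIncl_apply]
  refine Fin.succAboveCases i ?_ (fun j ↦ ?_) j
  · simp
  · simp [Fin.succAbove_ne]

theorem integral_partial (i : Fin (k + 1)) {g : (Fin (k + 1) → ℝ) → ℝ}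
    (hg : ∀ x ∈ solidSimplex (k + 1), ContDiffAt ℝ ∞ g x) :
    IntegrableOn (fun x ↦ fderiv ℝ g x (Pi.single i 1)) (solidSimplex (k + 1)) ∧
    ∫ x in solidSimplex (k + 1), fderiv ℝ g x (Pi.single i 1) =
      (∫ y in solidSimplex k, g (param y)) - ∫ y in solidSimplex k, g (faceIncl i y) := by
  have hc : ContinuousOn (fun x ↦ fderiv ℝ g x (Pi.single i 1)) (solidSimplex (k + 1)) := by
    intro x hx
    exact (((hg x hx).fderiv_right (m := ∞) (by simp)).continuousAt.clm_apply
      continuousAt_const).continuousWithinAt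
  have hint : IntegrableOn (fun x ↦ fderiv ℝ g x (Pi.single i 1)) (solidSimplex (k + 1)) :=
    hc.integrableOn_compact isCompact_solidSimplex
  refine ⟨hint, ?_⟩
  have hcg : ∀ {n : ℕ} (p : (Fin n → ℝ) → (Fin (k + 1) → ℝ)), Continuous p →
      (∀ x ∈ solidSimplex n, p x ∈ solidSimplex (k + 1)) →
      IntegrableOn (fun y ↦ g (p y)) (solidSimplex n) := fun p hp hm ↦
    ContinuousOn.integrableOn_compact isCompact_solidSimplex fun x hx ↦
      ((hg _ (hm x hx)).continuousAt.comp hp.continuousAt).continuousWithinAt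
  have hsum : ∀ y ∈ solidSimplex k, 0 ≤ 1 - ∑ j, y j := fun y hy ↦ sub_nonneg.2 hy.2
  have h1 : ∀ y ∈ solidSimplex k, ∫ t in Icc 0 (1 - ∑ j, y j),
      fderiv ℝ g (i.insertNth (α := fun _ ↦ ℝ) t y) (Pi.single i 1) =
        g (i.insertNth (α := fun _ ↦ ℝ) (1 - ∑ j, y j) y) - g (faceIncl i y) := by
    intro y hy
    have hmem : ∀ t ∈ Icc 0 (1 - ∑ j, y j),
        i.insertNth (α := fun _ ↦ ℝ) t y ∈ solidSimplex (k + 1) := fun t ht ↦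
      (insertNth_mem_iff i).2 ⟨hy, ht⟩
    have hcont : Continuous fun t : ℝ ↦ i.insertNth (α := fun _ ↦ ℝ) t y := by
      simp only [insertNth_eq]; fun_prop
    rw [integral_Icc_eq_integral_Ioc, ← intervalIntegral.integral_of_le (hsum y hy)]
    rw [intervalIntegral.integral_eq_sub_of_hasDerivAt
      (f := fun t ↦ g (i.insertNth (α := fun _ ↦ ℝ) t y))]
    · rfl
    · intro t ht
      rw [uIcc_of_le (hsum y hy)] at ht
      have hd : HasDerivAt (fun t : ℝ ↦ i.insertNth (α := fun _ ↦ ℝ) t y) (Pi.single i 1) t := by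
        simp only [insertNth_eq]
        simpa using ((hasDerivAt_id t).smul_const (Pi.single i (1 : ℝ))).const_add (faceIncl i y)
      exact ((hg _ (hmem t ht)).differentiableAt (by simp)).hasFDerivAt.comp_hasDerivAt t hd
    · refine ContinuousOn.intervalIntegrable ?_
      rw [uIcc_of_le (hsum y hy)]
      exact hc.comp hcont.continuousOn hmem
  have h2 : ∫ x in solidSimplex (k + 1), fderiv ℝ g x (Pi.single i 1) =
      ∫ y in solidSimplex k, ∫ t in Icc 0 (1 - ∑ j, y j),
        fderiv ℝ g (i.insertNth (α := fun _ ↦ ℝ) t y) (Pi.single i 1) := by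
    have hS := (isClosed_solidSimplex (k := k + 1)).measurableSet
    have hS' := (isClosed_solidSimplex (k := k)).measurableSet
    rw [← integral_indicator hS, ← integral_indicator hS']
    have hmp := (volume_preserving_piFinSuccAbove (fun _ : Fin (k + 1) ↦ ℝ) i).symm
    rw [← integrable_indicator_iff hS] at hint
    rw [← hmp.integral_comp', Measure.volume_eq_prod, integral_prod_symm]
    · refine integral_congr_ae (Eventually.of_forall fun y ↦ ?_)
      change ∫ t, (solidSimplex (k + 1)).indicator (fun x ↦ fderiv ℝ g x (Pi.single i 1))
        (i.insertNth (α := fun _ ↦ ℝ) t y) = _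
      by_cases hy : y ∈ solidSimplex k
      · rw [indicator_of_mem hy, ← integral_indicator measurableSet_Icc]
        refine integral_congr_ae (Eventually.of_forall fun t ↦ ?_)
        have hiff := insertNth_mem_iff i (t := t) (y := y)
        by_cases ht : t ∈ Icc 0 (1 - ∑ j, y j)
        · simp only [indicator_of_mem ht, indicator_of_mem (hiff.2 ⟨hy, ht⟩)]
        · simp only [indicator_of_notMem ht, indicator_of_notMem fun h ↦ ht (hiff.1 h).2]
      · rw [indicator_of_notMem hy]
        simp [insertNth_mem_iff, hy]
    · exact (hmp.integrable_comp_emb (MeasurableEquiv.measurableEmbedding _)).2 hint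
  rw [h2, setIntegral_congr_fun isClosed_solidSimplex.measurableSet h1, integral_sub,
    integral_insertNth]
  · refine hcg (fun y ↦ i.insertNth (α := fun _ ↦ ℝ) (1 - ∑ j, y j) y) ?_ fun y hy ↦
      (insertNth_mem_iff i).2 ⟨hy, hsum y hy, le_rfl⟩
    simp only [insertNth_eq]; fun_prop
  · refine hcg (faceIncl i) (faceIncl i).continuous fun y hy ↦ ?_
    exact (insertNth_mem_iff i).2 ⟨hy, le_rfl, hsum y hy⟩

theorem map_paramLin (θ : (Fin (k + 1) → ℝ) [⋀^Fin k]→L[ℝ] ℝ) :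
    θ (fun l ↦ paramLin k (Pi.single l 1)) =
      ∑ i : Fin (k + 1), (-1 : ℝ) ^ (i : ℕ) * θ (i.removeNth (α := fun _ ↦ Fin (k + 1) → ℝ)
        fun j ↦ Pi.single j 1) := by
  let φ : (Fin (k + 1) → ℝ) →L[ℝ] ℝ := ∑ j, ContinuousLinearMap.proj j
  let Θ := ContinuousAlternatingMap.alternatizeUncurryFin (φ.smulRight θ)
  have hΘ : ∀ v, Θ v = ∑ i : Fin (k + 1), (-1 : ℝ) ^ (i : ℕ) * (φ (v i) * θ (i.removeNth v)) := by
    intro v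
    simp [Θ, ContinuousAlternatingMap.alternatizeUncurryFin_apply]
  have hφ : ∀ j, φ (Pi.single j 1) = 1 := fun j ↦ by simp [φ]
  let w : Fin (k + 1) → (Fin (k + 1) → ℝ) :=
    Fin.cons (Pi.single 0 1) fun l ↦ paramLin k (Pi.single l 1)
  have h1 : Θ w = θ (fun l ↦ paramLin k (Pi.single l 1)) := by
    rw [hΘ, Fin.sum_univ_succ, Finset.sum_eq_zero]
    · simp [w, hφ, Fin.removeNth_zero]
    · intro l _
      have : φ (w l.succ) = 0 := by simp [w, paramLin_single, hφ]
      rw [this]; simp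
  have h2 : Θ w = Θ fun j ↦ Pi.single j 1 := by
    have hb := Θ.toAlternatingMap.eq_smul_basis_det (Pi.basisFun ℝ (Fin (k + 1)))
    have h3 : Θ w = Θ.toAlternatingMap w := rfl
    rw [h3, hb]
    have h4 : (Pi.basisFun ℝ (Fin (k + 1))).det w = 1 := by
      rw [Module.Basis.det_apply, ← Matrix.det_transpose]
      rw [Matrix.det_eq_of_forall_row_eq_smul_add_const (B := 1)
        (Fin.cons 0 fun _ ↦ -1) 0 (by simp) ?_, Matrix.det_one]
      intro a b
      refine Fin.cases ?_ (fun a ↦ ?_) a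
      · simp [w, Module.Basis.toMatrix_apply, Pi.single_apply, Matrix.one_apply, eq_comm]
      · simp [w, Module.Basis.toMatrix_apply, paramLin_single, Pi.single_apply, Matrix.one_apply,
          eq_comm, sub_eq_add_neg]
        split_ifs <;> simp
    simp only [AlternatingMap.smul_apply, h4, smul_eq_mul, mul_one]
    change Θ _ = Θ _
    congr 1
    funext j
    exact Pi.basisFun_apply ℝ (Fin (k + 1)) j
  rw [← h1, h2, hΘ]
  simp [hφ]

variable {E : Type*} [NormedAddCommGroup E] [NormedSpace ℝ E]
  {M : Type*} [TopologicalSpace M] [ChartedSpace E M]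

theorem plotForm_comp {n m : ℕ} {p : (Fin m → ℝ) → M} {ψ : (Fin n → ℝ) → (Fin m → ℝ)}
    {ψ' : (Fin n → ℝ) →L[ℝ] (Fin m → ℝ)} {y : Fin n → ℝ} (η : FormField E M k)
    (hp : ContMDiffAt 𝓘(ℝ, Fin m → ℝ) 𝓘(ℝ, E) ∞ p (ψ y)) (hψ : HasFDerivAt ψ ψ' y) :
    plotForm (p ∘ ψ) η y = (plotForm p η (ψ y)).compContinuousLinearMap ψ' := by
  have h := pullForm_comp η (hp.mdifferentiableAt (by simp)) hψ.differentiableAt.mdifferentiableAt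
  have h2 : mfderiv 𝓘(ℝ, Fin n → ℝ) 𝓘(ℝ, Fin m → ℝ) ψ y = ψ' := by
    rw [mfderiv_eq_fderiv]; exact hψ.fderiv
  rw [plotForm, ← h, ← h2]
  rfl

theorem SmoothSimplex.integral_face_zero (σ : SmoothSimplex E M (k + 1)) (η : FormField E M k) :
    (σ.face 0).integral η = integralAlong ((σ.extension ∘ param) ∘ param) η := by
  refine integralAlong_congr (fun x hx ↦ ?_) η
  obtain ⟨_, _, _, _, h⟩ := σ.extension_spec
  obtain ⟨_, _, _, _, h'⟩ := (σ.face 0).extension_spec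
  simp only [Function.comp_apply]
  rw [h' ⟨_, param_mem hx⟩]
  simp only [SmoothSimplex.face]
  rw [← h]
  congr 1
  simp only [faceIncl_apply, Fin.insertNth_zero']
  rw [param.eq_1 (param x), sum_param, sub_self]

theorem SmoothSimplex.integral_face_succ (σ : SmoothSimplex E M (k + 1)) (η : FormField E M k)
    (i : Fin (k + 1)) :
    (σ.face i.succ).integral η = integralAlong ((σ.extension ∘ param) ∘ faceIncl i) η := by
  refine integralAlong_congr (fun x hx ↦ ?_) η
  obtain ⟨_, _, _, _, h⟩ := σ.extension_spec
  obtain ⟨_, _, _, _, h'⟩ := (σ.face i.succ).extension_spec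
  simp only [Function.comp_apply]
  rw [h' ⟨_, param_mem hx⟩]
  simp only [SmoothSimplex.face]
  rw [← h]
  congr 1
  have hs : ∑ j, faceIncl i x j = ∑ j, x j := by
    rw [faceIncl_apply, Fin.sum_univ_succAbove _ i]; simp
  simp only [param, hs]
  simp only [faceIncl_apply]
  exact Fin.insertNth_succ_cons _ _ _ _

theorem SmoothSimplex.stokes [IsManifold 𝓘(ℝ, E) ∞ M] (σ : SmoothSimplex E M (k + 1)) {η : FormField E M k}
    (hη : IsSmoothForm η) :
    σ.integral (extD η) = ∑ i : Fin (k + 2), (-1 : ℤ) ^ (i : ℕ) • (σ.face i).integral η := by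
  set p := σ.extension ∘ param with hpdef
  have hp : ∀ x ∈ solidSimplex (k + 1), ContMDiffAt 𝓘(ℝ, Fin (k + 1) → ℝ) 𝓘(ℝ, E) ∞ p x :=
    fun x hx ↦ σ.contMDiffAt_extension hx
  have hθ : ∀ x ∈ solidSimplex (k + 1), ContDiffAt ℝ ∞ (plotForm p η) x :=
    fun x hx ↦ hη.contDiffAt_plotForm (hp x hx)
  let e : Fin (k + 1) → (Fin (k + 1) → ℝ) := fun j ↦ Pi.single j 1
  let g : Fin (k + 1) → (Fin (k + 1) → ℝ) → ℝ := fun i x ↦ plotForm p η x (i.removeNth e)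
  have hg : ∀ i, ∀ x ∈ solidSimplex (k + 1), ContDiffAt ℝ ∞ (g i) x := by
    intro i x hx
    exact (ContinuousAlternatingMap.apply ℝ (Fin (k + 1) → ℝ) ℝ
      (i.removeNth e)).contDiff.contDiffAt.comp x (hθ x hx)
  have hmemp : ∀ y ∈ solidSimplex k, param y ∈ solidSimplex (k + 1) := fun y hy ↦
    ⟨fun j ↦ (param_mem hy).1 j, (sum_param y).le⟩
  have hmemf : ∀ (i : Fin (k + 1)), ∀ y ∈ solidSimplex k, faceIncl i y ∈ solidSimplex (k + 1) :=
    fun i y hy ↦ (insertNth_mem_iff i).2 ⟨hy, le_rfl, sub_nonneg.2 hy.2⟩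
  have h1 : σ.integral (extD η) = ∑ i : Fin (k + 1), (-1 : ℝ) ^ (i : ℕ) *
      ((∫ y in solidSimplex k, g i (param y)) - ∫ y in solidSimplex k, g i (faceIncl i y)) := by
    have h : ∀ x ∈ solidSimplex (k + 1), plotForm p (extD η) x e =
        ∑ i : Fin (k + 1), (-1 : ℝ) ^ (i : ℕ) * fderiv ℝ (g i) x (Pi.single i 1) := by
      intro x hx
      rw [← hη.extDeriv_plotForm (hp x hx),
        extDeriv_apply ((hθ x hx).differentiableAt (by simp))]
      simp [g, e]
    rw [SmoothSimplex.integral, integralAlong,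
      setIntegral_congr_fun isClosed_solidSimplex.measurableSet h, integral_finsetSum]
    · refine Finset.sum_congr rfl fun i _ ↦ ?_
      rw [integral_const_mul, (integral_partial i (hg i)).2]
    · intro i _
      exact (integral_partial i (hg i)).1.const_mul _
  have h2 : (σ.face 0).integral η =
      ∑ i : Fin (k + 1), (-1 : ℝ) ^ (i : ℕ) * ∫ y in solidSimplex k, g i (param y) := by
    have h : ∀ y ∈ solidSimplex k, plotForm (p ∘ param) η y (fun l ↦ Pi.single l 1) =
        ∑ i : Fin (k + 1), (-1 : ℝ) ^ (i : ℕ) * g i (param y) := by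
      intro y hy
      rw [plotForm_comp η (hp _ (hmemp y hy)) (hasFDerivAt_param y)]
      exact map_paramLin (plotForm p η (param y))
    rw [σ.integral_face_zero, integralAlong,
      setIntegral_congr_fun isClosed_solidSimplex.measurableSet h, integral_finsetSum]
    · exact Finset.sum_congr rfl fun i _ ↦ integral_const_mul _ _
    · intro i _
      refine Integrable.const_mul ?_ _
      exact ContinuousOn.integrableOn_compact isCompact_solidSimplex fun y hy ↦
        ((hg i _ (hmemp y hy)).continuousAt.comp
          contDiff_param.continuous.continuousAt).continuousWithinAt
  have h3 : ∀ i : Fin (k + 1), (σ.face i.succ).integral η =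
      ∫ y in solidSimplex k, g i (faceIncl i y) := by
    intro i
    rw [σ.integral_face_succ]
    refine setIntegral_congr_fun isClosed_solidSimplex.measurableSet fun y hy ↦ ?_
    simp only [← hpdef]
    rw [plotForm_comp η (hp _ (hmemf i y hy)) (faceIncl i).hasFDerivAt]
    simp only [ContinuousAlternatingMap.compContinuousLinearMap_apply, g]
    congr 1
    funext l
    exact faceIncl_single i l
  rw [Fin.sum_univ_succ, h1, h2]
  simp only [h3, mul_sub, Finset.sum_sub_distrib]
  simp [pow_succ, sub_eq_add_neg, Finset.sum_neg_distrib]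

end Stokes


/-! ### The category of manifolds -/

/-- A smooth Hausdorff manifold without boundary. Second countability is not part of the structure,
so that the disjoint union of the members of any open cover is again an object. -/
structure Mfld : Type (u + 1) where
  carrier : Type u
  dim : ℕ
  [top : TopologicalSpace carrier]
  [t2 : T2Space carrier]
  [charted : ChartedSpace (EuclideanSpace ℝ (Fin dim)) carrier]
  [smooth : IsManifold (𝓡 dim) ∞ carrier]

namespace Mfld

instance : CoeSort Mfld.{u} (Type u) := ⟨Mfld.carrier⟩

instance (M : Mfld.{u}) : TopologicalSpace M := M.top
instance (M : Mfld.{u}) : T2Space M := M.t2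
instance (M : Mfld.{u}) : ChartedSpace (EuclideanSpace ℝ (Fin M.dim)) M := M.charted
instance (M : Mfld.{u}) : IsManifold (𝓡 M.dim) ∞ M := M.smooth

/-- The morphisms are the smooth maps. -/
noncomputable instance : Category Mfld.{u} where
  Hom M N := ContMDiffMap (𝓡 M.dim) (𝓡 N.dim) M N ∞
  id M := ContMDiffMap.id
  comp f g := ContMDiffMap.comp g f

/-- The smooth map underlying a morphism. -/
def Hom.toMap {M N : Mfld.{u}} (f : M ⟶ N) : ContMDiffMap (𝓡 M.dim) (𝓡 N.dim) M N ∞ := f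

/-- The model space of a manifold. -/
abbrev Model (M : Mfld.{u}) : Type := EuclideanSpace ℝ (Fin M.dim)

end Mfld

/-! ### Differential cochains -/

section DC

variable (M N P : Mfld.{u}) (s k : ℕ)

/-- `Ωᵏ(M)`. -/
abbrev Om : Type u := Form M.Model M k

/-- `Cᵏ(M; R)`. -/
abbrev Coch (R : Type) : Type u := SCochain M.Model M k R

/-- `Cᵏ⁻¹(M; ℝ)`, which is trivial for `k = 0`. -/
def PrevCoch : ℕ → Type u
  | 0 => PUnit
  | k + 1 => Coch M k ℝ

instance : ∀ k, AddCommGroup (PrevCoch M k)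
  | 0 => inferInstanceAs (AddCommGroup PUnit)
  | k + 1 => inferInstanceAs (AddCommGroup (Coch M k ℝ))

/-- `d : Cᵏ⁻¹(M; ℝ) → Cᵏ(M; ℝ)`. -/
noncomputable def PrevCoch.d : ∀ k, PrevCoch M k →+ Coch M k ℝ
  | 0 => 0
  | _ + 1 => SCochain.d

/-- The inclusion `Cᵏ(M; ℤ) ⊆ Cᵏ(M; ℝ)`. -/
def Coch.real : Coch M k ℤ →+ Coch M k ℝ where
  toFun c := fun σ ↦ (c σ : ℝ)
  map_zero' := by ext; simp
  map_add' _ _ := by ext; simp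

theorem SmoothSimplex.integrableOn {M : Mfld.{u}} {k : ℕ} (σ : SmoothSimplex M.Model M k) (η : Om M k) :
    IntegrableOn (fun x ↦ plotForm (σ.extension ∘ param) η.1 x fun i ↦ Pi.single i 1)
      (solidSimplex k) :=
  ContinuousOn.integrableOn_compact isCompact_solidSimplex fun _ hx ↦
    (((ContinuousAlternatingMap.apply ℝ (Fin k → ℝ) ℝ fun i ↦ Pi.single i 1).continuous.continuousAt
      ).comp (η.2.contDiffAt_plotForm (σ.contMDiffAt_extension hx)).continuousAt).continuousWithinAt

/-- Integration of forms, `Ωᵏ(M) → Cᵏ(M; ℝ)`. -/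
noncomputable def Om.integrate : Om M k →+ Coch M k ℝ where
  toFun η := fun σ ↦ σ.integral η.1
  map_zero' := by
    funext σ
    have : ∀ x, plotForm (σ.extension ∘ param) (0 : FormField M.Model M k) x = 0 := fun _ ↦ rfl
    simp [SmoothSimplex.integral, integralAlong, this]
  map_add' a b := by
    funext σ
    exact integral_add (σ.integrableOn a) (σ.integrableOn b)

/-- The group of differential cochains of degree `k` and height `s`:
triples `(c, h, ω) ∈ Cᵏ(M; ℤ) × Cᵏ⁻¹(M; ℝ) × Ωᵏ(M)` with `ω = 0` if `k < s`. -/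
def DiffCochain : AddSubgroup (Coch M k ℤ × PrevCoch M k × Om M k) where
  carrier := {x | k < s → x.2.2 = 0}
  zero_mem' := fun _ ↦ rfl
  add_mem' := fun {a b} ha hb h ↦ by simp [ha h, hb h]
  neg_mem' := fun {a} ha h ↦ by simp [ha h]

/-- The differential `d(c, h, ω) = (dc, ω - c - dh, dω)`. -/
noncomputable def DiffCochain.d : DiffCochain M s k →+ DiffCochain M s (k + 1) where
  toFun x := ⟨(SCochain.d x.1.1,
    (Om.integrate M k x.1.2.2 - Coch.real M k x.1.1 - PrevCoch.d M k x.1.2.1 : Coch M k ℝ),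
    Form.d x.1.2.2), fun h ↦ by
      change Form.d x.1.2.2 = 0
      rw [x.2 (Nat.lt_of_succ_lt h), map_zero]⟩
  map_zero' := by
    refine Subtype.ext (Prod.ext (map_zero _) (Prod.ext ?_ (map_zero _)))
    change (Om.integrate M k 0 - Coch.real M k 0 - PrevCoch.d M k 0 : Coch M k ℝ) = 0
    simp
  map_add' x y := by
    refine Subtype.ext (Prod.ext (map_add _ _ _) (Prod.ext ?_ (map_add _ _ _)))
    change (Om.integrate M k (x.1.2.2 + y.1.2.2) - Coch.real M k (x.1.1 + y.1.1) -
      PrevCoch.d M k (x.1.2.1 + y.1.2.1) : Coch M k ℝ) =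
      (Om.integrate M k x.1.2.2 - Coch.real M k x.1.1 - PrevCoch.d M k x.1.2.1) +
      (Om.integrate M k y.1.2.2 - Coch.real M k y.1.1 - PrevCoch.d M k y.1.2.1)
    simp only [map_add]
    abel

theorem Om.integrate_d (η : Om M k) :
    Om.integrate M (k + 1) (Form.d η) = SCochain.d (Om.integrate M k η) := by
  funext σ
  exact σ.stokes η.2

theorem Coch.real_d (c : Coch M k ℤ) :
    Coch.real M (k + 1) (SCochain.d c) = SCochain.d (Coch.real M k c) := by
  funext σ
  simp [Coch.real, SCochain.d]

theorem PrevCoch.d_d (h : PrevCoch M k) :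
    (SCochain.d (PrevCoch.d M k h) : Coch M (k + 1) ℝ) = 0 := by
  cases k with
  | zero => exact map_zero _
  | succ k => exact SCochain.d_d _

theorem DiffCochain.d_d (x : DiffCochain M s k) :
    DiffCochain.d M s (k + 1) (DiffCochain.d M s k x) = 0 := by
  refine Subtype.ext (Prod.ext (SCochain.d_d _) (Prod.ext ?_ (Subtype.ext x.1.2.2.2.extD_extD)))
  change Om.integrate M (k + 1) (Form.d x.1.2.2) - Coch.real M (k + 1) (SCochain.d x.1.1) -
    SCochain.d (Om.integrate M k x.1.2.2 - Coch.real M k x.1.1 - PrevCoch.d M k x.1.2.1) = 0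
  rw [Om.integrate_d, Coch.real_d, map_sub, map_sub, PrevCoch.d_d]
  abel

/-- The cochain complex of differential cochains of height `s`. -/
noncomputable def diffComplex : CochainComplex AddCommGrpCat.{u} ℕ :=
  CochainComplex.of (fun k ↦ AddCommGrpCat.of (DiffCochain M s k))
    (fun k ↦ AddCommGrpCat.ofHom (DiffCochain.d M s k)) fun k ↦ by
      ext1
      exact AddMonoidHom.ext fun x ↦ DiffCochain.d_d M s k x

theorem diffComplex_d :
    (diffComplex M s).d k (k + 1) = AddCommGrpCat.ofHom (DiffCochain.d M s k) :=
  CochainComplex.of_d (fun k ↦ AddCommGrpCat.of (DiffCochain M s k))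
    (fun k ↦ AddCommGrpCat.ofHom (DiffCochain.d M s k)) k

variable {M N P}

/-- The pullback on `Cᵏ⁻¹(-; ℝ)`. -/
noncomputable def PrevCoch.pull (f : N ⟶ M) : ∀ k, PrevCoch M k →+ PrevCoch N k
  | 0 => AddMonoidHom.id _
  | _ + 1 => SCochain.pull (Mfld.Hom.toMap f) (Mfld.Hom.toMap f).contMDiff

/-- The pullback `f^*(c, h, ω) = (f^*c, f^*h, f^*ω)` of differential cochains. -/
noncomputable def DiffCochain.pull (f : N ⟶ M) : DiffCochain M s k →+ DiffCochain N s k where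
  toFun x := ⟨(SCochain.pull (Mfld.Hom.toMap f) (Mfld.Hom.toMap f).contMDiff x.1.1,
    PrevCoch.pull f k x.1.2.1,
    Form.pull (Mfld.Hom.toMap f) (Mfld.Hom.toMap f).contMDiff x.1.2.2), fun h ↦ by
      change Form.pull _ _ x.1.2.2 = 0
      rw [x.2 h, map_zero]⟩
  map_zero' := Subtype.ext (Prod.ext rfl (Prod.ext (map_zero _) rfl))
  map_add' _ _ := Subtype.ext (Prod.ext rfl (Prod.ext (map_add _ _ _) rfl))

theorem PrevCoch.d_pull (f : N ⟶ M) (h : PrevCoch M k) :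
    PrevCoch.d N k (PrevCoch.pull f k h) =
      SCochain.pull (Mfld.Hom.toMap f) (Mfld.Hom.toMap f).contMDiff (PrevCoch.d M k h) := by
  cases k <;> rfl

theorem DiffCochain.d_pull (f : N ⟶ M) (x : DiffCochain M s k) :
    DiffCochain.d N s k (DiffCochain.pull s k f x) =
      DiffCochain.pull s (k + 1) f (DiffCochain.d M s k x) := by
  refine Subtype.ext (Prod.ext rfl (Prod.ext ?_
    (Subtype.ext (x.1.2.2.2.extD_pullForm (Mfld.Hom.toMap f).contMDiff))))
  change Om.integrate N k (Form.pull _ _ x.1.2.2) -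
    Coch.real N k (SCochain.pull _ _ x.1.1) - PrevCoch.d N k (PrevCoch.pull f k x.1.2.1) =
    SCochain.pull (Mfld.Hom.toMap f) (Mfld.Hom.toMap f).contMDiff
      (Om.integrate M k x.1.2.2 - Coch.real M k x.1.1 - PrevCoch.d M k x.1.2.1)
  rw [PrevCoch.d_pull, map_sub, map_sub]
  congr 2
  funext σ
  exact (σ.integral_push _ _ _).symm

theorem DiffCochain.pull_id (x : DiffCochain M s k) : DiffCochain.pull s k (𝟙 M) x = x := by
  refine Subtype.ext (Prod.ext rfl (Prod.ext ?_ (Subtype.ext ?_)))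
  · change PrevCoch.pull (𝟙 M) k x.1.2.1 = x.1.2.1
    cases k <;> rfl
  · funext y
    change pullForm (F := M.Model) (id : M → M) x.1.2.2.1 y = x.1.2.2.1 y
    simp only [pullForm, mfderiv_id]
    rfl

theorem DiffCochain.pull_comp (g : P ⟶ N) (f : N ⟶ M) (x : DiffCochain M s k) :
    DiffCochain.pull s k (g ≫ f) x = DiffCochain.pull s k g (DiffCochain.pull s k f x) := by
  refine Subtype.ext (Prod.ext rfl (Prod.ext ?_ (Subtype.ext ?_)))
  · change PrevCoch.pull (g ≫ f) k x.1.2.1 = PrevCoch.pull g k (PrevCoch.pull f k x.1.2.1)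
    cases k <;> rfl
  · funext y
    exact (pullForm_comp x.1.2.2.1 ((Mfld.Hom.toMap f).contMDiff.mdifferentiableAt (by simp))
      ((Mfld.Hom.toMap g).contMDiff.mdifferentiableAt (by simp))).symm

/-- The presheaf `M ↦ DC_s^*(M)` of cochain complexes on manifolds. -/
noncomputable def diffPresheaf : Mfld.{u}ᵒᵖ ⥤ CochainComplex AddCommGrpCat.{u} ℕ where
  obj M := diffComplex M.unop s
  map f := CochainComplex.ofHom
    (fun k ↦ AddCommGrpCat.ofHom (DiffCochain.pull s k f.unop)) fun k ↦ by
      rw [diffComplex_d, diffComplex_d]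
      ext1
      exact AddMonoidHom.ext fun x ↦ DiffCochain.d_pull s k f.unop x
  map_id M := by
    ext1 k
    ext1
    exact AddMonoidHom.ext fun x ↦ DiffCochain.pull_id s k x
  map_comp f g := by
    ext1 k
    ext1
    exact AddMonoidHom.ext fun x ↦ DiffCochain.pull_comp s k g.unop f.unop x

end DC


/-! ### The cocycle 2-category of a cochain complex -/

section CocycleTwoCat

open Bicategory

variable (K L : CochainComplex AddCommGrpCat.{u} ℕ)

/-- `K¹ / im(d : K⁰ → K¹)`. -/
abbrev TwoClass : Type u := K.X 1 ⧸ (K.d 0 1).hom.range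

/-- The map `K¹ / im d → K²` induced by the differential. -/
def dBar : TwoClass K →+ K.X 2 :=
  QuotientAddGroup.lift (K.d 0 1).hom.range (K.d 1 2).hom (by
    rintro _ ⟨z, rfl⟩
    have h := K.d_comp_d 0 1 2
    exact congrArg (fun f ↦ f.hom z) h)

variable {K L} in
/-- The map on `K¹ / im d` induced by a cochain map. -/
def mapClass (f : K ⟶ L) : TwoClass K →+ TwoClass L :=
  QuotientAddGroup.map _ _ (f.f 1).hom (by
    rintro _ ⟨z, rfl⟩
    exact ⟨(f.f 0).hom z, congrArg (fun g ↦ g.hom z) (f.comm 0 1)⟩)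

/-- The objects of the cocycle 2-category `ℋ³(K)`: the 3-cocycles of `K`. -/
structure Cocycle where
  val : K.X 3
  closed : (K.d 3 4).hom val = 0

variable {K L}

/-- A 1-arrow `x ⟶ y`: a 2-cochain `b` with `x - y = db`. -/
@[ext]
structure OneCell (x y : Cocycle K) where
  val : K.X 2
  bdry : x.val - y.val = (K.d 2 3).hom val

/-- A 2-arrow `b ⟹ b'`: the class of a 1-cochain `a` with `b' - b = da`, modulo coboundaries. -/
@[ext]
structure TwoCell (b b' : K.X 2) where
  val : TwoClass K
  bdry : b' - b = dBar K val

instance Cocycle.struct : CategoryStruct (Cocycle K) where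
  Hom x y := OneCell x y
  id x := ⟨0, by simp⟩
  comp {x y z} f g := ⟨f.val + g.val, by rw [map_add, ← f.bdry, ← g.bdry]; abel⟩

instance Cocycle.homCat (x y : Cocycle K) : Category (x ⟶ y) where
  Hom b b' := TwoCell b.val b'.val
  id b := ⟨0, by simp⟩
  comp {b b' b''} f g := ⟨f.val + g.val, by rw [map_add, ← f.bdry, ← g.bdry]; abel⟩
  id_comp f := TwoCell.ext (zero_add _)
  comp_id f := TwoCell.ext (add_zero _)
  assoc f g h := TwoCell.ext (add_assoc _ _ _)

theorem Cocycle.id_val (x : Cocycle K) : (𝟙 x : x ⟶ x).val = 0 := rfl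

theorem Cocycle.comp_val {x y z : Cocycle K} (f : x ⟶ y) (g : y ⟶ z) :
    (f ≫ g).val = f.val + g.val := rfl

/-- The identity 2-arrow between 1-arrows with the same underlying cochain. -/
def OneCell.isoOfEq {x y : Cocycle K} {b b' : x ⟶ y} (h : b.val = b'.val) : b ≅ b' where
  hom := ⟨0, by simp [h]⟩
  inv := ⟨0, by simp [h]⟩
  hom_inv_id := TwoCell.ext (add_zero _)
  inv_hom_id := TwoCell.ext (add_zero _)

/-- Horizontal composition of a 2-arrow with an identity 2-arrow. -/
def TwoCell.addLeft (c : K.X 2) {b b' : K.X 2} (a : TwoCell b b') : TwoCell (c + b) (c + b') :=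
  ⟨a.val, by rw [← a.bdry]; abel⟩

/-- Horizontal composition of a 2-arrow with an identity 2-arrow. -/
def TwoCell.addRight {b b' : K.X 2} (a : TwoCell b b') (c : K.X 2) : TwoCell (b + c) (b' + c) :=
  ⟨a.val, by rw [← a.bdry]; abel⟩

/-- The cocycle 2-category `ℋ³(K)`. All compositions are given by addition, all identities by `0`,
and it is strict: the associators and unitors are identities. -/
instance Cocycle.bicategory : Bicategory (Cocycle K) where
  toCategoryStruct := Cocycle.struct
  homCategory := Cocycle.homCat
  whiskerLeft f _ _ a := TwoCell.addLeft f.val a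
  whiskerRight a f := TwoCell.addRight a f.val
  associator _ _ _ := OneCell.isoOfEq (add_assoc _ _ _)
  leftUnitor _ := OneCell.isoOfEq (zero_add _)
  rightUnitor _ := OneCell.isoOfEq (add_zero _)
  whiskerLeft_id _ _ := rfl
  whiskerLeft_comp _ _ _ _ _ _ := rfl
  id_whiskerLeft a := by
    apply TwoCell.ext
    change TwoCell.val a = 0 + (TwoCell.val a + 0)
    simp
  comp_whiskerLeft _ _ _ _ a := by
    apply TwoCell.ext
    change TwoCell.val a = 0 + (TwoCell.val a + 0)
    simp
  id_whiskerRight _ _ := rfl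
  comp_whiskerRight _ _ _ := rfl
  whiskerRight_id a := by
    apply TwoCell.ext
    change TwoCell.val a = 0 + (TwoCell.val a + 0)
    simp
  whiskerRight_comp a _ _ := by
    apply TwoCell.ext
    change TwoCell.val a = 0 + (TwoCell.val a + 0)
    simp
  whisker_assoc _ _ _ a _ := by
    apply TwoCell.ext
    change TwoCell.val a = 0 + (TwoCell.val a + 0)
    simp
  whisker_exchange a b := TwoCell.ext (add_comm (TwoCell.val b) (TwoCell.val a))
  pentagon _ _ _ _ := by
    apply TwoCell.ext
    change (0 + (0 + 0) : TwoClass K) = 0 + 0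
    simp
  triangle _ _ := by
    apply TwoCell.ext
    change (0 + 0 : TwoClass K) = 0
    simp

/-- The 2-arrow induced by a cochain map. -/
def TwoCell.map (f : K ⟶ L) {b b' : K.X 2} (a : TwoCell b b') :
    TwoCell ((f.f 2).hom b) ((f.f 2).hom b') where
  val := mapClass f a.val
  bdry := by
    rw [← map_sub, a.bdry]
    obtain ⟨z, hz⟩ := QuotientAddGroup.mk_surjective a.val
    rw [← hz]
    exact (congrArg (fun g ↦ g.hom z) (f.comm 1 2)).symm

/-- The cocycle induced by a cochain map. -/
def Cocycle.map (f : K ⟶ L) (x : Cocycle K) : Cocycle L where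
  val := (f.f 3).hom x.val
  closed := by
    have h := congrArg (fun g ↦ g.hom x.val) (f.comm 3 4)
    refine Eq.trans h ?_
    change (f.f 4).hom ((K.d 3 4).hom x.val) = 0
    rw [x.closed, map_zero]

/-- The 1-arrow induced by a cochain map. -/
def OneCell.map (f : K ⟶ L) {x y : Cocycle K} (b : OneCell x y) :
    OneCell (x.map f) (y.map f) where
  val := (f.f 2).hom b.val
  bdry := by
    change (f.f 3).hom x.val - (f.f 3).hom y.val = _
    rw [← map_sub, b.bdry]
    exact (congrArg (fun g ↦ g.hom b.val) (f.comm 2 3)).symm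

/-- The strict 2-functor `ℋ³(K) → ℋ³(L)` induced by a cochain map. -/
def cocycleMap (f : K ⟶ L) : Pseudofunctor (Cocycle K) (Cocycle L) where
  obj x := x.map f
  map b := OneCell.map f b
  map₂ a := TwoCell.map f a
  map₂_id _ := TwoCell.ext (map_zero _)
  map₂_comp _ _ := TwoCell.ext (map_add _ _ _)
  mapId _ := OneCell.isoOfEq (map_zero _)
  mapComp _ _ := OneCell.isoOfEq (map_add _ _ _)
  map₂_whisker_left _ _ _ a := by
    apply TwoCell.ext
    change mapClass f (TwoCell.val a) = 0 + (mapClass f (TwoCell.val a) + 0)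
    simp
  map₂_whisker_right a _ := by
    apply TwoCell.ext
    change mapClass f (TwoCell.val a) = 0 + (mapClass f (TwoCell.val a) + 0)
    simp
  map₂_associator _ _ _ := by
    apply TwoCell.ext
    change mapClass f 0 = 0 + (0 + (0 + (0 + 0)))
    simp
  map₂_left_unitor _ := by
    apply TwoCell.ext
    change mapClass f 0 = 0 + (0 + 0)
    simp
  map₂_right_unitor _ := by
    apply TwoCell.ext
    change mapClass f 0 = 0 + (0 + 0)
    simp

end CocycleTwoCat

/-! ### Equivariant objects -/

/-- A semisimplicial manifold, such as the nerve of a Lie groupoid. -/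
structure SemiSimplicialMfld where
  obj : ℕ → Mfld.{u}
  face : ∀ n, Fin (n + 2) → (obj (n + 1) ⟶ obj n)
  face_comp : ∀ n (i j : Fin (n + 2)), i ≤ j →
    face (n + 1) j.succ ≫ face n i = face (n + 1) i.castSucc ≫ face n j

section Equivariant

open Bicategory Opposite

variable (A : Mfld.{u}ᵒᵖ ⥤ CochainComplex AddCommGrpCat.{u} ℕ) (Γ : SemiSimplicialMfld.{u})

/-- The cochain map `∂ᵢ^* : A(Γₙ) → A(Γₙ₊₁)`. -/
noncomputable abbrev facePull (n : ℕ) (i : Fin (n + 2)) : A.obj (op (Γ.obj n)) ⟶ A.obj (op (Γ.obj (n + 1))) :=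
  A.map (Γ.face n i).op

/-- A `Γ`-equivariant object `(c, e, τ)` of the presheaf `ℋ³(A)`: an object `c` of `ℋ³(A(Γ₀))`,
a 1-arrow `e : ∂₀^*c ⟶ ∂₁^*c`, and a 2-arrow `τ : ∂₂^*e ∘ ∂₀^*e ⟹ ∂₁^*e`, with
`∂₂^*τ ∘ (id ⋆ ∂₀^*τ) = ∂₁^*τ ∘ (∂₃^*τ ⋆ id)`. All compositions in the cocycle 2-categories are
addition of (classes of) cochains. -/
structure EqObj where
  c : Cocycle (A.obj (op (Γ.obj 0)))
  e : (cocycleMap (facePull A Γ 0 0)).obj c ⟶ (cocycleMap (facePull A Γ 0 1)).obj c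
  τ : TwoCell (((facePull A Γ 1 2).f 2).hom e.val + ((facePull A Γ 1 0).f 2).hom e.val)
    (((facePull A Γ 1 1).f 2).hom e.val)
  coh : mapClass (facePull A Γ 2 2) τ.val + mapClass (facePull A Γ 2 0) τ.val =
    mapClass (facePull A Γ 2 1) τ.val + mapClass (facePull A Γ 2 3) τ.val

variable {A Γ}

/-- A 1-arrow `(b, α) : (c, e, τ) ⟶ (c', e', τ')`: a 1-arrow `b : c ⟶ c'` and a 2-arrow
`α : e' ∘ ∂₀^*b ⟹ ∂₁^*b ∘ e` with
`(id ⋆ τ) ∘ (∂₂^*α ⋆ id) ∘ (id ⋆ ∂₀^*α) = ∂₁^*α ∘ (τ' ⋆ id)`. -/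
@[ext]
structure EqHom (X Y : EqObj A Γ) where
  b : X.c ⟶ Y.c
  α : TwoCell (Y.e.val + ((facePull A Γ 0 0).f 2).hom b.val)
    (((facePull A Γ 0 1).f 2).hom b.val + X.e.val)
  coh : X.τ.val + mapClass (facePull A Γ 1 2) α.val + mapClass (facePull A Γ 1 0) α.val =
    mapClass (facePull A Γ 1 1) α.val + Y.τ.val

/-- A 2-arrow `(b, α) ⟹ (b', α')`: a 2-arrow `β : b ⟹ b'` with
`α' ∘ (id ⋆ ∂₀^*β) = (∂₁^*β ⋆ id) ∘ α`. -/
@[ext]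
structure EqTwoHom {X Y : EqObj A Γ} (f g : EqHom X Y) where
  β : f.b ⟶ g.b
  coh : g.α.val + mapClass (facePull A Γ 0 0) β.val =
    mapClass (facePull A Γ 0 1) β.val + f.α.val

theorem EqHom.ext_val {X Y : EqObj A Γ} {f g : EqHom X Y} (h : f.b.val = g.b.val)
    (h' : f.α.val = g.α.val) : f = g := by
  obtain ⟨⟨b, hb⟩, ⟨α, hα⟩, hc⟩ := f
  obtain ⟨⟨b', hb'⟩, ⟨α', hα'⟩, hc'⟩ := g
  obtain rfl : b = b' := h
  obtain rfl : α = α' := h'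
  rfl

theorem EqTwoHom.ext_val {X Y : EqObj A Γ} {f g : EqHom X Y} {s t : EqTwoHom f g}
    (h : s.β.val = t.β.val) : s = t :=
  EqTwoHom.ext (TwoCell.ext h)

instance EqObj.struct : CategoryStruct (EqObj A Γ) where
  Hom X Y := EqHom X Y
  id X :=
    { b := 𝟙 X.c
      α := ⟨0, by rw [Cocycle.id_val, map_zero, map_zero]; simp⟩
      coh := by simp }
  comp {X Y Z} f g :=
    { b := f.b ≫ g.b
      α := ⟨f.α.val + g.α.val, by
        rw [map_add, ← f.α.bdry, ← g.α.bdry, Cocycle.comp_val, map_add, map_add]; abel⟩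
      coh := by
        have h1 := f.coh
        have h2 := g.coh
        simp only [map_add]
        calc _ = (X.τ.val + mapClass (facePull A Γ 1 2) f.α.val +
              mapClass (facePull A Γ 1 0) f.α.val) + mapClass (facePull A Γ 1 2) g.α.val +
              mapClass (facePull A Γ 1 0) g.α.val := by abel
          _ = mapClass (facePull A Γ 1 1) f.α.val + (Y.τ.val +
              mapClass (facePull A Γ 1 2) g.α.val + mapClass (facePull A Γ 1 0) g.α.val) := by
            rw [h1]; abel
          _ = _ := by rw [h2]; abel }

instance EqObj.homCat (X Y : EqObj A Γ) : Category (X ⟶ Y) where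
  Hom f g := EqTwoHom f g
  id f := ⟨𝟙 f.b, by change f.α.val + mapClass _ 0 = mapClass _ 0 + f.α.val; simp⟩
  comp {f g h} s t := ⟨s.β ≫ t.β, by
    have h1 := s.coh
    have h2 := t.coh
    change h.α.val + mapClass _ (s.β.val + t.β.val) = mapClass _ (s.β.val + t.β.val) + f.α.val
    rw [map_add, map_add, add_comm (mapClass _ s.β.val), ← add_assoc, h2, add_assoc, h1]
    abel⟩
  id_comp _ := EqTwoHom.ext_val (zero_add _)
  comp_id _ := EqTwoHom.ext_val (add_zero _)
  assoc _ _ _ := EqTwoHom.ext_val (add_assoc _ _ _)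

theorem EqObj.comp_b {X Y Z : EqObj A Γ} (f : X ⟶ Y) (g : Y ⟶ Z) : (f ≫ g).b = f.b ≫ g.b := rfl

theorem EqObj.comp_α {X Y Z : EqObj A Γ} (f : X ⟶ Y) (g : Y ⟶ Z) :
    (f ≫ g).α.val = f.α.val + g.α.val := rfl

/-- The identity 2-arrow between 1-arrows with the same underlying cochains. -/
def EqHom.isoOfEq {X Y : EqObj A Γ} {f g : X ⟶ Y} (h : f.b.val = g.b.val)
    (h' : f.α.val = g.α.val) : f ≅ g where
  hom := ⟨(OneCell.isoOfEq h).hom, by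
    change g.α.val + mapClass _ 0 = mapClass _ 0 + f.α.val; simp [h']⟩
  inv := ⟨(OneCell.isoOfEq h).inv, by
    change f.α.val + mapClass _ 0 = mapClass _ 0 + g.α.val; simp [h']⟩
  hom_inv_id := EqTwoHom.ext_val (add_zero _)
  inv_hom_id := EqTwoHom.ext_val (add_zero _)

/-- Left whiskering of 2-arrows. -/
def EqTwoHom.whiskerL {X Y Z : EqObj A Γ} (f : X ⟶ Y) {g h : Y ⟶ Z} (s : EqTwoHom g h) :
    EqTwoHom (f ≫ g) (f ≫ h) :=
  ⟨f.b ◁ s.β, by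
    have h1 := s.coh
    change (f.α.val + h.α.val) + mapClass _ s.β.val = mapClass _ s.β.val + (f.α.val + g.α.val)
    rw [add_assoc, h1]; abel⟩

/-- Right whiskering of 2-arrows. -/
def EqTwoHom.whiskerR {X Y Z : EqObj A Γ} {f g : X ⟶ Y} (s : EqTwoHom f g) (h : Y ⟶ Z) :
    EqTwoHom (f ≫ h) (g ≫ h) :=
  ⟨s.β ▷ h.b, by
    have h1 := s.coh
    change (g.α.val + h.α.val) + mapClass _ s.β.val = mapClass _ s.β.val + (f.α.val + h.α.val)
    rw [add_right_comm, h1]; abel⟩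

/-- The bicategory of `Γ`-equivariant objects of `ℋ³(A)`. -/
instance EqObj.bicategory : Bicategory (EqObj A Γ) where
  toCategoryStruct := EqObj.struct
  homCategory := EqObj.homCat
  whiskerLeft f _ _ s := EqTwoHom.whiskerL f s
  whiskerRight s h := EqTwoHom.whiskerR s h
  associator _ _ _ := EqHom.isoOfEq (add_assoc _ _ _) (add_assoc _ _ _)
  leftUnitor _ := EqHom.isoOfEq (zero_add _) (zero_add _)
  rightUnitor _ := EqHom.isoOfEq (add_zero _) (add_zero _)
  whiskerLeft_id _ _ := rfl
  whiskerLeft_comp _ _ _ _ _ _ := rfl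
  id_whiskerLeft s := by
    apply EqTwoHom.ext_val
    change (EqTwoHom.β s).val = 0 + ((EqTwoHom.β s).val + 0)
    simp
  comp_whiskerLeft _ _ _ _ s := by
    apply EqTwoHom.ext_val
    change (EqTwoHom.β s).val = 0 + ((EqTwoHom.β s).val + 0)
    simp
  id_whiskerRight _ _ := rfl
  comp_whiskerRight _ _ _ := rfl
  whiskerRight_id s := by
    apply EqTwoHom.ext_val
    change (EqTwoHom.β s).val = 0 + ((EqTwoHom.β s).val + 0)
    simp
  whiskerRight_comp s _ _ := by
    apply EqTwoHom.ext_val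
    change (EqTwoHom.β s).val = 0 + ((EqTwoHom.β s).val + 0)
    simp
  whisker_assoc _ _ _ s _ := by
    apply EqTwoHom.ext_val
    change (EqTwoHom.β s).val = 0 + ((EqTwoHom.β s).val + 0)
    simp
  whisker_exchange s t := EqTwoHom.ext_val (add_comm (EqTwoHom.β t).val (EqTwoHom.β s).val)
  pentagon _ _ _ _ := by
    apply EqTwoHom.ext_val
    change (0 + (0 + 0) : TwoClass _) = 0 + 0
    simp
  triangle _ _ := by
    apply EqTwoHom.ext_val
    change (0 + 0 : TwoClass _) = 0
    simp

section Restriction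

variable {M : Mfld.{u}} {π : Γ.obj 0 ⟶ M}

theorem facePull_restrict (hπ : Γ.face 0 0 ≫ π = Γ.face 0 1 ≫ π) (n : ℕ) (z : (A.obj (op M)).X n) :
    ((facePull A Γ 0 0).f n).hom (((A.map π.op).f n).hom z) =
      ((facePull A Γ 0 1).f n).hom (((A.map π.op).f n).hom z) := by
  have h : A.map π.op ≫ facePull A Γ 0 0 = A.map π.op ≫ facePull A Γ 0 1 := by
    rw [facePull, facePull, ← A.map_comp, ← A.map_comp, ← op_comp, ← op_comp, hπ]
  exact congrArg (fun g ↦ (g.f n).hom z) h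

theorem mapClass_restrict (hπ : Γ.face 0 0 ≫ π = Γ.face 0 1 ≫ π) (z : TwoClass (A.obj (op M))) :
    mapClass (facePull A Γ 0 0) (mapClass (A.map π.op) z) =
      mapClass (facePull A Γ 0 1) (mapClass (A.map π.op) z) := by
  obtain ⟨w, rfl⟩ := QuotientAddGroup.mk_surjective z
  exact congrArg _ (facePull_restrict hπ 1 w)

/-- The object `(π^*c, id, id)`. -/
noncomputable def restrictObj (hπ : Γ.face 0 0 ≫ π = Γ.face 0 1 ≫ π) (x : Cocycle (A.obj (op M))) : EqObj A Γ where
  c := x.map (A.map π.op)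
  e := OneCell.mk 0 (by
    rw [map_zero, sub_eq_zero]
    exact facePull_restrict hπ 3 x.val)
  τ := ⟨0, by simp⟩
  coh := by simp

/-- The 1-arrow `(π^*b, id)`. -/
noncomputable def restrictMap (hπ : Γ.face 0 0 ≫ π = Γ.face 0 1 ≫ π) {x y : Cocycle (A.obj (op M))} (b : x ⟶ y) :
    EqHom (restrictObj hπ x) (restrictObj hπ y) where
  b := OneCell.map (A.map π.op) b
  α := ⟨0, by
    change _ + (0 : (A.obj (op (Γ.obj 1))).X 2) - (0 + _) = _
    rw [map_zero, sub_eq_zero]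
    refine (add_zero _).trans (Eq.trans ?_ (zero_add _).symm)
    exact (facePull_restrict hπ 2 b.val).symm⟩
  coh := by
    change (0 : TwoClass _) + _ + _ = _ + (0 : TwoClass _)
    simp

/-- The 2-arrow `π^*a`. -/
noncomputable def restrictMap₂ (hπ : Γ.face 0 0 ≫ π = Γ.face 0 1 ≫ π) {x y : Cocycle (A.obj (op M))} {b b' : x ⟶ y} (a : b ⟶ b') :
    EqTwoHom (restrictMap hπ b) (restrictMap hπ b') where
  β := TwoCell.map (A.map π.op) a
  coh := by
    change 0 + mapClass _ (mapClass _ (TwoCell.val a)) = mapClass _ (mapClass _ (TwoCell.val a)) + 0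
    exact (zero_add _).trans ((mapClass_restrict hπ _).trans (add_zero _).symm)

/-- The restriction 2-functor `π^* : ℋ³(A(M)) → ℋ³(A(Γ))` along an augmentation `π : Γ₀ → M`,
`π ∘ ∂₀ = π ∘ ∂₁`. It sends `c` to `(π^*c, id, id)`, `b` to `(π^*b, id)` and `a` to `π^*a`. -/
noncomputable def restriction (hπ : Γ.face 0 0 ≫ π = Γ.face 0 1 ≫ π) :
    Pseudofunctor (Cocycle (A.obj (op M))) (EqObj A Γ) where
  obj x := restrictObj hπ x
  map b := restrictMap hπ b
  map₂ a := restrictMap₂ hπ a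
  map₂_id _ := EqTwoHom.ext_val (map_zero _)
  map₂_comp _ _ := EqTwoHom.ext_val (map_add _ _ _)
  mapId _ := EqHom.isoOfEq (map_zero _) rfl
  mapComp _ _ := EqHom.isoOfEq (map_add _ _ _) (add_zero (0 : TwoClass _)).symm
  map₂_whisker_left _ _ _ a := by
    apply EqTwoHom.ext_val
    change mapClass _ (TwoCell.val a) = 0 + (mapClass _ (TwoCell.val a) + 0)
    simp
  map₂_whisker_right a _ := by
    apply EqTwoHom.ext_val
    change mapClass _ (TwoCell.val a) = 0 + (mapClass _ (TwoCell.val a) + 0)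
    simp
  map₂_associator _ _ _ := by
    apply EqTwoHom.ext_val
    change mapClass _ 0 = 0 + (0 + (0 + (0 + 0)))
    simp
  map₂_left_unitor _ := by
    apply EqTwoHom.ext_val
    change mapClass _ 0 = 0 + (0 + 0)
    simp
  map₂_right_unitor _ := by
    apply EqTwoHom.ext_val
    change mapClass _ 0 = 0 + (0 + 0)
    simp

end Restriction

end Equivariant

/-- A pseudofunctor is an equivalence of bicategories if it is fully faithful (an equivalence on
all `Hom`-categories) and essentially surjective (every object is equivalent to one in the image). -/
def IsBiequivalence {B : Type*} [Bicategory.{u, u} B] {C : Type*} [Bicategory.{u, u} C]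
    (F : Pseudofunctor B C) : Prop :=
  (∀ x y : B, (F.toPrelaxFunctor.mapFunctor x y).IsEquivalence) ∧
    ∀ z : C, ∃ x : B, Nonempty (Bicategory.Equivalence (F.obj x) z)


/-! ### The Čech groupoid of an open cover -/

section LocalHomeo

variable {n : ℕ} {X Y M : Type*} [TopologicalSpace X] [TopologicalSpace Y] [TopologicalSpace M]
  [ChartedSpace (EuclideanSpace ℝ (Fin n)) M] {p : X → M} {q : Y → M}

/-- The charts of `M`, pulled back along a local homeomorphism `p : X → M`: near `x` they are
compositions of `p` with a chart of `M` at `p x`. -/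
@[reducible]
noncomputable def pullCharts (hp : IsLocalHomeomorph p) :
    ChartedSpace (EuclideanSpace ℝ (Fin n)) X where
  atlas := range fun x ↦ (hp.localInverseAt x).symm ≫ₕ chartAt (EuclideanSpace ℝ (Fin n)) (p x)
  chartAt x := (hp.localInverseAt x).symm ≫ₕ chartAt (EuclideanSpace ℝ (Fin n)) (p x)
  mem_chart_source x := by simp
  chart_mem_atlas x := ⟨x, rfl⟩

theorem isManifold_pullCharts [IsManifold (𝓡 n) ∞ M] (hp : IsLocalHomeomorph p) :
    letI := pullCharts (n := n) hp
    IsManifold (𝓡 n) ∞ X := by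
  let _ := pullCharts (n := n) hp
  refine isManifold_of_contDiffOn _ _ _ ?_
  rintro _ _ ⟨x, rfl⟩ ⟨y, rfl⟩
  set c := chartAt (EuclideanSpace ℝ (Fin n)) (p x)
  set c' := chartAt (EuclideanSpace ℝ (Fin n)) (p y)
  have h : ContDiffOn ℝ ∞ ((𝓡 n) ∘ (c.symm ≫ₕ c') ∘ (𝓡 n).symm)
      ((𝓡 n).symm ⁻¹' (c.symm ≫ₕ c').source ∩ range (𝓡 n)) :=
    ((contDiffGroupoid ∞ (𝓡 n)).compatible (chart_mem_atlas _ (p x)) (chart_mem_atlas _ (p y))).1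
  have key : ∀ z ∈ (((hp.localInverseAt x).symm ≫ₕ c).symm ≫ₕ
      ((hp.localInverseAt y).symm ≫ₕ c')).source,
      p (hp.localInverseAt x (c.symm z)) = c.symm z := by
    intro z hz
    simp only [OpenPartialHomeomorph.trans_source, OpenPartialHomeomorph.trans_symm_eq_symm_trans_symm,
      OpenPartialHomeomorph.symm_symm, mem_inter_iff, mem_preimage] at hz
    exact hp.apply_localInverseAt_of_mem hz.1.2
  refine (h.mono ?_).congr ?_
  · rintro z ⟨hz, hz'⟩
    refine ⟨?_, hz'⟩
    have hk := key ((𝓡 n).symm z) hz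
    simp only [mem_preimage, OpenPartialHomeomorph.trans_source,
      OpenPartialHomeomorph.trans_symm_eq_symm_trans_symm, OpenPartialHomeomorph.coe_trans,
      OpenPartialHomeomorph.symm_symm, mem_inter_iff, Function.comp_apply,
      IsLocalHomeomorph.localInverseAt_symm] at hz hk ⊢
    exact ⟨hz.1.1, hk ▸ hz.2.2⟩
  · rintro z ⟨hz, hz'⟩
    have hk := key ((𝓡 n).symm z) hz
    simp only [OpenPartialHomeomorph.trans_symm_eq_symm_trans_symm, OpenPartialHomeomorph.coe_trans,
      OpenPartialHomeomorph.symm_symm, Function.comp_apply,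
      IsLocalHomeomorph.localInverseAt_symm] at hk ⊢
    exact congrArg (fun w ↦ (𝓡 n) (c' w)) hk

theorem contMDiff_pullCharts [IsManifold (𝓡 n) ∞ M] (hp : IsLocalHomeomorph p) :
    letI := pullCharts (n := n) hp
    ContMDiff (𝓡 n) (𝓡 n) ∞ p := by
  let _ := pullCharts (n := n) hp
  have _ := isManifold_pullCharts (n := n) hp
  intro x
  have h1 : ContMDiffAt (𝓡 n) (𝓡 n) ∞ (chartAt (EuclideanSpace ℝ (Fin n)) x) x :=
    (contMDiffOn_chart (x := x)).contMDiffAt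
      ((chartAt _ x).open_source.mem_nhds (mem_chart_source _ x))
  have hx : chartAt (EuclideanSpace ℝ (Fin n)) x x =
      chartAt (EuclideanSpace ℝ (Fin n)) (p x) (p x) := by
    change chartAt _ (p x) ((hp.localInverseAt x).symm x) = _
    simp
  have h2 : ContMDiffAt (𝓡 n) (𝓡 n) ∞ (chartAt (EuclideanSpace ℝ (Fin n)) (p x)).symm
      (chartAt (EuclideanSpace ℝ (Fin n)) x x) := by
    rw [hx]
    exact (contMDiffOn_chart_symm (x := p x)).contMDiffAt
      ((chartAt _ (p x)).open_target.mem_nhds (mem_chart_target _ (p x)))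
  refine (h2.comp x h1).congr_of_eventuallyEq ?_
  filter_upwards [(chartAt (EuclideanSpace ℝ (Fin n)) x).open_source.mem_nhds
    (mem_chart_source _ x)] with y hy
  change y ∈ ((hp.localInverseAt x).symm ≫ₕ chartAt (EuclideanSpace ℝ (Fin n)) (p x)).source at hy
  change p y = (chartAt _ (p x)).symm (chartAt _ (p x) ((hp.localInverseAt x).symm y))
  rw [OpenPartialHomeomorph.trans_source] at hy
  have hy2 := hy.2
  rw [mem_preimage] at hy2
  rw [(chartAt _ (p x)).left_inv hy2]
  simp

theorem contMDiff_lift_pullCharts [IsManifold (𝓡 n) ∞ M] (hp : IsLocalHomeomorph p)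
    {m : ℕ} [ChartedSpace (EuclideanSpace ℝ (Fin m)) Y] {g : Y → X} (hg : Continuous g)
    (h : ContMDiff (𝓡 m) (𝓡 n) ∞ (p ∘ g)) :
    letI := pullCharts (n := n) hp
    ContMDiff (𝓡 m) (𝓡 n) ∞ g := by
  let _ := pullCharts (n := n) hp
  have _ := isManifold_pullCharts (n := n) hp
  intro y
  set x := g y with hxy
  have h1 : ContMDiffAt (𝓡 n) (𝓡 n) ∞ (chartAt (EuclideanSpace ℝ (Fin n)) (p x)) (p x) :=
    (contMDiffOn_chart (x := p x)).contMDiffAt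
      ((chartAt _ (p x)).open_source.mem_nhds (mem_chart_source _ (p x)))
  have hx : chartAt (EuclideanSpace ℝ (Fin n)) x x =
      chartAt (EuclideanSpace ℝ (Fin n)) (p x) (p x) := by
    change chartAt _ (p x) ((hp.localInverseAt x).symm x) = _
    simp
  have h2 : ContMDiffAt (𝓡 n) (𝓡 n) ∞ (chartAt (EuclideanSpace ℝ (Fin n)) x).symm
      (chartAt (EuclideanSpace ℝ (Fin n)) (p x) (p x)) := by
    rw [← hx]
    exact (contMDiffOn_chart_symm (x := x)).contMDiffAt
      ((chartAt _ x).open_target.mem_nhds (mem_chart_target _ x))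
  refine ((h2.comp (p x) h1).comp_of_eq (h y) rfl).congr_of_eventuallyEq ?_
  filter_upwards [hg.continuousAt.preimage_mem_nhds
    ((chartAt (EuclideanSpace ℝ (Fin n)) x).open_source.mem_nhds (mem_chart_source _ x))] with z hz
  have hz' := (chartAt (EuclideanSpace ℝ (Fin n)) x).left_inv hz
  change g z = (chartAt (EuclideanSpace ℝ (Fin n)) x).symm
    (chartAt (EuclideanSpace ℝ (Fin n)) (p x) (p (g z)))
  refine hz'.symm.trans (congrArg _ ?_)
  change chartAt _ (p x) ((hp.localInverseAt x).symm (g z)) = _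
  simp

end LocalHomeo

section Cech

open TopologicalSpace

variable {M : Mfld.{u}} {J J' : Type u}

/-- The projection to `M` of the disjoint union of a family of open subsets of `M`. -/
def piecesProj (V : J → Opens M) (y : Σ j, V j) : M := y.2.1

theorem isLocalHomeomorph_piecesProj (V : J → Opens M) : IsLocalHomeomorph (piecesProj V) := by
  rw [isLocalHomeomorph_iff_isOpenEmbedding_restrict]
  rintro ⟨j, y⟩
  refine ⟨range (Sigma.mk j), (Topology.IsOpenEmbedding.sigmaMk.isOpen_range).mem_nhds ⟨y, rfl⟩, ?_⟩
  refine Topology.IsOpenEmbedding.of_continuous_injective_isOpenMap ?_ ?_ ?_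
  · exact (continuous_sigma fun _ ↦ continuous_subtype_val).comp continuous_subtype_val
  · rintro ⟨_, a, rfl⟩ ⟨_, b, rfl⟩ h
    have : a = b := Subtype.ext h
    rw [this]
  · refine IsOpenMap.comp ?_ Topology.IsOpenEmbedding.sigmaMk.isOpen_range.isOpenMap_subtype_val
    exact isOpenMap_sigma.2 fun j ↦ (V j).isOpen.isOpenMap_subtype_val

/-- The disjoint union of a family of open subsets of `M`, as a manifold. -/
noncomputable def pieces (V : J → Opens M) : Mfld.{u} :=
  letI := pullCharts (n := M.dim) (isLocalHomeomorph_piecesProj V)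
  haveI := isManifold_pullCharts (n := M.dim) (isLocalHomeomorph_piecesProj V)
  { carrier := Σ j, V j
    dim := M.dim }

/-- The projection `∐ⱼ Vⱼ → M`. -/
noncomputable def piecesToBase (V : J → Opens M) : pieces V ⟶ M :=
  (⟨piecesProj V, contMDiff_pullCharts (n := M.dim) (isLocalHomeomorph_piecesProj V)⟩ :
    ContMDiffMap (𝓡 (pieces V).dim) (𝓡 M.dim) (pieces V) M ∞)

/-- The map `∐ⱼ Vⱼ → ∐ⱼ V'ⱼ` given by a map of index sets `r` and the inclusions
`Vⱼ ⊆ V'_{r(j)}`. -/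
noncomputable def piecesMap (V : J → Opens M) (V' : J' → Opens M) (r : J → J')
    (h : ∀ j, V j ≤ V' (r j)) : pieces V ⟶ pieces V' :=
  (⟨fun y ↦ (⟨r y.1, y.2.1, h y.1 y.2.2⟩ : Σ j, V' j),
    contMDiff_lift_pullCharts (n := M.dim) (m := (pieces V).dim) (Y := pieces V) (isLocalHomeomorph_piecesProj V')
      (continuous_sigma fun j ↦ 
        (continuous_sigmaMk (i := r j)).comp
          (continuous_subtype_val.subtype_mk fun x : V j ↦ h j x.2))
      (contMDiff_pullCharts (n := M.dim) (isLocalHomeomorph_piecesProj V))⟩ :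
    ContMDiffMap (𝓡 (pieces V).dim) (𝓡 (pieces V').dim) (pieces V) (pieces V') ∞)

variable {I : Type u} (U : I → Opens M)

/-- The intersection `U_{a₀} ∩ ⋯ ∩ U_{aₙ}`. -/
def inters (n : ℕ) (a : Fin (n + 1) → I) : Opens M where
  carrier := {x | ∀ j, x ∈ U (a j)}
  is_open' := by
    simp only [ofPred_forall]
    exact isOpen_iInter_of_finite fun j ↦ (U (a j)).isOpen

/-- The Čech nerve of an open cover of `M`: `Γₙ` is the disjoint union of the intersections
`U_{a₀} ∩ ⋯ ∩ U_{aₙ}` over all `(n + 1)`-tuples of indices, and `∂ᵢ` omits the index `aᵢ`. -/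
noncomputable def cech : SemiSimplicialMfld.{u} where
  obj n := pieces (inters U n)
  face n i := piecesMap _ _ (fun a j ↦ a (i.succAbove j)) fun _ _ hx j ↦ hx (i.succAbove j)
  face_comp n i j hij := by
    refine ContMDiffMap.ext fun y ↦ ?_
    refine Sigma.ext (funext fun l ↦ congrArg y.1 (succAbove_comm hij l)) ?_
    have : ∀ (a b : Fin (n + 1) → I) (ha : y.2.1 ∈ inters U n a) (hb : y.2.1 ∈ inters U n b),
        a = b → HEq (⟨y.2.1, ha⟩ : inters U n a) (⟨y.2.1, hb⟩ : inters U n b) := by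
      rintro a b ha hb rfl
      rfl
    exact this _ _ _ _ (funext fun l ↦ congrArg y.1 (succAbove_comm hij l))

/-- The projection `π : Γ₀ = ∐ Uᵢ → M`. -/
noncomputable def cechProj : (cech U).obj 0 ⟶ M := piecesToBase (inters U 0)

theorem face_cechProj :
    (cech U).face 0 0 ≫ cechProj U = (cech U).face 0 1 ≫ cechProj U := rfl

end Cech

/-- The presheaf `M ↦ ℋ³(A(M))` of cocycle 2-categories is a 2-stack: for every (second countable)
manifold `M` and every open cover of `M`, restriction along `∐ Uᵢ → M` is an equivalence from
`ℋ³(A(M))` to the bicategory of descent data, i.e. of objects equivariant for the Čech groupoid of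
the cover. -/
def IsTwoStack (A : Mfld.{u}ᵒᵖ ⥤ CochainComplex AddCommGrpCat.{u} ℕ) : Prop :=
  ∀ (M : Mfld.{u}) [SecondCountableTopology M] (I : Type u) (U : I → TopologicalSpace.Opens M),
    (∀ x, ∃ i, x ∈ U i) → IsBiequivalence (restriction (A := A) (face_cechProj U))

end DiffCocycle

/-! Descent data form a cocycle in a Čech double complex. Write `δ = ∑ (-1)ⁱ ∂ᵢ^*`. An object `(c,
e, τ)` satisfies `dc = 0`, `δc = de`, `δe = -dτ` and `δτ = 0`, with `τ` a class in `A¹/dA⁰`. If the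
Čech direction is exact in positive degrees, a staircase trivializes it: `τ = δσ`, then `e + dσ =
δf`, and `c - df` is `δ`-closed, so it comes from `M`. The same argument, one and two steps shorter,
treats 1-arrows and 2-arrows.

There are two complications. A singular cochain on `M` is not determined by its restrictions to the
cover: the kernel of `π^*` consists of the cochains that vanish on small simplices, those contained
in a member of the cover. This kernel is acyclic in positive degrees, so a cochain that descends can
be corrected to have a prescribed differential. Moreover 2-arrows are classes modulo `dA⁰`. For `s >
0` a 0-cochain is `(c, 0, 0)` with differential `(dc, -c, 0)`, so `d` is injective in degree 0; then
`0 → A⁰ → A¹ → A¹/dA⁰ → 0` is exact and the quotient inherits Čech exactness. `CechAcyclic` collects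
these requirements, and `CechAcyclic.isBiequivalence_restriction` is the formal consequence.

The requirements are checked componentwise. For cochains, choosing a member of the cover for each
small simplex contracts the Čech complex (`cochain_cech_exact`). For forms, a partition of unity
does so (`form_cech_exact`). Acyclicity of the kernel is the theorem of small simplices: barycentric
subdivision yields a linear contraction of chains modulo small chains (`exists_contraction`), which
dualizes to any coefficients (`exists_cochain_d_eq`). -/

namespace DiffCocycle

/-! ### Descent from Čech acyclicity -/

section Descent

open Bicategory Opposite

variable (A : Mfld.{u}ᵒᵖ ⥤ CochainComplex AddCommGrpCat.{u} ℕ) (Γ : SemiSimplicialMfld.{u})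

/-- The Čech differential `∑ᵢ (-1)ⁱ ∂ᵢ^*`. -/
noncomputable def cechD (k n : ℕ) :
    (A.obj (op (Γ.obj n))).X k →+ (A.obj (op (Γ.obj (n + 1)))).X k :=
  ∑ i : Fin (n + 2), (-1 : ℤ) ^ (i : ℕ) • ((facePull A Γ n i).f k).hom

/-- The Čech differential on classes of 1-cochains. -/
noncomputable def cechClassD (n : ℕ) :
    TwoClass (A.obj (op (Γ.obj n))) →+ TwoClass (A.obj (op (Γ.obj (n + 1)))) :=
  ∑ i : Fin (n + 2), (-1 : ℤ) ^ (i : ℕ) • mapClass (facePull A Γ n i)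

variable {A Γ}

theorem cechD_apply (k n : ℕ) (z : (A.obj (op (Γ.obj n))).X k) :
    cechD A Γ k n z = ∑ i : Fin (n + 2), (-1 : ℤ) ^ (i : ℕ) • ((facePull A Γ n i).f k).hom z := by
  simp [cechD, AddMonoidHom.finsetSum_apply]

theorem cechClassD_apply (n : ℕ) (z : TwoClass (A.obj (op (Γ.obj n)))) :
    cechClassD A Γ n z = ∑ i : Fin (n + 2), (-1 : ℤ) ^ (i : ℕ) • mapClass (facePull A Γ n i) z := by
  simp [cechClassD, AddMonoidHom.finsetSum_apply]

theorem cechClassD_mk (n : ℕ) (z : (A.obj (op (Γ.obj n))).X 1) :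
    cechClassD A Γ n (QuotientAddGroup.mk z) = QuotientAddGroup.mk (cechD A Γ 1 n z) := by
  rw [cechClassD_apply, cechD_apply]
  let q := QuotientAddGroup.mk' ((A.obj (op (Γ.obj (n + 1)))).d 0 1).hom.range
  refine Eq.trans ?_ (map_sum q _ _).symm
  exact Finset.sum_congr rfl fun i _ ↦ (map_zsmul q _ _).symm

theorem hom_f_d {K L : CochainComplex AddCommGrpCat.{u} ℕ} (f : K ⟶ L) (i j : ℕ) (z : K.X i) :
    (L.d i j).hom ((f.f i).hom z) = (f.f j).hom ((K.d i j).hom z) :=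
  congrArg (fun g ↦ g.hom z) (f.comm i j)

theorem hom_d_d (K : CochainComplex AddCommGrpCat.{u} ℕ) (i j k : ℕ) (z : K.X i) :
    (K.d j k).hom ((K.d i j).hom z) = 0 :=
  congrArg (fun g ↦ g.hom z) (K.d_comp_d i j k)

theorem cechD_d (j k n : ℕ) (z : (A.obj (op (Γ.obj n))).X j) :
    cechD A Γ k n (((A.obj (op (Γ.obj n))).d j k).hom z) =
      ((A.obj (op (Γ.obj (n + 1)))).d j k).hom (cechD A Γ j n z) := by
  simp only [cechD_apply, map_sum, map_zsmul, hom_f_d]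

theorem dBar_mk (K : CochainComplex AddCommGrpCat.{u} ℕ) (z : K.X 1) :
    dBar K (QuotientAddGroup.mk z) = (K.d 1 2).hom z := rfl

theorem d_dBar (K : CochainComplex AddCommGrpCat.{u} ℕ) (t : TwoClass K) :
    (K.d 2 3).hom (dBar K t) = 0 := by
  obtain ⟨z, rfl⟩ := QuotientAddGroup.mk_surjective t
  exact hom_d_d K 1 2 3 z

theorem cechD_dBar (n : ℕ) (t : TwoClass (A.obj (op (Γ.obj n)))) :
    cechD A Γ 2 n (dBar _ t) = dBar _ (cechClassD A Γ n t) := by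
  obtain ⟨z, rfl⟩ := QuotientAddGroup.mk_surjective t
  rw [cechClassD_mk, dBar_mk, dBar_mk, cechD_d]

theorem facePull_facePull (k n : ℕ) {i j : Fin (n + 2)} (h : i ≤ j)
    (z : (A.obj (op (Γ.obj n))).X k) :
    ((facePull A Γ (n + 1) j.succ).f k).hom (((facePull A Γ n i).f k).hom z) =
      ((facePull A Γ (n + 1) i.castSucc).f k).hom (((facePull A Γ n j).f k).hom z) := by
  have h : facePull A Γ n i ≫ facePull A Γ (n + 1) j.succ =
      facePull A Γ n j ≫ facePull A Γ (n + 1) i.castSucc := by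
    rw [facePull, facePull, facePull, facePull, ← A.map_comp, ← A.map_comp, ← op_comp, ← op_comp,
      Γ.face_comp n i j h]
  exact congrArg (fun g ↦ (g.f k).hom z) h

theorem cechD_cechD (k n : ℕ) (z : (A.obj (op (Γ.obj n))).X k) :
    cechD A Γ k (n + 1) (cechD A Γ k n z) = 0 := by
  have h := alternating_sum_cancel (fun (i : Fin (n + 3)) (j : Fin (n + 2)) ↦
    ((facePull A Γ (n + 1) i).f k).hom (((facePull A Γ n j).f k).hom z))
    (fun i j hij ↦ facePull_facePull k n hij z)
  simp only [cechD_apply, map_sum, map_zsmul, Finset.smul_sum, smul_smul]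
  rw [Finset.sum_comm]
  simpa only [mul_comm] using h

theorem cechD_zero (k : ℕ) (z : (A.obj (op (Γ.obj 0))).X k) :
    cechD A Γ k 0 z = ((facePull A Γ 0 0).f k).hom z - ((facePull A Γ 0 1).f k).hom z := by
  simp [cechD_apply, Fin.sum_univ_two, sub_eq_add_neg]

theorem cechD_one (k : ℕ) (z : (A.obj (op (Γ.obj 1))).X k) :
    cechD A Γ k 1 z = ((facePull A Γ 1 0).f k).hom z - ((facePull A Γ 1 1).f k).hom z +
      ((facePull A Γ 1 2).f k).hom z := by
  simp [cechD_apply, Fin.sum_univ_three, sub_eq_add_neg]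

theorem cechClassD_zero (z : TwoClass (A.obj (op (Γ.obj 0)))) :
    cechClassD A Γ 0 z = mapClass (facePull A Γ 0 0) z - mapClass (facePull A Γ 0 1) z := by
  simp [cechClassD_apply, Fin.sum_univ_two, sub_eq_add_neg]

theorem cechClassD_one (z : TwoClass (A.obj (op (Γ.obj 1)))) :
    cechClassD A Γ 1 z = mapClass (facePull A Γ 1 0) z - mapClass (facePull A Γ 1 1) z +
      mapClass (facePull A Γ 1 2) z := by
  simp [cechClassD_apply, Fin.sum_univ_three, sub_eq_add_neg]

theorem cechClassD_two (z : TwoClass (A.obj (op (Γ.obj 2)))) :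
    cechClassD A Γ 2 z = mapClass (facePull A Γ 2 0) z - mapClass (facePull A Γ 2 1) z +
      mapClass (facePull A Γ 2 2) z - mapClass (facePull A Γ 2 3) z := by
  simp [cechClassD_apply, Fin.sum_univ_four, sub_eq_add_neg, pow_succ]

variable {M : Mfld.{u}}

variable (A) in
/-- The augmented Čech complexes of `A` along `π : Γ₀ → M` are exact in positive degrees, the kernel
of the augmentation is acyclic, and `d` is injective on 0-cochains of the levels of `Γ`. -/
structure CechAcyclic (π : Γ.obj 0 ⟶ M) : Prop where
  exact : ∀ k n (z : (A.obj (op (Γ.obj (n + 1)))).X k), cechD A Γ k (n + 1) z = 0 →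
    ∃ w, cechD A Γ k n w = z
  descend : ∀ k (z : (A.obj (op (Γ.obj 0))).X k), cechD A Γ k 0 z = 0 →
    ∃ w, ((A.map π.op).f k).hom w = z
  ker_acyclic : ∀ k (z : (A.obj (op M)).X (k + 1)),
    ((A.obj (op M)).d (k + 1) (k + 2)).hom z = 0 → ((A.map π.op).f (k + 1)).hom z = 0 →
      ∃ w, ((A.map π.op).f k).hom w = 0 ∧ ((A.obj (op M)).d k (k + 1)).hom w = z
  d_injective : ∀ n, Function.Injective ((A.obj (op (Γ.obj n))).d 0 1).hom

namespace CechAcyclic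

variable {π : Γ.obj 0 ⟶ M}

/-- Part of the long exact sequence of `0 → A⁰ → A¹ → A¹/dA⁰ → 0`. For a representative `z`, `δz =
dy`; then `d(δy) = δδz = 0` forces `δy = 0` by injectivity of `d`, so `y = δx` and `z - dx` is a
`δ`-closed representative. -/
theorem lift_class (h : CechAcyclic A π) (n : ℕ) (t : TwoClass (A.obj (op (Γ.obj n))))
    (ht : cechClassD A Γ n t = 0) :
    ∃ z : (A.obj (op (Γ.obj n))).X 1, QuotientAddGroup.mk z = t ∧ cechD A Γ 1 n z = 0 := by
  obtain ⟨z, rfl⟩ := QuotientAddGroup.mk_surjective t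
  rw [cechClassD_mk, QuotientAddGroup.eq_zero_iff] at ht
  obtain ⟨y, hy⟩ := ht
  have h0 : cechD A Γ 0 (n + 1) y = 0 := by
    apply h.d_injective
    rw [← cechD_d, hy, cechD_cechD, map_zero]
  obtain ⟨x, rfl⟩ := h.exact 0 n y h0
  refine ⟨z - ((A.obj (op (Γ.obj n))).d 0 1).hom x, ?_, ?_⟩
  · rw [QuotientAddGroup.eq]
    exact ⟨x, by abel⟩
  · rw [map_sub, cechD_d, hy, sub_self]

theorem exact_class (h : CechAcyclic A π) (n : ℕ) (t : TwoClass (A.obj (op (Γ.obj (n + 1)))))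
    (ht : cechClassD A Γ (n + 1) t = 0) : ∃ s, cechClassD A Γ n s = t := by
  obtain ⟨z, rfl, hz⟩ := h.lift_class _ t ht
  obtain ⟨w, rfl⟩ := h.exact _ _ z hz
  exact ⟨QuotientAddGroup.mk w, cechClassD_mk _ _⟩

/-- Descent for classes of 1-cochains with prescribed differential. -/
theorem descend_class (h : CechAcyclic A π) (t : TwoClass (A.obj (op (Γ.obj 0))))
    (ht : cechClassD A Γ 0 t = 0)
    (y : (A.obj (op M)).X 2) (hy : ((A.obj (op M)).d 2 3).hom y = 0)
    (hty : dBar _ t = ((A.map π.op).f 2).hom y) :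
    ∃ s, mapClass (A.map π.op) s = t ∧ dBar _ s = y := by
  obtain ⟨z, rfl, hz⟩ := h.lift_class _ t ht
  obtain ⟨w, rfl⟩ := h.descend _ z hz
  rw [dBar_mk, hom_f_d] at hty
  -- `dw` and `y` agree only after pullback along `π`. Their difference is a closed element of the
  -- acyclic kernel, so adding `v` corrects the differential without changing the pullback.
  obtain ⟨v, hv, hv'⟩ := h.ker_acyclic 1 (y - ((A.obj (op M)).d 1 2).hom w)
    (by rw [map_sub, hy, hom_d_d, sub_zero]) (by rw [map_sub, hty, sub_self])
  refine ⟨QuotientAddGroup.mk (w + v), ?_, ?_⟩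
  · change QuotientAddGroup.mk (((A.map π.op).f 1).hom (w + v)) = _
    rw [map_add, hv, add_zero]
  · rw [dBar_mk, map_add, hv', add_sub_cancel]

theorem cechD_restrict (hπ : Γ.face 0 0 ≫ π = Γ.face 0 1 ≫ π) (k : ℕ)
    (z : (A.obj (op M)).X k) : cechD A Γ k 0 (((A.map π.op).f k).hom z) = 0 := by
  rw [cechD_zero, facePull_restrict hπ, sub_self]

/-- If `π^*z = dy`, then `d(δy) = 0`, so `δy = 0` and `y = π^*x`. Now `z - dx` is closed and lies in
the kernel of `π^*`, hence is exact. The hypothesis that the class is closed cannot be dispensed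
with in this argument, since `π^*` may kill nonzero 1-cochains. -/
theorem class_injective (h : CechAcyclic A π) (hπ : Γ.face 0 0 ≫ π = Γ.face 0 1 ≫ π)
    (t : TwoClass (A.obj (op M))) (ht : mapClass (A.map π.op) t = 0) (hd : dBar _ t = 0) :
    t = 0 := by
  obtain ⟨z, rfl⟩ := QuotientAddGroup.mk_surjective t
  obtain ⟨y, hy⟩ := (QuotientAddGroup.eq_zero_iff _).1 ht
  have h0 : cechD A Γ 0 0 y = 0 := by
    apply h.d_injective
    rw [← cechD_d, hy, map_zero]
    exact cechD_restrict hπ 1 z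
  obtain ⟨x, rfl⟩ := h.descend 0 y h0
  rw [dBar_mk] at hd
  obtain ⟨w, -, hw⟩ := h.ker_acyclic 0 (z - ((A.obj (op M)).d 0 1).hom x)
    (by rw [map_sub, hd, hom_d_d, sub_zero]) (by rw [map_sub, ← hom_f_d, hy, sub_self])
  exact (QuotientAddGroup.eq_zero_iff _).2 ⟨w + x, by rw [map_add, hw, sub_add_cancel]⟩

/-- Descent for cochains with prescribed differential. -/
theorem descend_cochain (h : CechAcyclic A π) (k : ℕ) (z : (A.obj (op (Γ.obj 0))).X k)
    (hz : cechD A Γ k 0 z = 0) (y : (A.obj (op M)).X (k + 1))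
    (hy : ((A.obj (op M)).d (k + 1) (k + 2)).hom y = 0)
    (hzy : ((A.obj (op (Γ.obj 0))).d k (k + 1)).hom z = ((A.map π.op).f (k + 1)).hom y) :
    ∃ w, ((A.map π.op).f k).hom w = z ∧ ((A.obj (op M)).d k (k + 1)).hom w = y := by
  obtain ⟨w, rfl⟩ := h.descend k z hz
  rw [hom_f_d] at hzy
  obtain ⟨v, hv, hv'⟩ := h.ker_acyclic k (y - ((A.obj (op M)).d k (k + 1)).hom w)
    (by rw [map_sub, hy, hom_d_d, sub_zero]) (by rw [map_sub, hzy, sub_self])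
  exact ⟨w + v, by rw [map_add, hv, add_zero], by rw [map_add, hv', add_sub_cancel]⟩

end CechAcyclic

/-- A 2-arrow of equivariant objects is invertible. -/
def EqTwoHom.toIso {X Y : EqObj A Γ} {f g : X ⟶ Y} (s : EqTwoHom f g) : f ≅ g where
  hom := s
  inv :=
    { β := ⟨-s.β.val, by rw [map_neg, ← s.β.bdry]; abel⟩
      coh := by
        have h := s.coh
        change f.α.val + mapClass _ (-s.β.val) = mapClass _ (-s.β.val) + g.α.val
        rw [map_neg, map_neg, eq_neg_add_iff_add_eq, ← add_assoc, ← h]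
        abel }
  hom_inv_id := EqTwoHom.ext_val (add_neg_cancel _)
  inv_hom_id := EqTwoHom.ext_val (neg_add_cancel _)

/-- The inverse of a 1-arrow of equivariant objects. -/
def EqHom.reverse {X Y : EqObj A Γ} (f : X ⟶ Y) : Y ⟶ X where
  b := ⟨-f.b.val, by rw [map_neg, ← f.b.bdry]; abel⟩
  α := ⟨-f.α.val, by
    rw [map_neg, map_neg, map_neg, ← f.α.bdry]
    abel⟩
  coh := by
    have h := f.coh
    simp only [map_neg]
    rw [eq_neg_add_iff_add_eq, ← sub_eq_zero]
    rw [← sub_eq_zero] at h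
    rw [← neg_eq_zero, ← h]
    abel

/-- Every 1-arrow of equivariant objects is an equivalence. -/
noncomputable def EqHom.toEquivalence {X Y : EqObj A Γ} (f : X ⟶ Y) : Bicategory.Equivalence X Y :=
  Bicategory.Equivalence.mkOfAdjointifyCounit (f := f) (g := EqHom.reverse f)
    (EqHom.isoOfEq (add_neg_cancel f.b.val).symm (add_neg_cancel f.α.val).symm)
    (EqHom.isoOfEq (neg_add_cancel f.b.val) (neg_add_cancel f.α.val))

/-! ### Restriction is essentially surjective and fully faithful. -/

namespace CechAcyclic

variable {π : Γ.obj 0 ⟶ M}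

/-- The full staircase: the coherence of `τ` reads `δτ = 0`, and `τ`, `e`, `c` are successively
moved to data pulled back from `M`. -/
theorem exists_restrictObj (h : CechAcyclic A π) (hπ : Γ.face 0 0 ≫ π = Γ.face 0 1 ≫ π)
    (X : EqObj A Γ) : ∃ x, Nonempty (Bicategory.Equivalence (restrictObj hπ x) X) := by
  have hτ := X.τ.bdry
  have hc : cechD A Γ 3 0 X.c.val = ((A.obj (op (Γ.obj 1))).d 2 3).hom X.e.val :=
    (cechD_zero _ _).trans X.e.bdry
  have he : cechD A Γ 2 1 X.e.val = -dBar _ X.τ.val := by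
    rw [cechD_one, ← hτ]; abel
  obtain ⟨σ, hσ⟩ := h.exact_class 1 X.τ.val (by
    rw [cechClassD_two]
    have := X.coh
    rw [← sub_eq_zero] at this
    rw [← this]; abel)
  obtain ⟨f, hf⟩ := h.exact 2 0 (X.e.val + dBar _ σ) (by
    rw [map_add, cechD_dBar, hσ, he, neg_add_cancel])
  -- Prescribing the differential `0` makes `x` a cocycle on `M`, and not only after pullback.
  obtain ⟨x, hx, hdx⟩ := h.descend_cochain 3
    (X.c.val - ((A.obj (op (Γ.obj 0))).d 2 3).hom f) (by
      rw [map_sub, cechD_d, hf, map_add, d_dBar, hc, add_zero, sub_self]) 0 (map_zero _) (by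
      rw [map_sub, hom_d_d, X.c.closed, map_zero, sub_zero])
  -- The signs come from the conventions for arrows: `π^*x - c = d(-f)`, and `σ` is a 2-arrow
  -- because `dσ = δf - e`.
  refine ⟨⟨x, hdx⟩, ⟨EqHom.toEquivalence (Y := X)
    { b := ⟨-f, ?_⟩
      α := ⟨σ, ?_⟩
      coh := ?_ }⟩⟩
  · change ((A.map π.op).f 3).hom x - X.c.val = _
    rw [hx, map_neg]; abel
  · change ((facePull A Γ 0 1).f 2).hom (-f) + (0 : (A.obj (op (Γ.obj 1))).X 2) -
      (X.e.val + ((facePull A Γ 0 0).f 2).hom (-f)) = _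
    rw [cechD_zero] at hf
    rw [eq_comm, ← sub_eq_zero]
    rw [← sub_eq_zero] at hf
    simp only [map_neg, add_zero]
    rw [← neg_eq_zero, ← hf]
    abel
  · change (0 : TwoClass _) + _ + _ = _
    rw [← hσ, cechClassD_one]
    abel

/-- The staircase with one step less. Between restricted objects a 1-arrow `(b, α)` has `δb = -dα`
and `δα = 0`; with `α = δγ` the cochain `b + dγ` is `δ`-closed and descends, and `-γ` is the 2-arrow
from its restriction to the given arrow. -/
theorem exists_restrictMap (h : CechAcyclic A π) (hπ : Γ.face 0 0 ≫ π = Γ.face 0 1 ≫ π)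
    {x y : Cocycle (A.obj (op M))}
    (f : (restriction (A := A) hπ).obj x ⟶ (restriction (A := A) hπ).obj y) :
    ∃ b : x ⟶ y, Nonempty ((restriction (A := A) hπ).map b ≅ f) := by
  have hα : ((facePull A Γ 0 1).f 2).hom f.b.val + (0 : (A.obj (op (Γ.obj 1))).X 2) -
      (0 + ((facePull A Γ 0 0).f 2).hom f.b.val) = dBar _ f.α.val := f.α.bdry
  have hcoh : (0 : TwoClass _) + mapClass (facePull A Γ 1 2) f.α.val +
      mapClass (facePull A Γ 1 0) f.α.val = mapClass (facePull A Γ 1 1) f.α.val + 0 := f.coh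
  replace hα := (congrArg₂ _ (add_zero _) (zero_add _)).symm.trans hα
  rw [add_zero, zero_add] at hcoh
  obtain ⟨γ, hγ⟩ := h.exact_class 0 f.α.val (by
    rw [cechClassD_one, ← sub_eq_zero.2 hcoh]; abel)
  have hb : ((A.map π.op).f 3).hom x.val - ((A.map π.op).f 3).hom y.val =
    ((A.obj (op (Γ.obj 0))).d 2 3).hom f.b.val := f.b.bdry
  obtain ⟨b, hb1, hb2⟩ := h.descend_cochain 2 (f.b.val + dBar _ γ) (by
    rw [map_add, cechD_dBar, hγ, cechD_zero, ← hα]; abel) (x.val - y.val)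
    (by rw [map_sub, x.closed, y.closed, sub_zero])
    (by rw [map_add, d_dBar, add_zero, map_sub, hb])
  refine ⟨⟨b, hb2.symm⟩, ⟨EqTwoHom.toIso
    { β := ⟨-γ, ?_⟩
      coh := ?_ }⟩⟩
  · change f.b.val - ((A.map π.op).f 2).hom b = _
    rw [hb1, map_neg]; abel
  · change f.α.val + mapClass _ (-γ) = mapClass _ (-γ) + (0 : TwoClass _)
    rw [← hγ, cechClassD_zero, map_neg, map_neg]
    abel

/-- Since the `α`-components of restricted 1-arrows are zero, compatibility of `β` means `δβ = 0`,
and `descend_class` applies. -/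
theorem exists_restrictMap₂ (h : CechAcyclic A π) (hπ : Γ.face 0 0 ≫ π = Γ.face 0 1 ≫ π)
    {x y : Cocycle (A.obj (op M))} {b b' : x ⟶ y}
    (s : (restriction (A := A) hπ).map b ⟶ (restriction (A := A) hπ).map b') :
    ∃ a : b ⟶ b', (restriction (A := A) hπ).map₂ a = s := by
  have hs : ((A.map π.op).f 2).hom b'.val - ((A.map π.op).f 2).hom b.val = dBar _ s.β.val :=
    s.β.bdry
  have hcoh : (0 : TwoClass _) + mapClass (facePull A Γ 0 0) s.β.val =
    mapClass (facePull A Γ 0 1) s.β.val + 0 := s.coh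
  replace hcoh := (zero_add _).symm.trans (hcoh.trans (add_zero _))
  obtain ⟨a, ha, ha'⟩ := h.descend_class s.β.val (by rw [cechClassD_zero, hcoh, sub_self])
    (b'.val - b.val) (by rw [map_sub, ← b'.bdry, ← b.bdry, sub_self])
    (by rw [map_sub, ← hs])
  exact ⟨⟨a, ha'.symm⟩, EqTwoHom.ext_val ha⟩

theorem isBiequivalence_restriction (h : CechAcyclic A π)
    (hπ : Γ.face 0 0 ≫ π = Γ.face 0 1 ≫ π) : IsBiequivalence (restriction (A := A) hπ) := by
  refine ⟨fun x y ↦ ?_, h.exists_restrictObj hπ⟩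
  have h1 : ((restriction (A := A) hπ).toPrelaxFunctor.mapFunctor x y).Faithful := by
    constructor
    intro b b' a a' haa
    have haa : mapClass (A.map π.op) (TwoCell.val a) = mapClass (A.map π.op) (TwoCell.val a') :=
      congrArg (fun s : EqTwoHom (restrictMap hπ b) (restrictMap hπ b') ↦ s.β.val) haa
    -- Parallel 2-arrows have the same differential, so their difference is a closed class killed by
    -- `π^*`.
    refine TwoCell.ext (sub_eq_zero.1 (h.class_injective hπ _ ?_ ?_))
    · rw [map_sub, haa, sub_self]
    · rw [map_sub, ← TwoCell.bdry a, ← TwoCell.bdry a', sub_self]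
  have h2 : ((restriction (A := A) hπ).toPrelaxFunctor.mapFunctor x y).Full :=
    ⟨fun s ↦ h.exists_restrictMap₂ hπ s⟩
  have h3 : ((restriction (A := A) hπ).toPrelaxFunctor.mapFunctor x y).EssSurj :=
    ⟨fun f ↦ h.exists_restrictMap hπ f⟩
  exact { faithful := h1, full := h2, essSurj := h3 }

end CechAcyclic

end Descent

/-! ### Barycentric subdivision of chains of tuples -/

section Tuples

variable {X Y : Type*} {n : ℕ}

variable (X n) in
/-- Formal integral combinations of `n`-tuples of points. -/
abbrev TupleChain : Type _ := (Fin n → X) →₀ ℤ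

/-- The boundary `∑ᵢ (-1)ⁱ [x₀, …, x̂ᵢ, …, xₙ]`. -/
noncomputable def tupleBdry : TupleChain X (n + 1) →ₗ[ℤ] TupleChain X n :=
  Finsupp.linearCombination ℤ fun v ↦ ∑ i : Fin (n + 1),
    (-1 : ℤ) ^ (i : ℕ) • Finsupp.single (fun j ↦ v (i.succAbove j)) (1 : ℤ)

/-- The cone `[x₁, …, xₙ] ↦ [b, x₁, …, xₙ]`. -/
noncomputable def tupleCone (b : X) : TupleChain X n →ₗ[ℤ] TupleChain X (n + 1) :=
  Finsupp.linearCombination ℤ fun v ↦ Finsupp.single (Fin.cons b v : Fin (n + 1) → X) (1 : ℤ)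

/-- The map of chains of tuples induced by a map of points. -/
noncomputable def tupleMap (f : X → Y) : TupleChain X n →ₗ[ℤ] TupleChain Y n :=
  Finsupp.linearCombination ℤ fun v ↦ Finsupp.single (fun j ↦ f (v j)) (1 : ℤ)

theorem tupleBdry_single (v : Fin (n + 1) → X) : tupleBdry (Finsupp.single v 1) =
    ∑ i : Fin (n + 1), (-1 : ℤ) ^ (i : ℕ) • Finsupp.single (fun j ↦ v (i.succAbove j)) (1 : ℤ) := by
  rw [tupleBdry, Finsupp.linearCombination_single, one_smul]

theorem tupleCone_single (b : X) (v : Fin n → X) :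
    tupleCone b (Finsupp.single v 1) = Finsupp.single (Fin.cons b v : Fin (n + 1) → X) 1 := by
  rw [tupleCone, Finsupp.linearCombination_single, one_smul]

theorem tupleMap_single (f : X → Y) (v : Fin n → X) :
    tupleMap f (Finsupp.single v 1) = Finsupp.single (fun j ↦ f (v j)) 1 := by
  rw [tupleMap, Finsupp.linearCombination_single, one_smul]

/-- Linear maps from formal integral combinations agree if they do on the basis. -/
theorem chain_hom_ext {α A : Type*} [AddCommGroup A] {f g : (α →₀ ℤ) →ₗ[ℤ] A}
    (h : ∀ a, f (Finsupp.single a 1) = g (Finsupp.single a 1)) (x : α →₀ ℤ) : f x = g x := by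
  have : f = g := Finsupp.lhom_ext' fun a ↦ LinearMap.ext_ring (h a)
  rw [this]

theorem tupleBdry_tupleBdry (x : TupleChain X (n + 2)) : tupleBdry (tupleBdry x) = 0 := by
  refine chain_hom_ext (f := tupleBdry ∘ₗ tupleBdry) (g := 0) (fun v ↦ ?_) x
  cases n with
  | zero =>
    simp [tupleBdry_single, Fin.sum_univ_two, Subsingleton.elim _ (finZeroElim : Fin 0 → X)]
  | succ n =>
    have h := alternating_sum_cancel (fun (i : Fin (n + 3)) (j : Fin (n + 2)) ↦
      Finsupp.single (fun l ↦ v (i.succAbove (j.succAbove l))) (1 : ℤ)) fun i j hij ↦ by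
        simp only [succAbove_comm hij]
    simpa only [LinearMap.comp_apply, LinearMap.zero_apply, tupleBdry_single, map_sum, map_zsmul,
      Finset.smul_sum, smul_smul] using h

/-- Omitting the apex returns `x`; omitting a later entry shifts its position by one, whence the
sign. -/
theorem tupleBdry_tupleCone (b : X) (x : TupleChain X (n + 1)) :
    tupleBdry (tupleCone b x) = x - tupleCone b (tupleBdry x) := by
  refine chain_hom_ext (f := tupleBdry ∘ₗ tupleCone b)
    (g := LinearMap.id - tupleCone b ∘ₗ tupleBdry) (fun v ↦ ?_) x
  simp only [LinearMap.comp_apply, LinearMap.sub_apply, LinearMap.id_apply, tupleCone_single,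
    tupleBdry_single, map_sum, map_zsmul]
  rw [Fin.sum_univ_succ, sub_eq_add_neg, ← Finset.sum_neg_distrib]
  congr 1
  · simp
  · refine Finset.sum_congr rfl fun i _ ↦ ?_
    rw [Fin.val_succ, pow_succ, mul_neg_one, neg_smul]
    congr 3
    funext j
    refine Fin.cases ?_ (fun j ↦ ?_) j <;> simp

theorem tupleBdry_tupleCone_zero (b : X) (x : TupleChain X 0) :
    tupleBdry (tupleCone b x) = x := by
  refine chain_hom_ext (f := tupleBdry ∘ₗ tupleCone b) (g := LinearMap.id) (fun v ↦ ?_) x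
  simp only [LinearMap.comp_apply, LinearMap.id_apply, tupleCone_single, tupleBdry_single]
  simp

theorem tupleMap_tupleBdry (f : X → Y) (x : TupleChain X (n + 1)) :
    tupleMap f (tupleBdry x) = tupleBdry (tupleMap f x) := by
  refine chain_hom_ext (f := tupleMap f ∘ₗ tupleBdry) (g := tupleBdry ∘ₗ tupleMap f)
    (fun v ↦ ?_) x
  simp only [LinearMap.comp_apply, tupleMap_single, tupleBdry_single, map_sum, map_zsmul]

theorem tupleMap_tupleCone (f : X → Y) (b : X) (x : TupleChain X n) :
    tupleMap f (tupleCone b x) = tupleCone (f b) (tupleMap f x) := by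
  refine chain_hom_ext (f := tupleMap f ∘ₗ tupleCone b) (g := tupleCone (f b) ∘ₗ tupleMap f)
    (fun v ↦ ?_) x
  simp only [LinearMap.comp_apply, tupleMap_single, tupleCone_single]
  congr 1
  funext j
  refine Fin.cases ?_ (fun j ↦ ?_) j <;> simp

/-! ### Subdivision of tuples with respect to a choice of centres, and its homotopy to the identity.
-/

variable (β : ∀ n, (Fin (n + 1) → X) → X) (γ : ∀ n, (Fin (n + 1) → Y) → Y)

/-- The subdivision of chains of tuples that cones off at the points `β v`. -/
noncomputable def subdiv : ∀ n, TupleChain X n →ₗ[ℤ] TupleChain X n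
  | 0 => LinearMap.id
  | n + 1 => Finsupp.linearCombination ℤ fun v ↦
      tupleCone (β n v) (subdiv n (tupleBdry (Finsupp.single v 1)))

/-- The chain homotopy between the identity and the subdivision. -/
noncomputable def subdivHtpy : ∀ n, TupleChain X n →ₗ[ℤ] TupleChain X (n + 1)
  | 0 => 0
  | n + 1 => Finsupp.linearCombination ℤ fun v ↦ tupleCone (β n v)
      (Finsupp.single v 1 - subdivHtpy n (tupleBdry (Finsupp.single v 1)))

theorem subdiv_single (v : Fin (n + 1) → X) : subdiv β (n + 1) (Finsupp.single v 1) =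
    tupleCone (β n v) (subdiv β n (tupleBdry (Finsupp.single v 1))) := by
  rw [subdiv, Finsupp.linearCombination_single, one_smul]

theorem subdivHtpy_single (v : Fin (n + 1) → X) : subdivHtpy β (n + 1) (Finsupp.single v 1) =
    tupleCone (β n v)
      (Finsupp.single v 1 - subdivHtpy β n (tupleBdry (Finsupp.single v 1))) := by
  rw [subdivHtpy, Finsupp.linearCombination_single, one_smul]

/-- Purely formal, for arbitrary centres `β`. Write `T` for the homotopy and `S` for the
subdivision. By induction `∂(v - T∂v) = S∂v`, and the cone formula turns this into `∂Tv = (v - T∂v)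
- Sv`, as `Sv` is the cone on `S∂v`. -/
theorem tupleBdry_subdivHtpy (x : TupleChain X (n + 1)) :
    tupleBdry (subdivHtpy β (n + 1) x) =
      x - subdiv β (n + 1) x - subdivHtpy β n (tupleBdry x) := by
  induction n with
  | zero =>
    refine chain_hom_ext (f := tupleBdry ∘ₗ subdivHtpy β 1)
      (g := LinearMap.id - subdiv β 1 - subdivHtpy β 0 ∘ₗ tupleBdry) (fun v ↦ ?_) x
    simp only [LinearMap.comp_apply, LinearMap.sub_apply, LinearMap.id_apply, subdivHtpy_single,
      subdiv_single, tupleBdry_tupleCone]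
    simp only [subdivHtpy, subdiv, LinearMap.zero_apply, LinearMap.id_apply, sub_zero]
  | succ n ih =>
    refine chain_hom_ext (f := tupleBdry ∘ₗ subdivHtpy β (n + 2))
      (g := LinearMap.id - subdiv β (n + 2) - subdivHtpy β (n + 1) ∘ₗ tupleBdry) (fun v ↦ ?_) x
    simp only [LinearMap.comp_apply, LinearMap.sub_apply, LinearMap.id_apply, subdivHtpy_single,
      subdiv_single _ v, tupleBdry_tupleCone]
    rw [map_sub, ih, tupleBdry_tupleBdry, map_zero, sub_zero, sub_sub_cancel]
    abel

variable {β γ}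

/-- Naturality for maps that respect the centres. It is applied to affine maps of simplices, and
lets the subdivision of a singular simplex be computed on the tuple of vertices of its domain. -/
theorem tupleMap_subdiv {f : X → Y} (hf : ∀ n v, f (β n v) = γ n fun j ↦ f (v j))
    (x : TupleChain X n) : tupleMap f (subdiv β n x) = subdiv γ n (tupleMap f x) := by
  induction n with
  | zero => rfl
  | succ n ih =>
    refine chain_hom_ext (f := tupleMap f ∘ₗ subdiv β (n + 1))
      (g := subdiv γ (n + 1) ∘ₗ tupleMap f) (fun v ↦ ?_) x
    simp only [LinearMap.comp_apply, tupleMap_single, subdiv_single, tupleMap_tupleCone, ih,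
      tupleMap_tupleBdry, hf]

theorem tupleMap_subdivHtpy {f : X → Y} (hf : ∀ n v, f (β n v) = γ n fun j ↦ f (v j))
    (x : TupleChain X n) : tupleMap f (subdivHtpy β n x) = subdivHtpy γ n (tupleMap f x) := by
  induction n with
  | zero => simp [subdivHtpy]
  | succ n ih =>
    refine chain_hom_ext (f := tupleMap f ∘ₗ subdivHtpy β (n + 1))
      (g := subdivHtpy γ (n + 1) ∘ₗ tupleMap f) (fun v ↦ ?_) x
    simp only [LinearMap.comp_apply, tupleMap_single, subdivHtpy_single, tupleMap_tupleCone, ih,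
      tupleMap_tupleBdry, map_sub, hf]

/-- A linear map from formal combinations maps those supported in `s` into a submodule as soon as
it does so on the basis. -/
theorem map_mem_of_supported {α A : Type*} [AddCommGroup A] {s : Set α} {P : Submodule ℤ A}
    {f : (α →₀ ℤ) →ₗ[ℤ] A} (h : ∀ a ∈ s, f (Finsupp.single a 1) ∈ P) {x : α →₀ ℤ}
    (hx : x ∈ Finsupp.supported ℤ ℤ s) : f x ∈ P := by
  rw [Finsupp.supported_eq_span_single] at hx
  have : Submodule.span ℤ ((fun i ↦ Finsupp.single i (1 : ℤ)) '' s) ≤ P.comap f := by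
    rw [Submodule.span_le]
    rintro _ ⟨a, ha, rfl⟩
    exact h a ha
  exact this hx

/-- The chains supported in the tuples with values in `C`. -/
noncomputable def tuplesIn (C : Set X) (n : ℕ) : Submodule ℤ (TupleChain X n) :=
  Finsupp.supported ℤ ℤ {v | ∀ i, v i ∈ C}

theorem tupleBdry_mem {C : Set X} {x : TupleChain X (n + 1)} (hx : x ∈ tuplesIn C (n + 1)) :
    tupleBdry x ∈ tuplesIn C n := by
  refine map_mem_of_supported (fun v hv ↦ ?_) hx
  rw [tupleBdry_single]
  exact Submodule.sum_mem _ fun i _ ↦ Submodule.smul_mem _ _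
    (Finsupp.single_mem_supported ℤ _ fun j ↦ hv _)

theorem tupleCone_mem {C : Set X} {b : X} (hb : b ∈ C) {x : TupleChain X n}
    (hx : x ∈ tuplesIn C n) : tupleCone b x ∈ tuplesIn C (n + 1) := by
  refine map_mem_of_supported (fun v hv ↦ ?_) hx
  rw [tupleCone_single]
  exact Finsupp.single_mem_supported ℤ _ (Fin.cases hb hv)

theorem subdiv_mem {C : Set X} (hC : ∀ n (v : Fin (n + 1) → X), (∀ i, v i ∈ C) → β n v ∈ C)
    {x : TupleChain X n} (hx : x ∈ tuplesIn C n) : subdiv β n x ∈ tuplesIn C n := by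
  induction n with
  | zero => exact hx
  | succ n ih =>
    refine map_mem_of_supported (fun v hv ↦ ?_) hx
    rw [subdiv_single]
    exact tupleCone_mem (hC n v hv) (ih (tupleBdry_mem (Finsupp.single_mem_supported ℤ _ hv)))

theorem single_mem_mesh [PseudoMetricSpace X] {d : ℝ} {v : Fin n → X}
    (hv : ∀ i j, dist (v i) (v j) ≤ d) :
    Finsupp.single v 1 ∈ Finsupp.supported ℤ ℤ {v : Fin n → X | ∀ i j, dist (v i) (v j) ≤ d} :=
  Finsupp.single_mem_supported ℤ _ hv

/-- Subdivision contracts the mesh by the factor `r`. -/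
theorem subdiv_mesh [PseudoMetricSpace X] {r : ℝ} {N : ℕ} (hr : 0 ≤ r)
    (hβ : ∀ n ≤ N, ∀ (v : Fin (n + 1) → X) d, (∀ i j, dist (v i) (v j) ≤ d) →
      ∀ i, dist (v i) (β n v) ≤ r * d)
    (hball : ∀ n (v : Fin (n + 1) → X) c d, (∀ i, dist (v i) c ≤ d) → dist (β n v) c ≤ d)
    {d : ℝ} (hd : 0 ≤ d) (hn : n ≤ N + 1) {x : TupleChain X n}
    (hx : x ∈ Finsupp.supported ℤ ℤ {v | ∀ i j, dist (v i) (v j) ≤ d}) :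
    subdiv β n x ∈ Finsupp.supported ℤ ℤ {v | ∀ i j, dist (v i) (v j) ≤ r * d} := by
  induction n with
  | zero =>
    refine map_mem_of_supported (fun v hv ↦ ?_) hx
    exact Finsupp.single_mem_supported ℤ _ fun i ↦ i.elim0
  | succ n ih =>
    refine map_mem_of_supported (fun v hv ↦ ?_) hx
    rw [subdiv_single]
    -- A tuple of at most `N + 1` points has dimension at most `N`, which is the range in which the
    -- factor `r` is available.
    have hb := hβ n (by omega) v d hv
    -- Two bounds on the subdivided faces. Their points stay in the ball of radius `r * d` about the
    -- centre, by `hball`, which bounds the edges that meet the apex of the cone; the remaining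
    -- edges are bounded by induction on the faces.
    have h1 : subdiv β n (tupleBdry (Finsupp.single v 1)) ∈
        tuplesIn {y | dist y (β n v) ≤ r * d} n :=
      subdiv_mem (fun m w hw ↦ hball m w _ _ hw)
        (tupleBdry_mem (Finsupp.single_mem_supported ℤ _ hb))
    have h2 : subdiv β n (tupleBdry (Finsupp.single v 1)) ∈
        Finsupp.supported ℤ ℤ {v | ∀ i j, dist (v i) (v j) ≤ r * d} := by
      refine ih (by omega) ?_
      rw [tupleBdry_single]
      exact Submodule.sum_mem _ fun i _ ↦ Submodule.smul_mem _ _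
        (Finsupp.single_mem_supported ℤ _ fun j l ↦ hv _ _)
    have h3 := Submodule.mem_inf.2 ⟨h1, h2⟩
    rw [tuplesIn, ← Finsupp.supported_inter] at h3
    refine map_mem_of_supported (fun w hw ↦ ?_) h3
    rw [tupleCone_single]
    refine Finsupp.single_mem_supported ℤ _ fun i j ↦ ?_
    refine Fin.cases ?_ (fun i ↦ ?_) i <;> refine Fin.cases ?_ (fun j ↦ ?_) j
    · simpa using mul_nonneg hr hd
    · simpa [dist_comm] using hw.1 j
    · simpa using hw.1 i
    · simpa using hw.2 i j

theorem subdiv_iterate_mesh [PseudoMetricSpace X] {r : ℝ} {N : ℕ} (hr : 0 ≤ r)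
    (hβ : ∀ n ≤ N, ∀ (v : Fin (n + 1) → X) d, (∀ i j, dist (v i) (v j) ≤ d) →
      ∀ i, dist (v i) (β n v) ≤ r * d)
    (hball : ∀ n (v : Fin (n + 1) → X) c d, (∀ i, dist (v i) c ≤ d) → dist (β n v) c ≤ d)
    {d : ℝ} (hd : 0 ≤ d) (hn : n ≤ N + 1) {x : TupleChain X n}
    (hx : x ∈ Finsupp.supported ℤ ℤ {v | ∀ i j, dist (v i) (v j) ≤ d}) (m : ℕ) :
    (subdiv β n)^[m] x ∈ Finsupp.supported ℤ ℤ {v | ∀ i j, dist (v i) (v j) ≤ r ^ m * d} := by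
  induction m with
  | zero => simpa using hx
  | succ m ih =>
    rw [Function.iterate_succ_apply', pow_succ', mul_assoc]
    exact subdiv_mesh hr hβ hball (by positivity) hn ih

end Tuples

/-! ### Small simplices -/

section SmallSimplices

variable {E : Type*} [NormedAddCommGroup E] [NormedSpace ℝ E]
  {M : Type*} [TopologicalSpace M] [ChartedSpace E M] {j k l : ℕ}

/-- The linear map that sends the `i`-th basis vector to `v i`. -/
noncomputable def simplexLin (v : Fin (j + 1) → stdSimplex ℝ (Fin (k + 1))) :
    (Fin (j + 1) → ℝ) →L[ℝ] (Fin (k + 1) → ℝ) :=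
  LinearMap.toContinuousLinearMap (Fintype.linearCombination ℝ fun i ↦ (v i).1)

theorem simplexLin_apply (v : Fin (j + 1) → stdSimplex ℝ (Fin (k + 1))) (x : Fin (j + 1) → ℝ) :
    simplexLin v x = ∑ i, x i • (v i).1 := rfl

/-- The affine map of standard simplices that sends the `i`-th vertex to `v i`. -/
noncomputable def simplexMap (v : Fin (j + 1) → stdSimplex ℝ (Fin (k + 1)))
    (x : stdSimplex ℝ (Fin (j + 1))) : stdSimplex ℝ (Fin (k + 1)) :=
  ⟨simplexLin v x.1, (convex_stdSimplex ℝ _).sum_mem (fun i _ ↦ x.2.1 i) x.2.2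
    fun i _ ↦ (v i).2⟩

/-- The tuple of vertices of the standard simplex. -/
noncomputable def stdVertices (k : ℕ) (i : Fin (k + 1)) : stdSimplex ℝ (Fin (k + 1)) :=
  ⟨Pi.single i 1, single_mem_stdSimplex ℝ i⟩

/-- The barycenter of the standard simplex. -/
noncomputable def stdCenter (k : ℕ) : stdSimplex ℝ (Fin (k + 1)) :=
  ⟨fun _ ↦ ((k : ℝ) + 1)⁻¹, fun _ ↦ by positivity, by
    simp only [Finset.sum_const, Finset.card_univ, Fintype.card_fin, nsmul_eq_mul]
    push_cast
    exact mul_inv_cancel₀ (by positivity)⟩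

/-- The barycenter of a tuple of points of the standard simplex. -/
noncomputable def barycenter (k : ℕ) (n : ℕ) (v : Fin (n + 1) → stdSimplex ℝ (Fin (k + 1))) :
    stdSimplex ℝ (Fin (k + 1)) :=
  simplexMap v (stdCenter n)

theorem simplexMap_simplexMap (w : Fin (k + 1) → stdSimplex ℝ (Fin (l + 1)))
    (v : Fin (j + 1) → stdSimplex ℝ (Fin (k + 1))) (x : stdSimplex ℝ (Fin (j + 1))) :
    simplexMap w (simplexMap v x) = simplexMap (fun i ↦ simplexMap w (v i)) x := by
  apply Subtype.ext
  change simplexLin w (simplexLin v x.1) = simplexLin _ x.1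
  rw [simplexLin_apply v, map_sum, simplexLin_apply]
  simp only [map_smul]
  rfl

/-- Affine maps preserve barycenters; this is the hypothesis under which tuple subdivision is
natural. -/
theorem simplexMap_barycenter (w : Fin (k + 1) → stdSimplex ℝ (Fin (l + 1))) (n : ℕ)
    (v : Fin (n + 1) → stdSimplex ℝ (Fin (k + 1))) :
    simplexMap w (barycenter k n v) = barycenter l n fun i ↦ simplexMap w (v i) :=
  simplexMap_simplexMap _ _ _

theorem simplexMap_stdVertices (v : Fin (j + 1) → stdSimplex ℝ (Fin (k + 1))) (i : Fin (j + 1)) :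
    simplexMap v (stdVertices j i) = v i := by
  apply Subtype.ext
  change simplexLin v (Pi.single i 1) = _
  simp [simplexLin_apply, Pi.single_apply]

theorem simplexMap_id (x : stdSimplex ℝ (Fin (j + 1))) : simplexMap (stdVertices j) x = x := by
  apply Subtype.ext
  funext i
  change simplexLin (stdVertices j) x.1 i = _
  simp [simplexLin_apply, stdVertices, Pi.single_apply]

theorem dist_simplexMap_le {v : Fin (j + 1) → stdSimplex ℝ (Fin (k + 1))}
    {c : stdSimplex ℝ (Fin (k + 1))} {d : ℝ} (h : ∀ i, dist (v i) c ≤ d)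
    (x : stdSimplex ℝ (Fin (j + 1))) : dist (simplexMap v x) c ≤ d :=
  (convex_closedBall c.1 d).sum_mem (t := Finset.univ) (fun i _ ↦ x.2.1 i) x.2.2 fun i _ ↦ h i

/-- The difference is the average of the `n + 1` vectors `v i - v j`, of which the one with `j = i`
vanishes; this gives `n / (n + 1)`. Enlarging it to `N / (N + 1)` provides one factor below 1 for
all faces of an `N`-simplex. -/
theorem dist_barycenter_le {N n : ℕ} (hn : n ≤ N) {v : Fin (n + 1) → stdSimplex ℝ (Fin (k + 1))}
    {d : ℝ} (h : ∀ i j, dist (v i) (v j) ≤ d) (i : Fin (n + 1)) :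
    dist (v i) (barycenter k n v) ≤ (N / (N + 1) : ℝ) * d := by
  have hd : 0 ≤ d := dist_nonneg.trans (h i i)
  have hpos : (0 : ℝ) < n + 1 := by positivity
  have h1 : (v i).1 - (barycenter k n v).1 = ∑ j, ((n : ℝ) + 1)⁻¹ • ((v i).1 - (v j).1) := by
    change (v i).1 - ∑ j, ((n : ℝ) + 1)⁻¹ • (v j).1 = _
    simp only [smul_sub, Finset.sum_sub_distrib, ← Finset.sum_smul, Finset.sum_const,
      Finset.card_univ, Fintype.card_fin, nsmul_eq_mul]
    push_cast
    rw [mul_inv_cancel₀ hpos.ne', one_smul]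
  have h2 : dist (v i) (barycenter k n v) ≤ (n / (n + 1) : ℝ) * d := by
    rw [Subtype.dist_eq, dist_eq_norm, h1, Fin.sum_univ_succAbove _ i, sub_self, smul_zero,
      zero_add]
    refine (norm_sum_le _ _).trans ?_
    refine (Finset.sum_le_card_nsmul _ _ (((n : ℝ) + 1)⁻¹ * d) fun j _ ↦ ?_).trans_eq ?_
    · rw [norm_smul, Real.norm_of_nonneg (by positivity), ← dist_eq_norm]
      exact mul_le_mul_of_nonneg_left (h _ _) (by positivity)
    · simp only [Finset.card_univ, Fintype.card_fin, nsmul_eq_mul]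
      ring
  refine h2.trans (mul_le_mul_of_nonneg_right ?_ hd)
  have : (n : ℝ) ≤ N := by exact_mod_cast hn
  rw [div_le_div_iff₀ hpos (by positivity)]
  nlinarith

/-- The composition of a smooth simplex with an affine map of standard simplices. -/
noncomputable def SmoothSimplex.comp (σ : SmoothSimplex E M k)
    (v : Fin (j + 1) → stdSimplex ℝ (Fin (k + 1))) : SmoothSimplex E M j where
  toFun x := σ.toFun (simplexMap v x)
  exists_ext := by
    obtain ⟨U, f, hU, hs, hf, he⟩ := σ.exists_ext
    refine ⟨simplexLin v ⁻¹' U, f ∘ simplexLin v, hU.preimage (simplexLin v).continuous,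
      fun x hx ↦ hs (simplexMap v ⟨x, hx⟩).2, ?_, fun x ↦ he (simplexMap v x)⟩
    exact hf.comp (simplexLin v).contDiff.contMDiff.contMDiffOn fun x hx ↦ hx

theorem SmoothSimplex.comp_stdVertices (σ : SmoothSimplex E M k) :
    σ.comp (stdVertices k) = σ := by
  ext x
  simp only [SmoothSimplex.comp, simplexMap_id]

theorem SmoothSimplex.comp_comp (σ : SmoothSimplex E M l)
    (w : Fin (k + 1) → stdSimplex ℝ (Fin (l + 1))) (v : Fin (j + 1) → stdSimplex ℝ (Fin (k + 1))) :
    (σ.comp w).comp v = σ.comp fun i ↦ simplexMap w (v i) := by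
  ext x
  simp only [SmoothSimplex.comp, simplexMap_simplexMap]

theorem SmoothSimplex.face_comp (σ : SmoothSimplex E M k)
    (v : Fin (j + 2) → stdSimplex ℝ (Fin (k + 1))) (i : Fin (j + 2)) :
    (σ.comp v).face i = σ.comp fun l ↦ v (i.succAbove l) := by
  ext x
  simp only [SmoothSimplex.face, SmoothSimplex.comp]
  congr 1
  apply Subtype.ext
  change simplexLin v (faceIncl i x.1) = simplexLin _ x.1
  rw [simplexLin_apply, simplexLin_apply, Fin.sum_univ_succAbove _ i]
  simp [faceIncl_apply]

theorem SmoothSimplex.continuous_toFun (σ : SmoothSimplex E M k) : Continuous σ.toFun := by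
  obtain ⟨U, f, hU, hs, hf, he⟩ := σ.exists_ext
  have : σ.toFun = fun x ↦ f x.1 := funext fun x ↦ (he x).symm
  rw [this]
  exact (hf.continuousOn.mono hs).domRestrict

/-! ### Barycentric subdivision of smooth singular chains. -/

variable (E M k) in
/-- Smooth singular chains. -/
abbrev SChain : Type _ := SmoothSimplex E M k →₀ ℤ

/-- The singular boundary. -/
noncomputable def singBdry : SChain E M (k + 1) →ₗ[ℤ] SChain E M k :=
  Finsupp.linearCombination ℤ fun σ ↦ ∑ i : Fin (k + 2),
    (-1 : ℤ) ^ (i : ℕ) • Finsupp.single (σ.face i) (1 : ℤ)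

/-- The image under `σ` of chains of tuples of points of the standard simplex. -/
noncomputable def SmoothSimplex.pushTuples (σ : SmoothSimplex E M k) (j : ℕ) :
    TupleChain (stdSimplex ℝ (Fin (k + 1))) (j + 1) →ₗ[ℤ] SChain E M j :=
  Finsupp.linearCombination ℤ fun v ↦ Finsupp.single (σ.comp v) (1 : ℤ)

variable (E M k) in
/-- Barycentric subdivision of singular chains. -/
noncomputable def singSubdiv : SChain E M k →ₗ[ℤ] SChain E M k :=
  Finsupp.linearCombination ℤ fun σ ↦ σ.pushTuples k
    (subdiv (barycenter k) (k + 1) (Finsupp.single (stdVertices k) 1))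

variable (E M k) in
/-- The chain homotopy between the identity and barycentric subdivision. -/
noncomputable def singHtpy : SChain E M k →ₗ[ℤ] SChain E M (k + 1) :=
  Finsupp.linearCombination ℤ fun σ ↦ σ.pushTuples (k + 1)
    (subdivHtpy (barycenter k) (k + 1) (Finsupp.single (stdVertices k) 1))

theorem singBdry_single (σ : SmoothSimplex E M (k + 1)) : singBdry (Finsupp.single σ 1) =
    ∑ i : Fin (k + 2), (-1 : ℤ) ^ (i : ℕ) • Finsupp.single (σ.face i) (1 : ℤ) := by
  rw [singBdry, Finsupp.linearCombination_single, one_smul]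

theorem SmoothSimplex.pushTuples_single (σ : SmoothSimplex E M k)
    (v : Fin (j + 1) → stdSimplex ℝ (Fin (k + 1))) :
    σ.pushTuples j (Finsupp.single v 1) = Finsupp.single (σ.comp v) 1 := by
  rw [pushTuples, Finsupp.linearCombination_single, one_smul]

theorem singSubdiv_single (σ : SmoothSimplex E M k) : singSubdiv E M k (Finsupp.single σ 1) =
    σ.pushTuples k (subdiv (barycenter k) (k + 1) (Finsupp.single (stdVertices k) 1)) := by
  rw [singSubdiv, Finsupp.linearCombination_single, one_smul]

theorem singHtpy_single (σ : SmoothSimplex E M k) : singHtpy E M k (Finsupp.single σ 1) =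
    σ.pushTuples (k + 1)
      (subdivHtpy (barycenter k) (k + 1) (Finsupp.single (stdVertices k) 1)) := by
  rw [singHtpy, Finsupp.linearCombination_single, one_smul]

theorem singBdry_singBdry (x : SChain E M (k + 2)) : singBdry (singBdry x) = 0 := by
  refine chain_hom_ext (f := singBdry ∘ₗ singBdry) (g := 0) (fun σ ↦ ?_) x
  have h := alternating_sum_cancel (fun (i : Fin (k + 3)) (j : Fin (k + 2)) ↦
    Finsupp.single ((σ.face i).face j) (1 : ℤ)) fun i j hij ↦ by
      rw [SmoothSimplex.face_face hij]
  simpa only [LinearMap.comp_apply, LinearMap.zero_apply, singBdry_single, map_sum, map_zsmul,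
    Finset.smul_sum, smul_smul] using h

theorem SmoothSimplex.singBdry_pushTuples (σ : SmoothSimplex E M k)
    (x : TupleChain (stdSimplex ℝ (Fin (k + 1))) (j + 2)) :
    singBdry (σ.pushTuples (j + 1) x) = σ.pushTuples j (tupleBdry x) := by
  refine chain_hom_ext (f := singBdry ∘ₗ σ.pushTuples (j + 1)) (g := σ.pushTuples j ∘ₗ tupleBdry)
    (fun v ↦ ?_) x
  simp only [LinearMap.comp_apply, pushTuples_single, singBdry_single, tupleBdry_single, map_sum,
    map_zsmul, face_comp]

theorem SmoothSimplex.pushTuples_comp (σ : SmoothSimplex E M l)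
    (w : Fin (k + 1) → stdSimplex ℝ (Fin (l + 1)))
    (x : TupleChain (stdSimplex ℝ (Fin (k + 1))) (j + 1)) :
    (σ.comp w).pushTuples j x = σ.pushTuples j (tupleMap (simplexMap w) x) := by
  refine chain_hom_ext (f := (σ.comp w).pushTuples j)
    (g := σ.pushTuples j ∘ₗ tupleMap (simplexMap w)) (fun v ↦ ?_) x
  simp only [LinearMap.comp_apply, pushTuples_single, tupleMap_single, comp_comp]

/-- Subdividing `σ ∘ v` means pushing forward the subdivided vertex tuple along `σ ∘ v`. The affine
map of `v` commutes with subdivision and sends the vertices to `v`, so everything takes place inside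
the domain of `σ`. -/
theorem SmoothSimplex.singSubdiv_pushTuples (σ : SmoothSimplex E M k)
    (x : TupleChain (stdSimplex ℝ (Fin (k + 1))) (j + 1)) :
    singSubdiv E M j (σ.pushTuples j x) = σ.pushTuples j (subdiv (barycenter k) (j + 1) x) := by
  refine chain_hom_ext (f := singSubdiv E M j ∘ₗ σ.pushTuples j)
    (g := σ.pushTuples j ∘ₗ subdiv (barycenter k) (j + 1)) (fun v ↦ ?_) x
  simp only [LinearMap.comp_apply, pushTuples_single, singSubdiv_single, pushTuples_comp]
  rw [tupleMap_subdiv (simplexMap_barycenter v), tupleMap_single]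
  simp only [simplexMap_stdVertices]

theorem SmoothSimplex.singHtpy_pushTuples (σ : SmoothSimplex E M k)
    (x : TupleChain (stdSimplex ℝ (Fin (k + 1))) (j + 1)) :
    singHtpy E M j (σ.pushTuples j x) =
      σ.pushTuples (j + 1) (subdivHtpy (barycenter k) (j + 1) x) := by
  refine chain_hom_ext (f := singHtpy E M j ∘ₗ σ.pushTuples j)
    (g := σ.pushTuples (j + 1) ∘ₗ subdivHtpy (barycenter k) (j + 1)) (fun v ↦ ?_) x
  simp only [LinearMap.comp_apply, pushTuples_single, singHtpy_single, pushTuples_comp]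
  rw [tupleMap_subdivHtpy (simplexMap_barycenter v), tupleMap_single]
  simp only [simplexMap_stdVertices]

/-- A simplex is the push-forward of its vertex tuple, and push-forward intertwines boundary,
subdivision and homotopy with those of tuples, so the identity is that of `tupleBdry_subdivHtpy`. -/
theorem singBdry_singHtpy (x : SChain E M (k + 1)) :
    singBdry (singHtpy E M (k + 1) x) =
      x - singSubdiv E M (k + 1) x - singHtpy E M k (singBdry x) := by
  refine chain_hom_ext (f := singBdry ∘ₗ singHtpy E M (k + 1))
    (g := LinearMap.id - singSubdiv E M (k + 1) - singHtpy E M k ∘ₗ singBdry) (fun σ ↦ ?_) x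
  have h : (Finsupp.single σ 1 : SChain E M (k + 1)) =
      σ.pushTuples (k + 1) (Finsupp.single (stdVertices (k + 1)) 1) := by
    rw [SmoothSimplex.pushTuples_single, SmoothSimplex.comp_stdVertices]
  simp only [LinearMap.comp_apply, LinearMap.sub_apply, LinearMap.id_apply]
  rw [h, σ.singBdry_pushTuples, σ.singHtpy_pushTuples, σ.singHtpy_pushTuples,
    σ.singSubdiv_pushTuples, σ.singBdry_pushTuples, tupleBdry_subdivHtpy, map_sub, map_sub]

/-! ### Small simplices and the contraction of chains modulo small chains. -/

variable {ι : Type*} (U : ι → Set M)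

/-- A simplex is small if it is contained in a member of the cover. -/
def SmoothSimplex.IsSmall (σ : SmoothSimplex E M k) : Prop :=
  ∃ i, ∀ x, σ.toFun x ∈ U i

variable (E) in
/-- The chains of small simplices. -/
noncomputable def smallChains (k : ℕ) : Submodule ℤ (SChain E M k) :=
  Finsupp.supported ℤ ℤ {σ | σ.IsSmall U}

variable {U}

theorem SmoothSimplex.IsSmall.comp {σ : SmoothSimplex E M k} (h : σ.IsSmall U)
    (v : Fin (j + 1) → stdSimplex ℝ (Fin (k + 1))) : (σ.comp v).IsSmall U :=
  h.imp fun _ hi _ ↦ hi _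

theorem SmoothSimplex.IsSmall.face {σ : SmoothSimplex E M (k + 1)} (h : σ.IsSmall U)
    (i : Fin (k + 2)) : (σ.face i).IsSmall U :=
  h.imp fun _ hi _ ↦ hi _

theorem single_mem_smallChains {σ : SmoothSimplex E M k} (h : σ.IsSmall U) :
    Finsupp.single σ 1 ∈ smallChains E U k :=
  Finsupp.single_mem_supported ℤ _ h

theorem SmoothSimplex.IsSmall.pushTuples_mem {σ : SmoothSimplex E M k} (h : σ.IsSmall U)
    (x : TupleChain (stdSimplex ℝ (Fin (k + 1))) (j + 1)) :
    σ.pushTuples j x ∈ smallChains E U j := by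
  refine map_mem_of_supported (s := Set.univ) (fun v _ ↦ ?_) (by simp)
  rw [pushTuples_single]
  exact single_mem_smallChains (h.comp v)

theorem singBdry_mem {x : SChain E M (k + 1)} (hx : x ∈ smallChains E U (k + 1)) :
    singBdry x ∈ smallChains E U k := by
  refine map_mem_of_supported (fun σ hσ ↦ ?_) hx
  rw [singBdry_single]
  exact Submodule.sum_mem _ fun i _ ↦ Submodule.smul_mem _ _
    (single_mem_smallChains (SmoothSimplex.IsSmall.face hσ i))

theorem singSubdiv_mem {x : SChain E M k} (hx : x ∈ smallChains E U k) :
    singSubdiv E M k x ∈ smallChains E U k := by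
  refine map_mem_of_supported (fun σ hσ ↦ ?_) hx
  rw [singSubdiv_single]
  exact SmoothSimplex.IsSmall.pushTuples_mem hσ _

theorem singHtpy_mem {x : SChain E M k} (hx : x ∈ smallChains E U k) :
    singHtpy E M k x ∈ smallChains E U (k + 1) := by
  refine map_mem_of_supported (fun σ hσ ↦ ?_) hx
  rw [singHtpy_single]
  exact SmoothSimplex.IsSmall.pushTuples_mem hσ _

/-- The pulled back cover of the compact standard simplex has a Lebesgue number, and the mesh of the
`m`-th subdivision is at most `(k / (k + 1)) ^ m` times the diameter, hence tends to zero. -/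
theorem SmoothSimplex.exists_subdiv_mem (hU : ∀ i, IsOpen (U i)) (hc : ∀ x, ∃ i, x ∈ U i)
    (σ : SmoothSimplex E M k) :
    ∃ m, (singSubdiv E M k)^[m] (Finsupp.single σ 1) ∈ smallChains E U k := by
  obtain ⟨δ, hδ, hball⟩ := lebesgue_number_lemma_of_metric
    (s := (Set.univ : Set (stdSimplex ℝ (Fin (k + 1))))) (c := fun i ↦ σ.toFun ⁻¹' U i)
    isCompact_univ (fun i ↦ (hU i).preimage σ.continuous_toFun)
    fun x _ ↦ mem_iUnion.2 (hc (σ.toFun x))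
  set d := Metric.diam (Set.univ : Set (stdSimplex ℝ (Fin (k + 1))))
  have hr : (0 : ℝ) ≤ k / (k + 1) := by positivity
  have hr1 : (k / (k + 1) : ℝ) < 1 := by
    rw [div_lt_one (by positivity)]; linarith
  obtain ⟨m, hm⟩ : ∃ m : ℕ, (k / (k + 1) : ℝ) ^ m * d < δ := by
    have := (tendsto_pow_atTop_nhds_zero_of_lt_one hr hr1).mul_const d
    rw [zero_mul] at this
    exact (this.eventually (gt_mem_nhds hδ)).exists
  refine ⟨m, ?_⟩
  have h1 : ∀ m, (singSubdiv E M k)^[m] (Finsupp.single σ 1) = σ.pushTuples k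
      ((subdiv (barycenter k) (k + 1))^[m] (Finsupp.single (stdVertices k) 1)) := by
    intro m
    induction m with
    | zero =>
      simp only [Function.iterate_zero, id, pushTuples_single, comp_stdVertices]
    | succ m ih =>
      rw [Function.iterate_succ_apply', ih, singSubdiv_pushTuples, Function.iterate_succ_apply']
  rw [h1]
  have h2 := subdiv_iterate_mesh (β := barycenter k) (N := k) (n := k + 1) (d := d) hr
    (fun n hn v d hv i ↦ dist_barycenter_le hn hv i)
    (fun n v c d hv ↦ dist_simplexMap_le hv _) Metric.diam_nonneg le_rfl
    (single_mem_mesh (v := stdVertices k) fun i j ↦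
      Metric.dist_le_diam_of_mem isCompact_univ.isBounded (mem_univ _) (mem_univ _)) m
  refine map_mem_of_supported (fun v hv ↦ ?_) h2
  rw [pushTuples_single]
  -- By convexity of balls, every point of the affine simplex spanned by `v`, and not only its
  -- vertices, is within `δ` of `v 0`.
  obtain ⟨i, hi⟩ := hball (v 0) (mem_univ _)
  exact single_mem_smallChains ⟨i, fun x ↦
    hi ((dist_simplexMap_le (fun j ↦ hv j 0) x).trans_lt hm)⟩

theorem iterate_singSubdiv_mem {x : SChain E M k} (hx : x ∈ smallChains E U k) (m : ℕ) :
    (singSubdiv E M k)^[m] x ∈ smallChains E U k := by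
  induction m with
  | zero => exact hx
  | succ m ih =>
    rw [Function.iterate_succ_apply']
    exact singSubdiv_mem ih

/-- Different simplices need different numbers of subdivisions. Further subdivision keeps a small
chain small, so for a sum the two numbers can be added. -/
theorem exists_iterate_singSubdiv_mem (hU : ∀ i, IsOpen (U i)) (hc : ∀ x, ∃ i, x ∈ U i)
    (x : SChain E M k) : ∃ m, (singSubdiv E M k)^[m] x ∈ smallChains E U k := by
  have hadd : ∀ m (x y : SChain E M k), (singSubdiv E M k)^[m] (x + y) =
      (singSubdiv E M k)^[m] x + (singSubdiv E M k)^[m] y := fun m x y ↦ by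
    rw [← Module.End.pow_apply, ← Module.End.pow_apply, ← Module.End.pow_apply, map_add]
  induction x using Finsupp.induction_linear with
  | zero => exact ⟨0, Submodule.zero_mem _⟩
  | add x y hx hy =>
    obtain ⟨a, ha⟩ := hx
    obtain ⟨b, hb⟩ := hy
    refine ⟨a + b, ?_⟩
    rw [hadd]
    refine Submodule.add_mem _ ?_ ?_
    · rw [add_comm, Function.iterate_add_apply]
      exact iterate_singSubdiv_mem ha b
    · rw [Function.iterate_add_apply]
      exact iterate_singSubdiv_mem hb a
  | single σ n =>
    obtain ⟨m, hm⟩ := σ.exists_subdiv_mem hU hc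
    refine ⟨m, ?_⟩
    have : (Finsupp.single σ n : SChain E M k) = n • Finsupp.single σ 1 := by simp
    rw [this, ← Module.End.pow_apply, map_zsmul, Module.End.pow_apply]
    exact Submodule.smul_mem _ _ hm

/-- A chain with small boundary is a boundary up to a small chain. -/
theorem exists_sub_singBdry_mem (hU : ∀ i, IsOpen (U i)) (hc : ∀ x, ∃ i, x ∈ U i)
    (z : SChain E M (k + 1)) (hz : singBdry z ∈ smallChains E U k) :
    ∃ w, z - singBdry w ∈ smallChains E U (k + 1) := by
  obtain ⟨m, hm⟩ := exists_iterate_singSubdiv_mem hU hc z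
  induction m generalizing z with
  | zero => exact ⟨0, by simpa using hm⟩
  | succ m ih =>
    -- With `T` the homotopy, `T∂z` is small because `∂z` is. Modulo small chains `z` is therefore
    -- the boundary of `Tz` plus the subdivision of `z`, which needs one subdivision less and again
    -- has small boundary.
    have h1 := singBdry_singHtpy z
    have h2 : singSubdiv E M (k + 1) z =
        z - singBdry (singHtpy E M (k + 1) z) - singHtpy E M k (singBdry z) := by
      rw [h1]; abel
    have h3 := singHtpy_mem hz
    obtain ⟨w, hw⟩ := ih (singSubdiv E M (k + 1) z) (by
      rw [h2, map_sub, map_sub, singBdry_singBdry, sub_zero]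
      exact Submodule.sub_mem _ hz (singBdry_mem h3)) hm
    refine ⟨singHtpy E M (k + 1) z + w, ?_⟩
    have h4 := Submodule.add_mem _ hw h3
    rw [h2] at h4
    rw [map_add]
    convert h4 using 1
    abel

/-- The inductive step in the construction of a contraction of the complex of chains modulo small
chains. -/
theorem exists_contraction_step (hU : ∀ i, IsOpen (U i)) (hc : ∀ x, ∃ i, x ∈ U i)
    (D : SChain E M k →ₗ[ℤ] SChain E M (k + 1))
    (hD : ∀ x ∈ smallChains E U k, D x ∈ smallChains E U (k + 1))
    (hD' : ∀ x, singBdry (x - D (singBdry x)) ∈ smallChains E U k) :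
    ∃ D' : SChain E M (k + 1) →ₗ[ℤ] SChain E M (k + 2),
      (∀ x ∈ smallChains E U (k + 1), D' x ∈ smallChains E U (k + 2)) ∧
        ∀ x, x - D (singBdry x) - singBdry (D' x) ∈ smallChains E U (k + 1) := by
  -- The quotient by small chains is free on the simplices that are not small, so the next map can
  -- be chosen generator by generator. The value `0` on small simplices makes it preserve small
  -- chains.
  have key : ∀ σ : SmoothSimplex E M (k + 1), ∃ w : SChain E M (k + 2),
      (σ.IsSmall U → w = 0) ∧ Finsupp.single σ 1 - D (singBdry (Finsupp.single σ 1)) - singBdry w ∈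
        smallChains E U (k + 1) := by
    intro σ
    by_cases hσ : σ.IsSmall U
    · refine ⟨0, fun _ ↦ rfl, ?_⟩
      rw [map_zero, sub_zero]
      exact Submodule.sub_mem _ (single_mem_smallChains hσ)
        (hD _ (singBdry_mem (single_mem_smallChains hσ)))
    · obtain ⟨w, hw⟩ := exists_sub_singBdry_mem hU hc _ (hD' (Finsupp.single σ 1))
      exact ⟨w, fun h ↦ absurd h hσ, hw⟩
  choose W hW hW' using key
  refine ⟨Finsupp.linearCombination ℤ W, fun x hx ↦ ?_, fun x ↦ ?_⟩
  · refine map_mem_of_supported (fun σ hσ ↦ ?_) hx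
    rw [Finsupp.linearCombination_single, hW σ hσ, smul_zero]
    exact Submodule.zero_mem _
  · refine map_mem_of_supported (s := Set.univ)
      (f := LinearMap.id - D ∘ₗ singBdry - singBdry ∘ₗ Finsupp.linearCombination ℤ W)
      (fun σ _ ↦ ?_) (by simp)
    simp only [LinearMap.comp_apply, LinearMap.sub_apply, LinearMap.id_apply,
      Finsupp.linearCombination_single, one_smul]
    exact hW' σ

-- The quotient of chains by small chains is acyclic, free and bounded below, hence contractible. A
-- contraction by linear maps, rather than acyclicity alone, is what survives dualization with
-- arbitrary coefficients. Two consecutive maps are kept because the homotopy identity involves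
-- both.
variable (E) in
theorem exists_contraction (hU : ∀ i, IsOpen (U i)) (hc : ∀ x, ∃ i, x ∈ U i) (k : ℕ) :
    ∃ (D : SChain E M k →ₗ[ℤ] SChain E M (k + 1))
      (D' : SChain E M (k + 1) →ₗ[ℤ] SChain E M (k + 2)),
      (∀ x ∈ smallChains E U k, D x ∈ smallChains E U (k + 1)) ∧
      (∀ x ∈ smallChains E U (k + 1), D' x ∈ smallChains E U (k + 2)) ∧
        ∀ x, x - D (singBdry x) - singBdry (D' x) ∈ smallChains E U (k + 1) := by
  induction k with
  | zero =>
    -- A 0-simplex is a point and lies in a member of the cover: the quotient vanishes in degree 0,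
    -- so the contraction may start with zero.
    have h0 : ∀ x : SChain E M 0, x ∈ smallChains E U 0 := by
      intro x
      refine map_mem_of_supported (s := Set.univ) (f := LinearMap.id) (fun σ _ ↦ ?_) (by simp)
      obtain ⟨i, hi⟩ := hc (σ.toFun (stdVertices 0 0))
      refine single_mem_smallChains ⟨i, fun x ↦ ?_⟩
      have : x = stdVertices 0 0 := Subsingleton.elim _ _
      rwa [this]
    obtain ⟨D', h1, h2⟩ := exists_contraction_step hU hc (0 : SChain E M 0 →ₗ[ℤ] SChain E M 1)
      (fun _ _ ↦ Submodule.zero_mem _) fun _ ↦ h0 _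
    exact ⟨0, D', fun _ _ ↦ Submodule.zero_mem _, h1, h2⟩
  | succ k ih =>
    obtain ⟨D, D', -, h1, h2⟩ := ih
    -- The chain `∂(x - D'∂x) = ∂x - ∂D'∂x` is small by the previous homotopy relation at `∂x`,
    -- where the term with `D` vanishes since `∂∂x = 0`.
    obtain ⟨D'', h3, h4⟩ := exists_contraction_step hU hc D' h1 fun x ↦ by
      have := h2 (singBdry x)
      rwa [singBdry_singBdry, map_zero, sub_zero, ← map_sub] at this
    exact ⟨D', D'', h1, h3, h4⟩

/-! ### Cochains that vanish on small simplices. -/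

variable {R : Type*} [AddCommGroup R]

theorem linearCombination_cochain_d (c : SCochain E M k R) (x : SChain E M (k + 1)) :
    Finsupp.linearCombination ℤ (SCochain.d c) x =
      Finsupp.linearCombination ℤ c (singBdry x) := by
  refine chain_hom_ext (f := Finsupp.linearCombination ℤ (SCochain.d c))
    (g := Finsupp.linearCombination ℤ c ∘ₗ singBdry) (fun σ ↦ ?_) x
  simp only [LinearMap.comp_apply, singBdry_single, map_sum, map_zsmul,
    Finsupp.linearCombination_single, one_smul]
  rfl

theorem linearCombination_eq_zero {c : SCochain E M k R} (hc : ∀ σ, σ.IsSmall U → c σ = 0)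
    {x : SChain E M k} (hx : x ∈ smallChains E U k) : Finsupp.linearCombination ℤ c x = 0 := by
  rw [← Submodule.mem_bot ℤ]
  refine map_mem_of_supported (fun σ hσ ↦ ?_) hx
  rw [Finsupp.linearCombination_single, hc σ hσ, smul_zero]
  exact Submodule.zero_mem _

/-- The complex of cochains that vanish on small simplices is acyclic. -/
theorem exists_cochain_d_eq (hU : ∀ i, IsOpen (U i)) (hc : ∀ x, ∃ i, x ∈ U i)
    (c : SCochain E M (k + 1) R) (hs : ∀ σ, σ.IsSmall U → c σ = 0) (hd : SCochain.d c = 0) :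
    ∃ e : SCochain E M k R, (∀ σ, σ.IsSmall U → e σ = 0) ∧ SCochain.d e = c := by
  obtain ⟨D, D', h1, h2, h3⟩ := exists_contraction E hU hc k
  -- The dual of the contraction, `e = c ∘ D`. As `c` kills small chains, `(de)(σ) = c(D∂σ) = c(σ) -
  -- c(∂D'σ)`, and the last term is `(dc)(D'σ) = 0`. It vanishes on small simplices because `D`
  -- preserves small chains.
  set e : SCochain E M k R := fun σ ↦
    Finsupp.linearCombination ℤ c (D (Finsupp.single σ 1)) with he
  have h4 : ∀ x, Finsupp.linearCombination ℤ e x = Finsupp.linearCombination ℤ c (D x) := by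
    intro x
    refine chain_hom_ext (f := Finsupp.linearCombination ℤ e)
      (g := Finsupp.linearCombination ℤ c ∘ₗ D) (fun σ ↦ ?_) x
    rw [Finsupp.linearCombination_single, one_smul, LinearMap.comp_apply]
  refine ⟨e, fun σ hσ ↦ linearCombination_eq_zero hs (h1 _ (single_mem_smallChains hσ)), ?_⟩
  funext σ
  have h5 := linearCombination_cochain_d e (Finsupp.single σ 1)
  rw [Finsupp.linearCombination_single, one_smul] at h5
  rw [h5, h4]
  have h6 := linearCombination_eq_zero hs (h3 (Finsupp.single σ 1))
  rw [map_sub, map_sub, ← linearCombination_cochain_d, hd, Finsupp.linearCombination_single,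
    one_smul] at h6
  have h7 : Finsupp.linearCombination ℤ (0 : SCochain E M (k + 2) R)
      (D' (Finsupp.single σ 1)) = 0 := by
    simp
  rw [h7, sub_zero, sub_eq_zero] at h6
  exact h6.symm

theorem cochain_zero_eq_zero (hc : ∀ x, ∃ i, x ∈ U i) (c : SCochain E M 0 R)
    (hs : ∀ σ, σ.IsSmall U → c σ = 0) : c = 0 := by
  funext σ
  obtain ⟨i, hi⟩ := hc (σ.toFun (stdVertices 0 0))
  refine hs σ ⟨i, fun x ↦ ?_⟩
  have : x = stdVertices 0 0 := Subsingleton.elim _ _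
  rwa [this]

end SmallSimplices

/-! ### The Čech complex of singular cochains -/

section CechCochains

open TopologicalSpace

/-- In the pulled back charts `p` is the identity, so near `y` the map `g` is a chart inverse
composed with a chart of `p ∘ g`. The pointwise version is needed because the extension of a simplex
is smooth only near the simplex. -/
theorem contMDiffAt_lift_pullCharts {n : ℕ} {X M F : Type*} [TopologicalSpace X]
    [TopologicalSpace M] [ChartedSpace (EuclideanSpace ℝ (Fin n)) M] [NormedAddCommGroup F]
    [NormedSpace ℝ F] {p : X → M} [IsManifold (𝓡 n) ∞ M] (hp : IsLocalHomeomorph p) {g : F → X}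
    {y : F} (hg : ContinuousAt g y) (h : ContMDiffAt 𝓘(ℝ, F) (𝓡 n) ∞ (p ∘ g) y) :
    letI := pullCharts (n := n) hp
    ContMDiffAt 𝓘(ℝ, F) (𝓡 n) ∞ g y := by
  let _ := pullCharts (n := n) hp
  have _ := isManifold_pullCharts (n := n) hp
  set x := g y with hxy
  have h1 : ContMDiffAt (𝓡 n) (𝓡 n) ∞ (chartAt (EuclideanSpace ℝ (Fin n)) (p x)) (p x) :=
    (contMDiffOn_chart (x := p x)).contMDiffAt
      ((chartAt _ (p x)).open_source.mem_nhds (mem_chart_source _ (p x)))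
  have hx : chartAt (EuclideanSpace ℝ (Fin n)) x x =
      chartAt (EuclideanSpace ℝ (Fin n)) (p x) (p x) := by
    change chartAt _ (p x) ((hp.localInverseAt x).symm x) = _
    simp
  have h2 : ContMDiffAt (𝓡 n) (𝓡 n) ∞ (chartAt (EuclideanSpace ℝ (Fin n)) x).symm
      (chartAt (EuclideanSpace ℝ (Fin n)) (p x) (p x)) := by
    rw [← hx]
    exact (contMDiffOn_chart_symm (x := x)).contMDiffAt
      ((chartAt _ x).open_target.mem_nhds (mem_chart_target _ x))
  refine ((h2.comp (p x) h1).comp_of_eq h rfl).congr_of_eventuallyEq ?_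
  filter_upwards [hg.preimage_mem_nhds
    ((chartAt (EuclideanSpace ℝ (Fin n)) x).open_source.mem_nhds (mem_chart_source _ x))] with z hz
  have hz' := (chartAt (EuclideanSpace ℝ (Fin n)) x).left_inv hz
  change g z = (chartAt (EuclideanSpace ℝ (Fin n)) x).symm
    (chartAt (EuclideanSpace ℝ (Fin n)) (p x) (p (g z)))
  refine hz'.symm.trans (congrArg _ ?_)
  change chartAt _ (p x) ((hp.localInverseAt x).symm (g z)) = _
  simp

variable {M : Mfld.{u}} {J J' : Type u} (V : J → Opens M) {k : ℕ}

open Classical in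
/-- The lift of a simplex to a member of a family of open sets that contains it. -/
noncomputable def SmoothSimplex.lift (j : J) (σ : SmoothSimplex M.Model M k)
    (h : ∀ x, σ.toFun x ∈ V j) : SmoothSimplex (pieces V).Model (pieces V) k where
  toFun x := (⟨j, σ.toFun x, h x⟩ : Σ j, V j)
  exists_ext := by
    obtain ⟨W, f, hW, hs, hf, he⟩ := σ.exists_ext
    -- An arbitrary value where the extension of `σ` leaves `V j`; only the open set `W ∩ f ⁻¹' V j`
    -- matters.
    let x₀ : V j := ⟨σ.toFun (stdVertices k 0), h _⟩
    let g : (Fin (k + 1) → ℝ) → V j := fun x ↦ if hx : f x ∈ V j then ⟨f x, hx⟩ else x₀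
    have hg : ∀ x, f x ∈ V j → (g x).1 = f x := fun x hx ↦ by simp only [g, dif_pos hx]
    refine ⟨W ∩ f ⁻¹' V j, fun x ↦ (⟨j, g x⟩ : Σ j, V j),
      hf.continuousOn.isOpen_inter_preimage hW (V j).isOpen, fun x hx ↦ ⟨hs hx, ?_⟩, ?_, ?_⟩
    · have := h ⟨x, hx⟩
      rwa [← he] at this
    · intro y hy
      have hfy : ContMDiffAt 𝓘(ℝ, Fin (k + 1) → ℝ) (𝓡 M.dim) ∞ f y :=
        hf.contMDiffAt (hW.mem_nhds hy.1)
      have hev : (fun x ↦ (g x).1) =ᶠ[𝓝 y] f := by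
        filter_upwards [hfy.continuousAt.preimage_mem_nhds ((V j).isOpen.mem_nhds hy.2)] with x hx
          using hg x hx
      have hgc : ContinuousAt g y :=
        Topology.IsInducing.subtypeVal.continuousAt_iff.2 (hfy.continuousAt.congr hev.symm)
      have key : ContMDiffAt 𝓘(ℝ, Fin (k + 1) → ℝ) (𝓡 (pieces V).dim) ∞ (M' := pieces V)
          (fun x ↦ (⟨j, g x⟩ : Σ j, V j)) y :=
        contMDiffAt_lift_pullCharts (n := M.dim) (isLocalHomeomorph_piecesProj V)
          ((continuous_sigmaMk (i := j)).continuousAt.comp hgc) (hfy.congr_of_eventuallyEq hev)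
      exact key.contMDiffWithinAt
    · intro x
      have hx : f x.1 ∈ V j := by
        rw [he]
        exact h x
      refine Sigma.ext rfl (heq_of_eq (Subtype.ext ?_))
      exact (hg _ hx).trans (he x)

/-- The image in `M` of a simplex of a disjoint union of open subsets. -/
noncomputable def SmoothSimplex.toBase {V : J → Opens M}
    (τ : SmoothSimplex (pieces V).Model (pieces V) k) : SmoothSimplex M.Model M k :=
  τ.push (Mfld.Hom.toMap (piecesToBase V)) (Mfld.Hom.toMap (piecesToBase V)).contMDiff

/-- The index of the open subset that contains a simplex. -/
noncomputable def SmoothSimplex.index {V : J → Opens M}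
    (τ : SmoothSimplex (pieces V).Model (pieces V) k) : J :=
  (show Σ j, V j from τ.toFun (stdVertices k 0)).1

-- The standard simplex is connected, so it maps into a single member of the disjoint union.
variable {V} in
theorem SmoothSimplex.exists_eq_lift (τ : SmoothSimplex (pieces V).Model (pieces V) k) :
    ∃ j h, τ = τ.toBase.lift V j h := by
  have : ConnectedSpace (stdSimplex ℝ (Fin (k + 1))) := Subtype.connectedSpace
    ((convex_stdSimplex ℝ (Fin (k + 1))).isConnected ⟨_, (stdVertices k 0).2⟩)
  obtain ⟨j, g, hg, hτ⟩ := Continuous.exists_lift_sigma (f := fun x ↦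
    (show Σ j, V j from τ.toFun x)) τ.continuous_toFun
  have h : ∀ x, τ.toBase.toFun x = (g x).1 := fun x ↦
    congrArg (fun y : Σ j, V j ↦ y.2.1) (congrFun hτ x)
  refine ⟨j, fun x ↦ by rw [h]; exact (g x).2, SmoothSimplex.ext (funext fun x ↦ ?_)⟩
  refine (congrFun hτ x).trans (Sigma.ext rfl (heq_of_eq (Subtype.ext (h x).symm)))

/-! ### Cochains on a disjoint union of open subsets as families of functions of simplices of the
base. -/

variable {R : Type}

open Classical in
/-- The value of a cochain at the lift of a simplex. -/
noncomputable def cochainAt [Zero R] {V : J → Opens M} (c : Coch (pieces V) k R) (j : J)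
    (σ : SmoothSimplex M.Model M k) : R :=
  if h : ∀ x, σ.toFun x ∈ V j then c (σ.lift V j h) else 0

theorem cochainAt_eq [Zero R] {V : J → Opens M} (c : Coch (pieces V) k R) {j : J}
    {σ : SmoothSimplex M.Model M k} (h : ∀ x, σ.toFun x ∈ V j) :
    cochainAt c j σ = c (σ.lift V j h) := dif_pos h

/-- Every simplex of the union is the lift of a simplex of the base, so values at lifts determine a
cochain. The default value of `cochainAt` at simplices outside `V j` plays no role. -/
theorem cochain_ext [Zero R] {V : J → Opens M} {c c' : Coch (pieces V) k R}
    (h : ∀ j σ, (∀ x, σ.toFun x ∈ V j) → cochainAt c j σ = cochainAt c' j σ) : c = c' := by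
  funext τ
  obtain ⟨j, hj, hτ⟩ := τ.exists_eq_lift
  rw [hτ, ← cochainAt_eq c, h _ _ hj, cochainAt_eq]

/-- The cochain on a disjoint union of open subsets given by a function of the index and of the
image of a simplex in `M`. -/
noncomputable def cochainOf (V : J → Opens M) (g : J → SmoothSimplex M.Model M k → R) :
    Coch (pieces V) k R :=
  fun τ ↦ g τ.index τ.toBase

theorem cochainAt_cochainOf [Zero R] (g : J → SmoothSimplex M.Model M k → R) {j : J}
    {σ : SmoothSimplex M.Model M k} (h : ∀ x, σ.toFun x ∈ V j) :
    cochainAt (cochainOf V g) j σ = g j σ := dif_pos h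

/-- The pullback of cochains along a morphism of manifolds. -/
noncomputable abbrev cochainPull {N : Mfld.{u}} [AddCommGroup R] (f : N ⟶ M) :
    Coch M k R →+ Coch N k R :=
  SCochain.pull (Mfld.Hom.toMap f) (Mfld.Hom.toMap f).contMDiff

theorem cochainAt_piecesMap [AddCommGroup R] {V : J → Opens M} {V' : J' → Opens M} {r : J → J'}
    (hr : ∀ j, V j ≤ V' (r j)) (c : Coch (pieces V') k R) {j : J} {σ : SmoothSimplex M.Model M k}
    (h : ∀ x, σ.toFun x ∈ V j) :
    cochainAt (cochainPull (piecesMap V V' r hr) c) j σ = cochainAt c (r j) σ := by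
  rw [cochainAt_eq _ h, cochainAt_eq _ fun x ↦ hr j (h x)]
  rfl

theorem cochainAt_piecesToBase [AddCommGroup R] {V : J → Opens M} (c : Coch M k R) {j : J}
    {σ : SmoothSimplex M.Model M k} (h : ∀ x, σ.toFun x ∈ V j) :
    cochainAt (cochainPull (piecesToBase V) c) j σ = c σ := by
  rw [cochainAt_eq _ h]
  rfl

/-- The contraction of the Čech complex of a cover with a trivial member. -/
theorem eq_sum_cons {I A : Type*} [AddCommGroup A] {n : ℕ} (g : (Fin (n + 2) → I) → A) (i : I)
    (a : Fin (n + 2) → I)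
    (h : ∑ l : Fin (n + 3), (-1 : ℤ) ^ (l : ℕ) •
      g (fun m ↦ (Fin.cons i a : Fin (n + 3) → I) (l.succAbove m)) = 0) :
    ∑ l : Fin (n + 2), (-1 : ℤ) ^ (l : ℕ) • g (Fin.cons i fun m ↦ a (l.succAbove m)) = g a := by
  rw [Fin.sum_univ_succ] at h
  have h1 : (fun m ↦ (Fin.cons i a : Fin (n + 3) → I) ((0 : Fin (n + 3)).succAbove m)) = a := by
    funext m; simp
  have h2 : ∀ l : Fin (n + 2), (fun m ↦ (Fin.cons i a : Fin (n + 3) → I) (l.succ.succAbove m)) =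
      Fin.cons i fun m ↦ a (l.succAbove m) := by
    intro l
    funext m
    refine Fin.cases ?_ (fun m ↦ ?_) m <;> simp
  simp only [h1, h2, Fin.val_zero, pow_zero, one_smul, Fin.val_succ, pow_succ, mul_neg_one,
    neg_smul, Finset.sum_neg_distrib] at h
  rw [← sub_eq_add_neg, sub_eq_zero] at h
  exact h.symm

/-! ### Čech exactness and descent for singular cochains. -/

variable {I : Type u} (U : I → Opens M)

theorem mem_inters_cons {n : ℕ} {i : I} {a : Fin (n + 1) → I} {x : M} (hi : x ∈ U i)
    (ha : x ∈ inters U n a) : x ∈ inters U (n + 1) (Fin.cons i a) :=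
  Fin.cases hi ha

variable [AddCommGroup R]

theorem cochainAt_sum {V : J → Opens M} {ι : Type*} (s : Finset ι) (m : ι → ℤ)
    (c : ι → Coch (pieces V) k R) {j : J} {σ : SmoothSimplex M.Model M k}
    (h : ∀ x, σ.toFun x ∈ V j) :
    cochainAt (∑ i ∈ s, m i • c i) j σ = ∑ i ∈ s, m i • cochainAt (c i) j σ := by
  simp only [cochainAt_eq _ h, Finset.sum_apply, Pi.smul_apply]

theorem cochainAt_face (n : ℕ) (i : Fin (n + 2)) (c : Coch ((cech U).obj n) k R)
    {a : Fin (n + 2) → I} {σ : SmoothSimplex M.Model M k}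
    (h : ∀ x, σ.toFun x ∈ inters U (n + 1) a) :
    cochainAt (V := inters U (n + 1)) (cochainPull ((cech U).face n i) c) a σ =
      cochainAt (V := inters U n) c (fun m ↦ a (i.succAbove m)) σ :=
  cochainAt_piecesMap (V' := inters U n) _ c h

open Classical in
/-- The Čech complex of cochains is exact in positive degrees. -/
theorem cochain_cech_exact (n : ℕ) (c : Coch ((cech U).obj (n + 1)) k R)
    (hc : ∑ i : Fin (n + 3), (-1 : ℤ) ^ (i : ℕ) • cochainPull ((cech U).face (n + 1) i) c = 0) :
    ∃ e : Coch ((cech U).obj n) k R,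
      ∑ i : Fin (n + 2), (-1 : ℤ) ^ (i : ℕ) • cochainPull ((cech U).face n i) e = c := by
  -- The contraction inserts in front an index `i` with `σ` contained in `U i`. It is chosen from
  -- `σ` alone and is the same for all `a`, so that `eq_sum_cons` applies. Cochains need not be
  -- continuous in `σ`, so any choice will do.
  let g : (Fin (n + 1) → I) → SmoothSimplex M.Model M k → R := fun a σ ↦
    if hs : σ.IsSmall (fun i ↦ (U i : Set M)) then
      cochainAt (V := inters U (n + 1)) c (Fin.cons hs.choose a) σ else 0
  refine ⟨cochainOf (inters U n) g, cochain_ext (V := inters U (n + 1)) fun a σ h ↦ ?_⟩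
  have hs : σ.IsSmall (fun i ↦ (U i : Set M)) := ⟨a 0, fun x ↦ h x 0⟩
  have h2 : ∀ x, σ.toFun x ∈ inters U (n + 2) (Fin.cons hs.choose a) := fun x ↦
    mem_inters_cons U (hs.choose_spec x) (h x)
  rw [← eq_sum_cons (fun b ↦ cochainAt (V := inters U (n + 1)) c b σ) hs.choose a]
  · refine (cochainAt_sum _ _ _ h).trans (Finset.sum_congr rfl fun l _ ↦ congrArg _ ?_)
    refine (cochainAt_face U n l _ h).trans ?_
    refine (cochainAt_cochainOf (inters U n) g fun x m ↦ h x (l.succAbove m)).trans ?_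
    simp only [g, dif_pos hs]
  · have h3 := congrArg (fun e ↦ cochainAt (V := inters U (n + 2)) e (Fin.cons hs.choose a) σ) hc
    refine Eq.trans ?_ (h3.trans (cochainAt_eq _ h2))
    refine Eq.trans ?_ (cochainAt_sum _ _ _ h2).symm
    exact Finset.sum_congr rfl fun l _ ↦ congrArg _ (cochainAt_face U (n + 1) l c h2).symm

open Classical in
/-- Descent for cochains. -/
theorem cochain_cech_descend (c : Coch ((cech U).obj 0) k R)
    (hc : cochainPull ((cech U).face 0 0) c = cochainPull ((cech U).face 0 1) c) :
    ∃ e : Coch M k R, cochainPull (cechProj U) e = c := by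
  -- On simplices that are not small the value is unconstrained by the restrictions; it is set to
  -- zero.
  refine ⟨fun σ ↦ if hs : σ.IsSmall (fun i ↦ (U i : Set M)) then
      cochainAt (V := inters U 0) c (fun _ ↦ hs.choose) σ else 0,
    cochain_ext (V := inters U 0) fun a σ h ↦ ?_⟩
  have hs : σ.IsSmall (fun i ↦ (U i : Set M)) := ⟨a 0, fun x ↦ h x 0⟩
  have h2 : ∀ x, σ.toFun x ∈ inters U 1 (Fin.cons hs.choose a) := fun x ↦
    mem_inters_cons U (hs.choose_spec x) (h x)
  refine (cochainAt_piecesToBase _ h).trans ?_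
  simp only [dif_pos hs]
  -- On the double intersection with indices `(i, a)`, the face `∂₀` keeps `a` and `∂₁` keeps the
  -- chosen `i`: the value does not depend on the choice.
  have h3 := congrArg (fun e ↦ cochainAt (V := inters U 1) e (Fin.cons hs.choose a) σ) hc
  have h4 := (cochainAt_face U 0 0 c h2).symm.trans (h3.trans (cochainAt_face U 0 1 c h2))
  refine Eq.trans ?_ (h4.symm.trans ?_)
  · congr 1
    funext m
    obtain rfl : m = 0 := Fin.fin_one_eq_zero m
    rfl
  · congr 1

/-- The simplices of `M` that lift to `Γ₀` are exactly the small ones. This identifies the kernel of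
the augmentation with the complex treated by `exists_cochain_d_eq`. -/
theorem cochainPull_cechProj_eq_zero (c : Coch M k R) :
    cochainPull (cechProj U) c = 0 ↔
      ∀ σ : SmoothSimplex M.Model M k, σ.IsSmall (fun i ↦ (U i : Set M)) → c σ = 0 := by
  refine ⟨fun h σ ⟨i, hi⟩ ↦ ?_, fun h ↦ cochain_ext (V := inters U 0) fun a σ hσ ↦ ?_⟩
  · have h0 : ∀ x, σ.toFun x ∈ inters U 0 fun _ ↦ i := fun x _ ↦ hi x
    refine (cochainAt_piecesToBase c h0).symm.trans ?_
    refine (congrArg (fun e ↦ cochainAt (V := inters U 0) e (fun _ ↦ i) σ) h).trans ?_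
    exact cochainAt_eq _ h0
  · refine (cochainAt_piecesToBase c hσ).trans ?_
    exact (h σ ⟨a 0, fun x ↦ hσ x 0⟩).trans (cochainAt_eq 0 hσ).symm

end CechCochains

/-! ### Smoothness of forms at a point -/

section SmoothFormAt

variable {E : Type*} [NormedAddCommGroup E] [NormedSpace ℝ E]
  {M : Type*} [TopologicalSpace M] [ChartedSpace E M]
  {F : Type*} [NormedAddCommGroup F] [NormedSpace ℝ F] {k : ℕ}

/-- A form is smooth at `x` if its coefficients in the preferred chart at `x` are. -/
def SmoothFormAt (η : FormField E M k) (x : M) : Prop :=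
  ContDiffAt ℝ ∞ (plotForm (extChartAt 𝓘(ℝ, E) x).symm η) (extChartAt 𝓘(ℝ, E) x x)

theorem IsSmoothForm.smoothFormAt {η : FormField E M k} (hη : IsSmoothForm η) (x : M) :
    SmoothFormAt η x :=
  (hη x).contDiffAt ((isOpen_extChartAt_target _).mem_nhds (mem_extChartAt_target _))

theorem plotForm_congr {η η' : FormField E M k} {p : F → M} {y : F} (hp : ContinuousAt p y)
    (h : ∀ᶠ z in 𝓝 (p y), η z = η' z) : plotForm p η =ᶠ[𝓝 y] plotForm p η' := by
  filter_upwards [hp.eventually h] with z hz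
  exact congrArg (fun a : E [⋀^Fin k]→L[ℝ] ℝ ↦ a.compContinuousLinearMap
    (mfderiv 𝓘(ℝ, F) 𝓘(ℝ, E) p z : F →L[ℝ] E)) hz

theorem SmoothFormAt.congr {η η' : FormField E M k} {x : M} (hη : SmoothFormAt η x)
    (h : ∀ᶠ z in 𝓝 x, η' z = η z) : SmoothFormAt η' x := by
  refine ContDiffAt.congr_of_eventuallyEq hη (plotForm_congr (continuousAt_extChartAt_symm x) ?_)
  rwa [extChartAt_to_inv]

theorem smoothFormAt_zero (x : M) : SmoothFormAt (0 : FormField E M k) x := by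
  have : plotForm (extChartAt 𝓘(ℝ, E) x).symm (0 : FormField E M k) = 0 := rfl
  rw [SmoothFormAt, this]
  exact contDiffAt_const

theorem SmoothFormAt.add {η η' : FormField E M k} {x : M} (h : SmoothFormAt η x)
    (h' : SmoothFormAt η' x) : SmoothFormAt (η + η') x :=
  ContDiffAt.add h h'

theorem SmoothFormAt.sum {ι : Type*} {s : Finset ι} {η : ι → FormField E M k} {x : M}
    (h : ∀ i ∈ s, SmoothFormAt (η i) x) : SmoothFormAt (∑ i ∈ s, η i) x := by
  classical
  induction s using Finset.induction_on with
  | empty => exact smoothFormAt_zero x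
  | insert a s ha ih =>
    rw [Finset.sum_insert ha]
    exact (h _ (Finset.mem_insert_self _ _)).add
      (ih fun i hi ↦ h i (Finset.mem_insert_of_mem hi))

variable [IsManifold 𝓘(ℝ, E) ∞ M]

/-- Smoothness in the preferred chart at one point implies it in any plot through that point, by the
chain rule. Smoothness thus becomes a local condition that can be checked one point at a time, as
needed for gluing. -/
theorem SmoothFormAt.contDiffAt_plotForm {η : FormField E M k} {p : F → M} {y : F}
    (hη : SmoothFormAt η (p y)) (hp : ContMDiffAt 𝓘(ℝ, F) 𝓘(ℝ, E) ∞ p y) :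
    ContDiffAt ℝ ∞ (plotForm p η) y := by
  have hx : p y ∈ (extChartAt 𝓘(ℝ, E) (p y)).source := mem_extChartAt_source _
  refine ContDiffAt.congr_of_eventuallyEq ?_ (plotForm_eventuallyEq η hp hx)
  have hq := contDiffAt_chart_comp hp hx
  exact contDiffAt_compCLM (ContDiffAt.comp y hη hq) (hq.fderiv_right (by simp))

theorem isSmoothForm_of_smoothFormAt {η : FormField E M k} (h : ∀ x, SmoothFormAt η x) :
    IsSmoothForm η := fun _ _ hy ↦
  ((h _).contDiffAt_plotForm (contMDiffAt_extChartAt_symm' hy)).contDiffWithinAt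

theorem SmoothFormAt.smul {η : FormField E M k} {x : M} (h : SmoothFormAt η x) {φ : M → ℝ}
    (hφ : ContMDiffAt 𝓘(ℝ, E) 𝓘(ℝ, ℝ) ∞ φ x) : SmoothFormAt (fun y ↦ φ y • η y) x := by
  have h1 : ContMDiffAt 𝓘(ℝ, E) 𝓘(ℝ, ℝ) ∞ (φ ∘ (extChartAt 𝓘(ℝ, E) x).symm)
      (extChartAt 𝓘(ℝ, E) x x) :=
    hφ.comp_of_eq (contMDiffAt_extChartAt_symm' (mem_extChartAt_target x)) (extChartAt_to_inv x)
  exact ContDiffAt.smul h1.contDiffAt h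

end SmoothFormAt

/-! ### The Čech complex of differential forms -/

section PullCharts

variable {n : ℕ} {X M : Type*} [TopologicalSpace X] [TopologicalSpace M]
  [ChartedSpace (EuclideanSpace ℝ (Fin n)) M] {p : X → M}

theorem extChartAt_pullCharts (hp : IsLocalHomeomorph p) (x : X) :
    letI := pullCharts (n := n) hp
    extChartAt (𝓡 n) x x = extChartAt (𝓡 n) (p x) (p x) := by
  let _ := pullCharts (n := n) hp
  change chartAt _ (p x) ((hp.localInverseAt x).symm x) = chartAt _ (p x) (p x)
  simp

theorem proj_extChartAt_symm (hp : IsLocalHomeomorph p) (x : X) :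
    letI := pullCharts (n := n) hp
    ∀ z ∈ (extChartAt (𝓡 n) x).target, z ∈ (extChartAt (𝓡 n) (p x)).target ∧
      p ((extChartAt (𝓡 n) x).symm z) = (extChartAt (𝓡 n) (p x)).symm z := by
  let _ := pullCharts (n := n) hp
  intro z hz
  rw [extChartAt_target] at hz
  have hz' : z ∈ ((hp.localInverseAt x).symm ≫ₕ
    chartAt (EuclideanSpace ℝ (Fin n)) (p x)).target := hz.1
  rw [OpenPartialHomeomorph.trans_target] at hz'
  refine ⟨?_, ?_⟩
  · rw [extChartAt_target]
    exact ⟨hz'.1, hz.2⟩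
  · exact hp.apply_localInverseAt_of_mem hz'.2

/-- The preferred chart at `x` is `p` followed by the preferred chart at `p x`, so `p` is the
identity in these charts. Pullback of forms along `p` is then evaluation, with no change of frame.
-/
theorem mfderiv_pullCharts [IsManifold (𝓡 n) ∞ M] (hp : IsLocalHomeomorph p) (x : X) :
    letI := pullCharts (n := n) hp
    mfderiv (𝓡 n) (𝓡 n) p x = ContinuousLinearMap.id ℝ (EuclideanSpace ℝ (Fin n)) := by
  let _ := pullCharts (n := n) hp
  have h := ((contMDiff_pullCharts (n := n) hp) x).mdifferentiableAt (by simp)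
  rw [h.mfderiv]
  have h1 : writtenInExtChartAt (𝓡 n) (𝓡 n) x p =ᶠ[𝓝 (extChartAt (𝓡 n) x x)] id := by
    filter_upwards [(isOpen_extChartAt_target (I := 𝓡 n) x).mem_nhds (mem_extChartAt_target x)]
      with z hz
    obtain ⟨h2, h3⟩ := proj_extChartAt_symm hp x z hz
    simp only [writtenInExtChartAt, Function.comp_apply, h3]
    exact (extChartAt (𝓡 n) (p x)).right_inv h2
  rw [(h1.filter_mono nhdsWithin_le_nhds).fderivWithin_eq h1.self_of_nhds]
  simp only [modelWithCornersSelf_coe, range_id, fderivWithin_univ]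
  exact fderiv_id

end PullCharts

/-! ### Forms on a disjoint union of open subsets as families of forms on the base. -/

section CechForms

open TopologicalSpace

variable {M : Mfld.{u}} {J J' : Type u} {k : ℕ}

/-- The value of a form at a point, as an alternating form on the model space. -/
noncomputable def formEval {N : Mfld.{u}} (y : N) : Om N k →+ N.Model [⋀^Fin k]→L[ℝ] ℝ where
  toFun η := η.1 y
  map_zero' := rfl
  map_add' _ _ := rfl

/-- The point `x` of the `j`-th member of a disjoint union of open subsets. -/
def piecesMk (V : J → Opens M) (j : J) (x : M) (h : x ∈ V j) : pieces V :=
  (⟨j, x, h⟩ : Σ j, V j)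

open Classical in
/-- The value at `x` of a form on a disjoint union of open subsets, on the `j`-th of them. -/
noncomputable def formAt (V : J → Opens M) (j : J) (x : M) :
    Om (pieces V) k →+ M.Model [⋀^Fin k]→L[ℝ] ℝ :=
  if h : x ∈ V j then formEval (piecesMk V j x h) else 0

theorem formAt_eq {V : J → Opens M} {j : J} {x : M} (h : x ∈ V j) (η : Om (pieces V) k) :
    formAt V j x η = formEval (piecesMk V j x h) η :=
  congrArg (fun f : Om (pieces V) k →+ M.Model [⋀^Fin k]→L[ℝ] ℝ ↦ f η) (dif_pos h)

theorem form_ext {V : J → Opens M} {η η' : Om (pieces V) k}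
    (h : ∀ j x, x ∈ V j → formAt V j x η = formAt V j x η') : η = η' := by
  refine Subtype.ext (funext fun y ↦ ?_)
  obtain ⟨j, x, hx⟩ := (show Σ j, V j from y)
  exact (formAt_eq hx η).symm.trans ((h j x hx).trans (formAt_eq hx η'))

theorem mfderiv_piecesToBase (V : J → Opens M) (y : pieces V) :
    mfderiv (𝓡 (pieces V).dim) (𝓡 M.dim) (Mfld.Hom.toMap (piecesToBase V)) y =
      ContinuousLinearMap.id ℝ M.Model :=
  mfderiv_pullCharts (n := M.dim) (isLocalHomeomorph_piecesProj V) y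

/-- The map commutes with the projections to `M`, whose derivatives are the identity. -/
theorem mfderiv_piecesMap (V : J → Opens M) (V' : J' → Opens M) (r : J → J')
    (hr : ∀ j, V j ≤ V' (r j)) (y : pieces V) :
    mfderiv (𝓡 (pieces V).dim) (𝓡 (pieces V').dim) (Mfld.Hom.toMap (piecesMap V V' r hr)) y =
      ContinuousLinearMap.id ℝ M.Model := by
  have h := mfderiv_comp y
    ((Mfld.Hom.toMap (piecesToBase V')).contMDiff.mdifferentiableAt (by simp))
    ((Mfld.Hom.toMap (piecesMap V V' r hr)).contMDiff.mdifferentiableAt (x := y) (by simp))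
  rw [mfderiv_piecesToBase] at h
  exact h.symm.trans (mfderiv_piecesToBase V y)

/-- The pullback of forms along a morphism of manifolds. -/
noncomputable abbrev formPull {N : Mfld.{u}} (f : N ⟶ M) : Om M k →+ Om N k :=
  Form.pull (Mfld.Hom.toMap f) (Mfld.Hom.toMap f).contMDiff

theorem compContinuousLinearMap_eq_self {N : Mfld.{u}} {a : N.Model [⋀^Fin k]→L[ℝ] ℝ}
    {A : N.Model →L[ℝ] N.Model} (hA : A = ContinuousLinearMap.id ℝ N.Model) :
    a.compContinuousLinearMap A = a := by
  rw [hA]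
  rfl

theorem formAt_piecesToBase {V : J → Opens M} {j : J} {x : M} (h : x ∈ V j) (η : Om M k) :
    formAt V j x (formPull (piecesToBase V) η) = formEval x η :=
  (formAt_eq h _).trans
    (compContinuousLinearMap_eq_self (N := M) (mfderiv_piecesToBase V (piecesMk V j x h)))

theorem formAt_piecesMap {V : J → Opens M} {V' : J' → Opens M} {r : J → J'}
    (hr : ∀ j, V j ≤ V' (r j)) (η : Om (pieces V') k) {j : J} {x : M} (h : x ∈ V j) :
    formAt V j x (formPull (piecesMap V V' r hr) η) = formAt V' (r j) x η :=
  (formAt_eq h _).trans ((compContinuousLinearMap_eq_self (N := M)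
    (mfderiv_piecesMap V V' r hr (piecesMk V j x h))).trans (formAt_eq (hr j h) η).symm)

/-- A field of forms on a disjoint union of open subsets is smooth at `(j, x)` if and only if the
corresponding field on the `j`-th subset is smooth at `x`. -/
theorem smoothFormAt_pieces_iff {V : J → Opens M} {j : J} {x : M} (h : x ∈ V j)
    (η : FormField (pieces V).Model (pieces V) k) (ζ : FormField M.Model M k)
    (hζ : ∀ y (hy : y ∈ V j), (η (piecesMk V j y hy) : M.Model [⋀^Fin k]→L[ℝ] ℝ) = ζ y) :
    SmoothFormAt (M := pieces V) η (piecesMk V j x h) ↔ SmoothFormAt ζ x := by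
  set y : pieces V := piecesMk V j x h with hy
  have hp := isLocalHomeomorph_piecesProj V
  have hz : extChartAt (𝓡 (pieces V).dim) y y = extChartAt (𝓡 M.dim) x x :=
    extChartAt_pullCharts (n := M.dim) hp y
  have hq : ∀ z ∈ (extChartAt (𝓡 (pieces V).dim) y).target, z ∈ (extChartAt (𝓡 M.dim) x).target ∧
      Mfld.Hom.toMap (piecesToBase V) ((extChartAt (𝓡 (pieces V).dim) y).symm z) =
        (extChartAt (𝓡 M.dim) x).symm z := proj_extChartAt_symm (n := M.dim) hp y
  have hT : (extChartAt (𝓡 (pieces V).dim) y).target ∈ 𝓝 (extChartAt (𝓡 (pieces V).dim) y y) :=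
    (isOpen_extChartAt_target (I := 𝓡 (pieces V).dim) y).mem_nhds (mem_extChartAt_target y)
  -- The hypothesis relates `η` to `ζ` on the `j`-th piece only; since this piece is open, the
  -- inverse chart stays in it near the base point.
  have hO : IsOpen {w : pieces V | (show Σ j, V j from w).1 = j} := by
    have : {w : Σ j, V j | w.1 = j} = range (Sigma.mk j) := by
      ext ⟨i, w⟩
      constructor
      · rintro rfl
        exact ⟨w, rfl⟩
      · rintro ⟨w', hw'⟩
        exact (congrArg Sigma.fst hw').symm
    change IsOpen {w : Σ j, V j | w.1 = j}
    rw [this]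
    exact Topology.IsOpenEmbedding.sigmaMk.isOpen_range
  have hI : ∀ᶠ z in 𝓝 (extChartAt (𝓡 (pieces V).dim) y y),
      (show Σ j, V j from (extChartAt (𝓡 (pieces V).dim) y).symm z).1 = j := by
    refine (continuousAt_extChartAt_symm (I := 𝓡 (pieces V).dim) y).preimage_mem_nhds
      (hO.mem_nhds ?_)
    rw [extChartAt_to_inv]
    rfl
  have hval : ∀ w : pieces V, (show Σ j, V j from w).1 = j →
      (η w : M.Model [⋀^Fin k]→L[ℝ] ℝ) = ζ (Mfld.Hom.toMap (piecesToBase V) w) := by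
    rintro ⟨i, w, hw⟩ hi
    obtain rfl : i = j := hi
    exact hζ w hw
  have hev : (plotForm (extChartAt (𝓡 (pieces V).dim) y).symm η :
      M.Model → M.Model [⋀^Fin k]→L[ℝ] ℝ) =ᶠ[𝓝 (extChartAt (𝓡 (pieces V).dim) y y)]
        plotForm (extChartAt (𝓡 M.dim) x).symm ζ := by
    -- The inverse chart of the union, followed by the projection, is the inverse chart of `M`; as
    -- the projection has derivative the identity, both forms have the same coefficients near the
    -- point.
    filter_upwards [hT, eventually_mem_nhds_iff.2 hT, hI] with z hz1 hz2 hz3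
    have hd := mfderiv_comp z
      ((Mfld.Hom.toMap (piecesToBase V)).contMDiff.mdifferentiableAt (by simp))
      ((contMDiffAt_extChartAt_symm' (E := (pieces V).Model) hz1).mdifferentiableAt (by simp))
    rw [mfderiv_piecesToBase] at hd
    have hev2 : Mfld.Hom.toMap (piecesToBase V) ∘ (extChartAt (𝓡 (pieces V).dim) y).symm =ᶠ[𝓝 z]
        (extChartAt (𝓡 M.dim) x).symm := by
      filter_upwards [hz2] with w hw using (hq w hw).2
    have hd2 : (mfderiv (𝓡 (pieces V).dim) (𝓡 (pieces V).dim)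
        (extChartAt (𝓡 (pieces V).dim) y).symm z : M.Model →L[ℝ] M.Model) =
          mfderiv (𝓡 M.dim) (𝓡 M.dim) (extChartAt (𝓡 M.dim) x).symm z :=
      hd.symm.trans hev2.mfderiv_eq
    have hv : (η ((extChartAt (𝓡 (pieces V).dim) y).symm z) : M.Model [⋀^Fin k]→L[ℝ] ℝ) =
        ζ ((extChartAt (𝓡 M.dim) x).symm z) :=
      (hval _ hz3).trans
        (congrArg (show M → M.Model [⋀^Fin k]→L[ℝ] ℝ from ζ) (hq z hz1).2)
    exact congrArg₂ (fun (a : M.Model [⋀^Fin k]→L[ℝ] ℝ) (A : M.Model →L[ℝ] M.Model) ↦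
      a.compContinuousLinearMap A) hv hd2
  have key : ∀ (f g : M.Model → M.Model [⋀^Fin k]→L[ℝ] ℝ) (a b : M.Model), a = b → f =ᶠ[𝓝 a] g →
      (ContDiffAt ℝ ∞ f a ↔ ContDiffAt ℝ ∞ g b) := by
    rintro f g a _ rfl hfg
    exact ⟨fun hf ↦ hf.congr_of_eventuallyEq hfg.symm, fun hg ↦ hg.congr_of_eventuallyEq hfg⟩
  exact key _ _ _ _ hz hev

/-- The form on a disjoint union of open subsets given by a family of fields that are smooth on
these subsets. -/
noncomputable def formOf (V : J → Opens M) (g : J → FormField M.Model M k)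
    (hg : ∀ j, ∀ x ∈ V j, SmoothFormAt (g j) x) : Om (pieces V) k :=
  ⟨fun y ↦ g (show Σ j, V j from y).1 (show Σ j, V j from y).2.1,
    isSmoothForm_of_smoothFormAt (M := pieces V) fun ⟨j, x, hx⟩ ↦
      (smoothFormAt_pieces_iff hx _ (g j) fun _ _ ↦ rfl).2 (hg j x hx)⟩

theorem formAt_formOf {V : J → Opens M} {g : J → FormField M.Model M k}
    (hg : ∀ j, ∀ x ∈ V j, SmoothFormAt (g j) x) {j : J} {x : M} (h : x ∈ V j) :
    formAt V j x (formOf V g hg) = g j x :=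
  formAt_eq h _

theorem smoothFormAt_formAt {V : J → Opens M} (η : Om (pieces V) k) {j : J} {x : M}
    (h : x ∈ V j) : SmoothFormAt (E := M.Model) (fun x ↦ formAt V j x η) x :=
  (smoothFormAt_pieces_iff h η.1 _ fun _ hy ↦ (formAt_eq hy η).symm).1
    (η.2.smoothFormAt (piecesMk V j x h))

/-! ### Čech exactness and descent for forms. -/

variable {I : Type u} (U : I → Opens M)

theorem formAt_face (n : ℕ) (i : Fin (n + 2)) (η : Om ((cech U).obj n) k)
    {a : Fin (n + 2) → I} {x : M} (h : x ∈ inters U (n + 1) a) :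
    formAt (inters U (n + 1)) a x (formPull ((cech U).face n i) η) =
      formAt (inters U n) (fun m ↦ a (i.succAbove m)) x η :=
  formAt_piecesMap (V' := inters U n) _ η h

/-- The Čech complex of forms is exact in positive degrees. -/
theorem form_cech_exact [SecondCountableTopology M] (hU : ∀ x, ∃ i, x ∈ U i) (n : ℕ)
    (η : Om ((cech U).obj (n + 1)) k)
    (hη : ∑ i : Fin (n + 3), (-1 : ℤ) ^ (i : ℕ) • formPull ((cech U).face (n + 1) i) η = 0) :
    ∃ e : Om ((cech U).obj n) k,
      ∑ i : Fin (n + 2), (-1 : ℤ) ^ (i : ℕ) • formPull ((cech U).face n i) e = η := by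
  -- Together with second countability this gives the `σ`-compactness behind smooth partitions of
  -- unity.
  have : LocallyCompactSpace M := ChartedSpace.locallyCompactSpace M.Model M
  obtain ⟨φ, hφ⟩ := SmoothPartitionOfUnity.exists_isSubordinate (𝓡 M.dim) isClosed_univ
    (fun i ↦ (U i : Set M)) (fun i ↦ (U i).isOpen) fun x _ ↦ mem_iUnion.2 (hU x)
  let f : (Fin (n + 2) → I) → M → M.Model [⋀^Fin k]→L[ℝ] ℝ := fun b x ↦
    formAt (inters U (n + 1)) b x η
  -- The smooth analogue of choosing an index: average the contractions `η_{i,a}` with the weights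
  -- `φ i`.
  let g : (Fin (n + 1) → I) → M → M.Model [⋀^Fin k]→L[ℝ] ℝ := fun a x ↦
    ∑ᶠ i, φ i x • f (Fin.cons i a) x
  have hsum : ∀ {s : Finset I} {x : M}, Function.support (fun i ↦ φ i x) ⊆ s → ∀ a,
      g a x = ∑ i ∈ s, φ i x • f (Fin.cons i a) x := by
    intro s x hs a
    refine finsum_eq_sum_of_support_subset _ fun i hi ↦ hs fun h : φ i x = 0 ↦ hi ?_
    change φ i x • f (Fin.cons i a) x = 0
    rw [h, zero_smul]
  have hg : ∀ a, ∀ x ∈ inters U n a, SmoothFormAt (E := M.Model) (g a) x := by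
    intro a x hx
    obtain ⟨s, hs⟩ := φ.toPartitionOfUnity.exists_finset_nhds x
    refine SmoothFormAt.congr (η := ∑ i ∈ s, fun y ↦ φ i y • f (Fin.cons i a) y)
      (SmoothFormAt.sum fun i _ ↦ ?_) ?_
    -- On the support of `φ i` the point lies in `U i`, where `η_{i,a}` is a smooth form. Off it the
    -- product is zero near `x`, so the default value of `formAt` outside the open set is harmless.
    · by_cases hi : x ∈ tsupport (φ i)
      · exact (smoothFormAt_formAt η (mem_inters_cons U (hφ i hi) hx)).smul
          ((φ i).contMDiff x)
      · refine (smoothFormAt_zero x).congr ?_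
        filter_upwards [notMem_tsupport_iff_eventuallyEq.1 hi] with y hy
        change φ i y • f (Fin.cons i a) y = 0
        rw [hy]
        exact zero_smul _ _
    · filter_upwards [hs] with y hy
      refine (hsum hy.2 a).trans ?_
      exact (Finset.sum_apply y s fun i (y : M) ↦ φ i y • f (Fin.cons i a) y).symm
  refine ⟨formOf (inters U n) g hg, form_ext (V := inters U (n + 1)) fun a x hx ↦ ?_⟩
  obtain ⟨s, hs⟩ := φ.toPartitionOfUnity.exists_finset_nhds x
  have hs1 : ∑ i ∈ s, φ i x = 1 := hs.self_of_nhds.1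
  have hface : ∀ l : Fin (n + 2), formAt (inters U (n + 1)) a x
      (formPull ((cech U).face n l) (formOf (inters U n) g hg)) =
        ∑ i ∈ s, φ i x • f (Fin.cons i fun m ↦ a (l.succAbove m)) x := fun l ↦
    (formAt_face U n l _ hx).trans ((formAt_formOf hg fun m ↦ hx (l.succAbove m)).trans
      (hsum hs.self_of_nhds.2 _))
  have hcons : ∀ i, φ i x • ∑ l : Fin (n + 2), (-1 : ℤ) ^ (l : ℕ) •
      f (Fin.cons i fun m ↦ a (l.succAbove m)) x = φ i x • f a x := by
    intro i
    -- The cocycle condition at `(i, a)` is available only for `x` in `U i`; where `φ i` vanishes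
    -- nothing has to be shown.
    by_cases hi : φ i x = 0
    · rw [hi, zero_smul, zero_smul]
    congr 1
    have hxi : x ∈ U i := hφ i (subset_tsupport _ hi)
    have h2 := mem_inters_cons U hxi hx
    refine eq_sum_cons (fun b ↦ f b x) i a ?_
    have h3 := congrArg (formAt (inters U (n + 2)) (Fin.cons i a) x) hη
    refine Eq.trans ?_ (h3.trans (map_zero (formAt (k := k) (inters U (n + 2)) (Fin.cons i a) x)))
    refine Eq.trans ?_ (map_sum (formAt (k := k) (inters U (n + 2)) (Fin.cons i a) x) _ _).symm
    refine Finset.sum_congr rfl fun l _ ↦ ?_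
    refine Eq.trans ?_ (map_zsmul (formAt (k := k) (inters U (n + 2)) (Fin.cons i a) x) _ _).symm
    exact congrArg _ (formAt_face U (n + 1) l η h2).symm
  refine (map_sum (formAt (k := k) (inters U (n + 1)) a x) _ _).trans ?_
  refine (Finset.sum_congr rfl fun l _ ↦
    (map_zsmul (formAt (k := k) (inters U (n + 1)) a x) _ _).trans (congrArg _ (hface l))).trans ?_
  simp only [Finset.smul_sum]
  rw [Finset.sum_comm]
  refine Eq.trans (Finset.sum_congr rfl fun i _ ↦ ?_) ((Finset.sum_smul (f := fun i ↦ φ i x)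
    (s := s) (x := f a x)).symm.trans (by rw [hs1, one_smul]))
  rw [← hcons i, Finset.smul_sum]
  exact Finset.sum_congr rfl fun l _ ↦ (smul_comm _ _ _)

open Classical in
/-- Descent for forms. -/
theorem form_cech_descend (hU : ∀ x, ∃ i, x ∈ U i) (η : Om ((cech U).obj 0) k)
    (hη : formPull ((cech U).face 0 0) η = formPull ((cech U).face 0 1) η) :
    ∃ e : Om M k, formPull (cechProj U) e = η := by
  choose i hi using hU
  let f : (Fin 1 → I) → M → M.Model [⋀^Fin k]→L[ℝ] ℝ := fun b x ↦ formAt (inters U 0) b x η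
  have hf : ∀ a x, x ∈ inters U 0 a → f (fun _ ↦ i x) x = f a x := by
    intro a x hx
    have h2 : x ∈ inters U 1 (Fin.cons (i x) a) := mem_inters_cons U (hi x) hx
    have h3 := (formAt_face U 0 0 η h2).symm.trans
      ((congrArg (formAt (inters U 1) (Fin.cons (i x) a) x) hη).trans (formAt_face U 0 1 η h2))
    refine Eq.trans ?_ (h3.symm.trans ?_)
    · change formAt (inters U 0) _ x η = _
      congr 2
      funext m
      obtain rfl : m = 0 := Fin.fin_one_eq_zero m
      rfl
    · rfl
  have hs : IsSmoothForm (E := M.Model) (M := M) (fun x ↦ f (fun _ ↦ i x) x) := by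
    refine isSmoothForm_of_smoothFormAt fun x ↦ ?_
    have hx : x ∈ inters U 0 fun _ ↦ i x := fun _ ↦ hi x
    refine (smoothFormAt_formAt η hx).congr ?_
    -- The chosen index may jump from point to point, but near `x` the cocycle condition allows the
    -- fixed index `i x` for all nearby points.
    filter_upwards [(inters U 0 fun _ ↦ i x).isOpen.mem_nhds hx] with y hy using hf _ y hy
  refine ⟨⟨_, hs⟩, form_ext (V := inters U 0) fun a x hx ↦ ?_⟩
  exact (formAt_piecesToBase hx _).trans (hf a x hx)

/-- Forms, unlike singular cochains, are determined pointwise and hence by their restrictions to the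
cover. The kernel of the augmentation therefore has no form component. -/
theorem formPull_cechProj_injective (hU : ∀ x, ∃ i, x ∈ U i) {η : Om M k}
    (h : formPull (cechProj U) η = 0) : η = 0 := by
  refine Subtype.ext (funext fun x ↦ ?_)
  obtain ⟨i, hi⟩ := hU x
  have hx : x ∈ inters U 0 fun _ ↦ i := fun _ ↦ hi
  have h2 := congrArg (formAt (inters U 0) (fun _ ↦ i) x) h
  exact (formAt_piecesToBase hx η).symm.trans
    (h2.trans (map_zero (formAt (k := k) (inters U 0) (fun _ ↦ i) x)))

end CechForms

/-! ### The Čech complex of differential cochains -/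

section DiffCech

open TopologicalSpace Opposite

variable {M N : Mfld.{u}} {s k : ℕ}

theorem diffCochain_ext {x y : DiffCochain M s k} (h1 : x.1.1 = y.1.1) (h2 : x.1.2.1 = y.1.2.1)
    (h3 : x.1.2.2 = y.1.2.2) : x = y :=
  Subtype.ext (Prod.ext h1 (Prod.ext h2 h3))

variable (M s k) in
/-- The integral component of a differential cochain. -/
noncomputable def intPart : DiffCochain M s k →+ Coch M k ℤ :=
  (AddMonoidHom.fst _ _).comp (DiffCochain M s k).subtype

variable (M s k) in
/-- The real component of a differential cochain. -/
noncomputable def realPart : DiffCochain M s k →+ PrevCoch M k :=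
  (AddMonoidHom.fst _ _).comp ((AddMonoidHom.snd _ _).comp (DiffCochain M s k).subtype)

variable (M s k) in
/-- The form component of a differential cochain. -/
noncomputable def formPart : DiffCochain M s k →+ Om M k :=
  (AddMonoidHom.snd _ _).comp ((AddMonoidHom.snd _ _).comp (DiffCochain M s k).subtype)

variable {I : Type u} (U : I → Opens M)

theorem prevCoch_cech_exact (n : ℕ) : ∀ k (c : PrevCoch ((cech U).obj (n + 1)) k),
    ∑ i : Fin (n + 3), (-1 : ℤ) ^ (i : ℕ) • PrevCoch.pull ((cech U).face (n + 1) i) k c = 0 →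
      ∃ e : PrevCoch ((cech U).obj n) k,
        ∑ i : Fin (n + 2), (-1 : ℤ) ^ (i : ℕ) • PrevCoch.pull ((cech U).face n i) k e = c
  | 0, _, _ => ⟨0, rfl⟩
  | _ + 1, c, hc => cochain_cech_exact U n c hc

theorem prevCoch_cech_descend : ∀ k (c : PrevCoch ((cech U).obj 0) k),
    PrevCoch.pull ((cech U).face 0 0) k c = PrevCoch.pull ((cech U).face 0 1) k c →
      ∃ e : PrevCoch M k, PrevCoch.pull (cechProj U) k e = c
  | 0, _, _ => ⟨0, rfl⟩
  | _ + 1, c, hc => cochain_cech_descend U c hc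

theorem diffCochain_cech_exact [SecondCountableTopology M] (hU : ∀ x, ∃ i, x ∈ U i) (n : ℕ)
    (z : DiffCochain ((cech U).obj (n + 1)) s k)
    (hz : ∑ i : Fin (n + 3), (-1 : ℤ) ^ (i : ℕ) •
      DiffCochain.pull s k ((cech U).face (n + 1) i) z = 0) :
    ∃ e : DiffCochain ((cech U).obj n) s k,
      ∑ i : Fin (n + 2), (-1 : ℤ) ^ (i : ℕ) • DiffCochain.pull s k ((cech U).face n i) e = z := by
  have h1 := congrArg (intPart _ s k) hz
  have h2 := congrArg (realPart _ s k) hz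
  have h3 := congrArg (formPart _ s k) hz
  rw [map_sum, map_zero] at h1 h2 h3
  simp only [map_zsmul] at h1 h2 h3
  obtain ⟨e1, he1⟩ := cochain_cech_exact U n z.1.1 h1
  obtain ⟨e2, he2⟩ := prevCoch_cech_exact U n k z.1.2.1 h2
  obtain ⟨e3, he3, he3'⟩ : ∃ e3 : Om ((cech U).obj n) k, (k < s → e3 = 0) ∧
      ∑ i : Fin (n + 2), (-1 : ℤ) ^ (i : ℕ) • formPull ((cech U).face n i) e3 = z.1.2.2 := by
    -- Below the height the form component of a primitive has to be zero, and zero works since that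
    -- of `z` is zero too.
    by_cases hk : k < s
    · refine ⟨0, fun _ ↦ rfl, ?_⟩
      rw [z.2 hk]
      exact Finset.sum_eq_zero fun i _ ↦ by rw [map_zero, smul_zero]
    · obtain ⟨e3, he3⟩ := form_cech_exact U hU n z.1.2.2 h3
      exact ⟨e3, fun h ↦ absurd h hk, he3⟩
  refine ⟨⟨(e1, e2, e3), he3⟩, diffCochain_ext ?_ ?_ ?_⟩
  · change intPart _ s k _ = _
    rw [map_sum, ← he1]
    simp only [map_zsmul]
    rfl
  · change realPart _ s k _ = _
    rw [map_sum, ← he2]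
    simp only [map_zsmul]
    rfl
  · change formPart _ s k _ = _
    rw [map_sum, ← he3']
    simp only [map_zsmul]
    rfl

theorem diffCochain_cech_descend (hU : ∀ x, ∃ i, x ∈ U i) (z : DiffCochain ((cech U).obj 0) s k)
    (hz : DiffCochain.pull s k ((cech U).face 0 0) z =
      DiffCochain.pull s k ((cech U).face 0 1) z) :
    ∃ e : DiffCochain M s k, DiffCochain.pull s k (cechProj U) e = z := by
  obtain ⟨e1, he1⟩ := cochain_cech_descend U z.1.1 (congrArg (intPart _ s k) hz)
  obtain ⟨e2, he2⟩ := prevCoch_cech_descend U k z.1.2.1 (congrArg (realPart _ s k) hz)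
  obtain ⟨e3, he3⟩ := form_cech_descend U hU z.1.2.2 (congrArg (formPart _ s k) hz)
  refine ⟨⟨(e1, e2, e3), fun hk ↦ ?_⟩, diffCochain_ext he1 he2 he3⟩
  -- The height condition holds on `M` because it holds on the cover and forms restrict injectively.
  exact formPull_cechProj_injective U hU (he3.trans (z.2 hk))

/-- In the kernel `z = (c, h, 0)` with `dc = 0`, `dh = -c`, both vanishing on small simplices: a
closed element of a mapping cone. Acyclicity of integral and of real cochains vanishing on small
simplices is applied in turn, to `c = dc'` and to the closed cochain `c' + h`. -/
theorem diffCochain_ker_acyclic (hU : ∀ x, ∃ i, x ∈ U i) (z : DiffCochain M s (k + 1))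
    (hd : DiffCochain.d M s (k + 1) z = 0) (hz : DiffCochain.pull s (k + 1) (cechProj U) z = 0) :
    ∃ w : DiffCochain M s k, DiffCochain.pull s k (cechProj U) w = 0 ∧
      DiffCochain.d M s k w = z := by
  have hopen : ∀ i, IsOpen ((fun i ↦ (U i : Set M)) i) := fun i ↦ (U i).isOpen
  set c : Coch M (k + 1) ℤ := z.1.1 with hc
  set h : Coch M k ℝ := z.1.2.1 with hh
  have hω : z.1.2.2 = 0 :=
    formPull_cechProj_injective U hU (congrArg (formPart _ s (k + 1)) hz)
  have hcs := (cochainPull_cechProj_eq_zero U c).1 (congrArg (intPart _ s (k + 1)) hz)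
  have hhs := (cochainPull_cechProj_eq_zero U h).1 (congrArg (realPart _ s (k + 1)) hz)
  have hdc : SCochain.d c = 0 := congrArg (intPart _ s (k + 2)) hd
  have hdh : Om.integrate M (k + 1) z.1.2.2 - Coch.real M (k + 1) c - SCochain.d h = 0 :=
    congrArg (realPart _ s (k + 2)) hd
  rw [hω, map_zero, zero_sub] at hdh
  obtain ⟨c', hcs', hc'⟩ := exists_cochain_d_eq hopen hU c hcs hdc
  set g : Coch M k ℝ := Coch.real M k c' + h with hg
  have hgs : ∀ σ : SmoothSimplex M.Model M k, σ.IsSmall (fun i ↦ (U i : Set M)) → g σ = 0 := by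
    intro σ hσ
    change ((c' σ : ℤ) : ℝ) + h σ = 0
    rw [hcs' σ hσ, hhs σ hσ, Int.cast_zero, add_zero]
  have hdg : SCochain.d g = 0 := by
    rw [hg, map_add, ← Coch.real_d, hc', ← neg_eq_zero, ← hdh]
    abel
  -- For `k = 0` there are no cochains of degree `-1`, but then `g` itself is zero, because every
  -- 0-simplex is small.
  obtain ⟨e, he, he'⟩ : ∃ e : PrevCoch M k, PrevCoch.pull (cechProj U) k e = 0 ∧
      PrevCoch.d M k e = g := by
    cases k with
    | zero => exact ⟨0, rfl, (cochain_zero_eq_zero hU g hgs).symm⟩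
    | succ k =>
      obtain ⟨e, he, he'⟩ := exists_cochain_d_eq hopen hU g hgs hdg
      exact ⟨e, (cochainPull_cechProj_eq_zero U (k := k) e).2 he, he'⟩
  -- The sign of `e` is that of `d(c', -e, 0) = (dc', -c' + de, 0)`, and `de = c' + h`.
  refine ⟨⟨(c', -e, 0), fun _ ↦ rfl⟩, diffCochain_ext ?_ ?_ ?_, diffCochain_ext hc' ?_ ?_⟩
  · exact (cochainPull_cechProj_eq_zero U c').2 hcs'
  · change PrevCoch.pull (cechProj U) k (-e) = 0
    rw [map_neg, he, neg_zero]
  · exact map_zero (formPull (cechProj U))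
  · change Om.integrate M k 0 - Coch.real M k c' - PrevCoch.d M k (-e) = h
    rw [map_zero, map_neg, he', hg]
    abel
  · exact (map_zero Form.d).trans hω.symm

/-- For `s > 0` a 0-cochain has no form component, so the real component of its differential is
`-c`, and integers embed in the reals. With forms allowed in degree 0, the locally constant integral
functions would be a kernel. -/
theorem diffCochain_d_injective (hs : 0 < s) : Function.Injective (DiffCochain.d N s 0) := by
  rw [injective_iff_map_eq_zero]
  intro x hx
  have h : Om.integrate N 0 x.1.2.2 - Coch.real N 0 x.1.1 - 0 = 0 :=
    congrArg (realPart _ s 1) hx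
  rw [x.2 hs, map_zero, zero_sub, sub_zero, neg_eq_zero] at h
  refine diffCochain_ext (funext fun σ ↦ ?_) rfl (x.2 hs)
  exact Int.cast_eq_zero.1 (congrFun h σ)

theorem cechAcyclic_diffPresheaf [SecondCountableTopology M] (hs : 0 < s)
    (hU : ∀ x, ∃ i, x ∈ U i) : CechAcyclic (diffPresheaf s) (cechProj U) where
  exact k n z hz := by
    rw [cechD_apply] at hz
    obtain ⟨e, he⟩ := diffCochain_cech_exact U hU n (s := s) (k := k) z hz
    exact ⟨e, (cechD_apply k n _).trans he⟩
  descend k z hz := by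
    rw [cechD_zero, sub_eq_zero] at hz
    exact diffCochain_cech_descend U hU (s := s) (k := k) z hz
  ker_acyclic k z hd hz := by
    obtain ⟨w, hw, hw'⟩ := diffCochain_ker_acyclic U hU (s := s) (k := k) z
      ((congrArg (fun f ↦ f.hom z) (diffComplex_d M s (k + 1))).symm.trans hd) hz
    exact ⟨w, hw, (congrArg (fun f ↦ f.hom w) (diffComplex_d M s k)).trans hw'⟩
  d_injective n := by
    have h : ((diffPresheaf s).obj (op ((cech U).obj n))).d 0 1 =
      AddCommGrpCat.ofHom (DiffCochain.d ((cech U).obj n) s 0) := diffComplex_d _ s 0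
    rw [h]
    exact diffCochain_d_injective hs

end DiffCech

end DiffCocycle

theorem theoremt (s : ℕ) (hs : 0 < s) :
    DiffCocycle.IsTwoStack (DiffCocycle.diffPresheaf.{u} s) := by
  intro M _ I U hU
  exact (DiffCocycle.cechAcyclic_diffPresheaf U hs hU).isBiequivalence_restriction
    (DiffCocycle.face_cechProj U)
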